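/- **Computational model.** Fix a finite alphabet $\Sigma$, a set $L\subseteq\Sigma^*$, a pairing $\langle\cdot,\cdot\rangle:L\times L\to L$, a length $|\cdot|:L\to\mathbb N$ with $|\langle x,y\rangle|=|x|+|y|+cp$ ($cp$ a constant) and $|x|\le\mathrm{length}(x)$, a partial application $(e,x)\mapsto\{e\}(x)\in L$ for $e,x\in L$, a time measure $\mathrm{Time}_e(x)\in\mathbb N$, defined whenever $\{e\}(x)$ is, and an injection $\Phi:\{0,1\}^*\to L$, such that ($O(\cdot)$ denotes upper bounds, and equations for applications and times are required when the applications on the right are defined): - for a fixed polynomial $p$ and every $e$, a Turing machine evaluates $x\mapsto\{e\}(x)$, where defined, in time $p(\mathrm{Time}_e(x)+|e|+|x|)$; - for every Turing machine computing $g:\{0,1\}^*\to\{0,1\}^*$ in time $T$ there is $e\in L$ with $\{e\}(\Phi(x))=\Phi(g(x))$ and $\mathrm{Time}_e(\Phi(x))=O(T(\mathrm{length}(x)))+O(1)$; $\Phi$ and $\Phi^{-1}$ are polynomial-time computable; - for $b\in\{0,1\}$ there is $e_b$ with $\{e_b\}(\Phi(x))=\Phi(bx)$ in time $O(1)$, and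 $|\Phi(bx)|\le|\Phi(x)|+O(1)$; - there are $e_{comp},e_{id},e_{throwfirst},e_{swap},e_{tens},e_{assl},e_{contr},e_{eval},e_{curry}\in L$ and, for every $x\in L$, $e^x_{const},e^x_{tensconst}\in L$ with: - $\{e_{comp}\}(\langle x,y\rangle)=z$ in time $O(1)$, where $|z|\le|x|+|y|+O(1)$, $\{z\}(w)=\{y\}(\{x\}(w))$ and $\mathrm{Time}_z(w)\le\mathrm{Time}_x(w)+\mathrm{Time}_y(\{x\}(w))+O(1)$; - $\{e_{id}\}(x)=x$, $\{e^x_{const}\}(y)=x$, $\{e^x_{tensconst}\}(y)=\langle y,x\rangle$, $\{e_{throwfirst}\}(\langle x,y\rangle)=y$, $\{e_{swap}\}(\langle x,y\rangle)=\langle y,x\rangle$, $\{e_{assl}\}(\langle x,\langle y,z\rangle\rangle)=\langle\langle x,y\rangle,z\rangle$, each in time $O(1)$ (the constant may depend on $x$ for $e^x_{const},e^x_{tensconst}$); $\{e_{contr}\}(x)=\langle x,x\rangle$ in time $O(|x|)+O(1)$; - $\{e_{tens}\}(x)=y$ in time $O(1)$, where $|y|\le|x|+O(1)$, $\{y\}(\langle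 z,w\rangle)=\langle\{x\}(z),w\rangle$ and $\mathrm{Time}_y(\langle z,w\rangle)\le\mathrm{Time}_x(z)+O(1)$; - $\{e_{eval}\}(\langle x,y\rangle)=\{x\}(y)$ in time $\mathrm{Time}_x(y)+O(1)$; - $\{e_{curry}\}(x)=y$ in time $O(1)$, where $|y|\le|x|+O(1)$ and, for every $z$, $c_z=\{y\}(z)$ is defined in time $O(1)$ with $|c_z|\le|y|+|z|+O(1)$, $\{c_z\}(w)=\{x\}(\langle z,w\rangle)$ and $\mathrm{Time}_{c_z}(w)\le\mathrm{Time}_x(\langle z,w\rangle)+O(1)$. **Soft length spaces.** Let $\mathcal I$ be the set of pairs $(l,n)$ of a finite list $l$ of naturals and $n\in\mathbb N$, with $(l,n)+(h,m)=(l+h,\max\{n,m\})$ (lists are added entrywise, the shorter being padded by $0$) and $0=(\mathit{empty},0)$. The relations $\le_e$ ($e\in\mathbb N$) are generated by: - $(\mathit{empty},n)\le_0(\mathit{empty},m)$ iff $n\le m$; - $(\mathit{empty},n)\le_e(\mathrm{cons}(m,l),p)$ iff for some $d\in\mathbb N$, $e\le m+pd$ and $(\mathit{empty},n)\le_d(l,p)$;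 - $(\mathrm{cons}(n,l),m)\le_e(\mathrm{cons}(p,h),q)$ iff for some $d\in\mathbb N$, $e+n\le p+qd$ and $(l,m)\le_d(h,q)$. Put $\alpha\le\beta$ iff $\alpha\le_e\beta$ for some $e$; then $\mathcal D(\alpha,\beta)=\max\{e:\alpha\le_e\beta\}$, $\|\alpha\|=\mathcal D(0,\alpha)$ and $!(l,n)=(\mathrm{cons}(0,l),n)$. A *soft length space* is a set $|A|$ with a relation $\alpha,e\Vdash_A a$ ($\alpha\in\mathcal I$, $e\in L$, $a\in|A|$) such that: $\alpha,e\Vdash a$ implies $|e|\le\|\alpha\|$; every $a$ has some $\alpha,e\Vdash a$; $\alpha,e\Vdash a$ and $\alpha\le\beta$ imply $\beta,e\Vdash a$; $\alpha,e\Vdash a$ and $\alpha,e\Vdash b$ imply $a=b$. - $|A\multimap B|$ is the set of *morphisms* $f:|A|\to|B|$, those with some $\varphi,e\Vdash f$, where $\varphi,e\Vdash f$ means: $|e|\le\|\varphi\|$ and whenever $\alpha,d\Vdash_A a$ there are $\beta,c$ with $\beta,c\Vdash_B f(a)$, $\beta\le\varphi+\alpha$, $\{e\}(d)=c$, $\mathrm{Time}_e(d)\le\mathcal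 D(\beta,\varphi+\alpha)$. - $|A\otimes B|=|A|\times|B|$, with $\alpha,e\Vdash(a,b)$ iff $|e|\le\|\alpha\|$, $e=\langle f,g\rangle$, $\beta,f\Vdash a$, $\gamma,g\Vdash b$ and $\beta+\gamma\le\alpha$ for some $f,g,\beta,\gamma$. $I$ has one element, realised by all $\alpha,e$ with $|e|\le\|\alpha\|$. - $|!A|=|A|$, with $\alpha,e\Vdash_{!A}a$ iff $|e|\le\|\alpha\|$ and $\beta,e\Vdash_A a$ for some $\beta$ with $!\beta\le\alpha$. - $\mathbf B$ is $\{0,1\}^*$ with $\alpha,e\Vdash t$ iff $e=\Phi(t)$ and $|\Phi(t)|\le\|\alpha\|$. **Logic.** SAL (intuitionistic Soft Affine Logic) has formulae $A::=\alpha\mid A\multimap A\mid A\otimes A\mid\forall\alpha.A\mid{!A}$. Its sequents $\Gamma\vdash A$ are derived, modulo exchange, by: identity $A\vdash A$; cut; weakening; the multiplicative left and right rules for $\otimes$ and $\multimap$; $\forall$-left (from $\Gamma,A[C/\alpha]\vdash B$ infer $\Gamma,\forall\alpha.A\vdash B$) and $\forall$-right (from $\Gamma\vdash A$, $\alpha$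 not free in $\Gamma$, infer $\Gamma\vdash\forall\alpha.A$); $P$ (from $\Gamma\vdash A$ infer $!\Gamma\vdash{!A}$); $C$ (from $\Gamma,A,\dots,A\vdash B$, with $n\ge1$ copies of $A$, infer $\Gamma,!A\vdash B$). Given an environment $\eta$ (a soft length space for each atom), formulae are interpreted by $[\![\alpha]\!]_\eta=\eta(\alpha)$, by the above operations, and by letting $|[\![\forall\alpha.A]\!]_\eta|$ be the set of families $(a_C)_C$ with a common realiser $\alpha,e\Vdash a_C$ for all $C$; here $C$ ranges over the soft length spaces whose underlying set is the set of classes of a partial equivalence relation on $L$ (every soft length space is isomorphic to one such), $a_C\in|[\![A]\!]_{\eta[\alpha\to C]}|$, and $\alpha,e\Vdash(a_C)_C$ iff $\alpha,e\Vdash a_C$ for all $C$. Proofs are interpreted as functions in the standard way (cut as composition, $\multimap$-rules as abstraction and application, $C$ as duplication, $P$ as the identity on functions, $\forall$-rules as tupling and projection, up to the canonical isomorphisms). Let $\mathit{List}_{SAL}=\forall\alpha.\,!(\alpha\multimap\alpha)\multimap{!(\alpha\multimap\alpha)}\multimap(\alpha\multimap\alpha)$. A word $w=b_1\cdots b_n\in\{0,1\}^*$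 is represented by the cut-free closed proof $\pi_w=\lambda s_0.\lambda s_1.\lambda x.\,s_{b_1}(\cdots(s_{b_n}x))$ of $\mathit{List}_{SAL}$. **Theorem (soundness).** Let $\pi$ be an SAL proof of $\vdash{!^j\mathit{List}_{SAL}}\multimap{!^k\mathit{List}_{SAL}}$, with $j,k\ge0$, and let $\eta$ be an environment. Then $\pi$ denotes an element $F$ of $|[\![!^j\mathit{List}_{SAL}\multimap{!^k\mathit{List}_{SAL}}]\!]_\eta|$ (in particular, a morphism), and it induces a unique function $f:\{0,1\}^*\to\{0,1\}^*$, namely $f(w)=g(F([\![\pi_w]\!]))$, where $|!^jA|=|A|$ and $g$ is internal application at $\mathbf B$: $g(x)=x_{\mathbf B}(s_0)(s_1)(\varepsilon)$ with $s_b(t)=bt$. This function $f$ is computable by a Turing machine in polynomial time. -/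

import Mathlib

namespace SAL

/-! ## Polynomial time and the abstract computational model -/

/-- `f` is computed by a (multi-stack) Turing machine in polynomial time; words are written on the
input and output stacks as they are. -/
def PolyTime (f : List Bool → List Bool) : Prop :=
  Nonempty (Turing.TM2ComputableInPolyTime (id : List Bool → List Bool)
    (id : List Bool → List Bool) f)

/-- An abstract computational model: a set `L` of words over a finite alphabet with a pairing
function, an abstract length `size`, a partial application `app e x` (the result of algorithm `e`
on input `x`), an abstract time measure `time e x` (meaningful only where `app e x` is defined)
and an embedding `Phi` of binary words.  Every `O(1)` is a constant `c`. -/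
structure CompModel where
  Sym : Type
  [symFintype : Fintype Sym]
  L : Set (List Sym)
  pair : L → L → L
  cp : ℕ
  size : L → ℕ
  app : L → L →. L
  time : L → L → ℕ
  Phi : List Bool → L
  size_pair : ∀ x y, size (pair x y) = size x + size y + cp
  size_le_length : ∀ x : L, size x ≤ (x : List Sym).length
  /-- Application can be evaluated by Turing machines, in time bounded by a fixed polynomial in
  abstract time, length of the algorithm and length of the input. -/
  exists_machine : ∃ p : Polynomial ℕ, ∀ e : L, ∃ M : Turing.TM2ComputableAux Sym Sym,
    ∀ x y : L, y ∈ app e x →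
      Nonempty (Turing.TM2OutputsInTime M.tm (List.map M.inputAlphabet.invFun (x : List Sym))
        (some (List.map M.outputAlphabet.invFun (y : List Sym)))
        (p.eval (time e x + size e + size x)))
  /-- Turing machines are simulated by algorithms with linear overhead. -/
  exists_algorithm : ∀ (g : List Bool → List Bool)
    (M : Turing.TM2ComputableInTime (id : List Bool → List Bool) (id : List Bool → List Bool) g),
    ∃ (e : L) (c : ℕ), ∀ x, Phi (g x) ∈ app e (Phi x) ∧
      time e (Phi x) ≤ c * M.time x.length + c
  Phi_injective : Function.Injective Phi
  /-- `Phi` is computable in polynomial time. -/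
  Phi_polyTime : Nonempty (Turing.TM2ComputableInPolyTime (id : List Bool → List Bool)
    (fun w : List Bool => (Phi w : List Sym)) id)
  /-- The inverse of `Phi` is computable in polynomial time. -/
  Phi_inv_polyTime : Nonempty (Turing.TM2ComputableInPolyTime
    (fun w : List Bool => (Phi w : List Sym)) (id : List Bool → List Bool) id)
  /-- Prepending a letter takes constant time and increases the length by a constant. -/
  exists_succ : ∀ b : Bool, ∃ (e : L) (c : ℕ), ∀ x, Phi (b :: x) ∈ app e (Phi x) ∧
    time e (Phi x) ≤ c ∧ size (Phi (b :: x)) ≤ size (Phi x) + c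
  /-- Composition. -/
  exists_comp : ∃ (e : L) (c : ℕ), ∀ x y, ∃ z ∈ app e (pair x y),
    size z ≤ size x + size y + c ∧ time e (pair x y) ≤ c ∧
    ∀ w u v, u ∈ app x w → v ∈ app y u → v ∈ app z w ∧ time z w ≤ time x w + time y u + c
  /-- Identity. -/
  exists_id : ∃ (e : L) (c : ℕ), ∀ x, x ∈ app e x ∧ time e x ≤ c
  /-- Constants. -/
  exists_const : ∀ x, ∃ (e : L) (c : ℕ), ∀ y, x ∈ app e y ∧ time e y ≤ c
  /-- Pairing with a constant. -/
  exists_tensconst : ∀ x, ∃ (e : L) (c : ℕ), ∀ y, pair y x ∈ app e y ∧ time e y ≤ c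
  /-- Second projection. -/
  exists_throwfirst : ∃ (e : L) (c : ℕ), ∀ x y, y ∈ app e (pair x y) ∧ time e (pair x y) ≤ c
  /-- Swapping. -/
  exists_swap : ∃ (e : L) (c : ℕ), ∀ x y, pair y x ∈ app e (pair x y) ∧ time e (pair x y) ≤ c
  /-- Acting on the first component. -/
  exists_tens : ∃ (e : L) (c : ℕ), ∀ x, ∃ y ∈ app e x, size y ≤ size x + c ∧ time e x ≤ c ∧
    ∀ z w u, u ∈ app x z → pair u w ∈ app y (pair z w) ∧ time y (pair z w) ≤ time x z + c
  /-- Rebracketing. -/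
  exists_assl : ∃ (e : L) (c : ℕ), ∀ x y z,
    pair (pair x y) z ∈ app e (pair x (pair y z)) ∧ time e (pair x (pair y z)) ≤ c
  /-- Duplication. -/
  exists_contr : ∃ (e : L) (c : ℕ), ∀ x, pair x x ∈ app e x ∧ time e x ≤ c * size x + c
  /-- Application. -/
  exists_eval : ∃ (e : L) (c : ℕ), ∀ x y z, z ∈ app x y →
    z ∈ app e (pair x y) ∧ time e (pair x y) ≤ time x y + c
  /-- Currying. -/
  exists_curry : ∃ (e : L) (c : ℕ), ∀ x, ∃ y ∈ app e x, size y ≤ size x + c ∧ time e x ≤ c ∧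
    ∀ z, ∃ cz ∈ app y z, size cz ≤ size y + size z + c ∧ time y z ≤ c ∧
      ∀ w v, v ∈ app x (pair z w) → v ∈ app cz w ∧ time cz w ≤ time x (pair z w) + c

theorem CompModel.pair_inj (K : CompModel) {x y x' y' : K.L} (h : K.pair x y = K.pair x' y') :
    x = x' ∧ y = y' := by
  obtain ⟨e, c, he⟩ := K.exists_throwfirst
  obtain ⟨s, d, hs⟩ := K.exists_swap
  have key : ∀ {a b a' b' : K.L}, K.pair a b = K.pair a' b' → b = b' := by
    intro a b a' b' hab
    have h1 := (he a b).1
    rw [hab] at h1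
    exact Part.mem_unique h1 (he a' b').1
  have h2 := (hs x y).1
  rw [h] at h2
  exact ⟨key (Part.mem_unique h2 (hs x' y').1), key h⟩

/-! ## Resource monoids and length spaces -/

/-- Resource monoids.  The function `dist` is only meaningful on pairs with `le a b`. -/
structure ResourceMonoid where
  carrier : Type
  [addCommMonoid : AddCommMonoid carrier]
  le : carrier → carrier → Prop
  dist : carrier → carrier → ℕ
  le_refl : ∀ a, le a a
  le_trans : ∀ {a b c}, le a b → le b c → le a c
  add_le_add : ∀ {a b} (c : carrier), le a b → le (a + c) (b + c)
  zero_le : ∀ a, le 0 a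
  dist_add_dist_le : ∀ {a b c}, le a b → le b c → dist a b + dist b c ≤ dist a c
  dist_le_dist_add : ∀ {a b} (c : carrier), le a b → dist a b ≤ dist (a + c) (b + c)
  exists_le_dist : ∀ n : ℕ, ∃ a, n ≤ dist 0 a

attribute [instance] ResourceMonoid.addCommMonoid

namespace ResourceMonoid

variable (M : ResourceMonoid)

def norm (a : M.carrier) : ℕ := M.dist 0 a

theorem norm_mono {a b : M.carrier} (h : M.le a b) : M.norm a ≤ M.norm b :=
  _root_.le_trans (Nat.le_add_right _ _) (M.dist_add_dist_le (M.zero_le a) h)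

theorem le_add_right (a b : M.carrier) : M.le a (a + b) := by
  have h := M.add_le_add a (M.zero_le b)
  rwa [zero_add, add_comm b a] at h

theorem le_add_left (a b : M.carrier) : M.le a (b + a) := by
  have h := M.add_le_add a (M.zero_le b)
  rwa [zero_add] at h

theorem dist_mono_right {a b c : M.carrier} (h : M.le a b) (h' : M.le b c) :
    M.dist a b ≤ M.dist a c :=
  _root_.le_trans (Nat.le_add_right _ _) (M.dist_add_dist_le h h')

end ResourceMonoid

/-- A length space structure on the set `X`: `maj a e x` is read "`a`, `e` realise `x`". -/
structure LengthStr (K : CompModel) (M : ResourceMonoid) (X : Type) where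
  maj : M.carrier → K.L → X → Prop
  size_le : ∀ {a e x}, maj a e x → K.size e ≤ M.norm a
  exists_maj : ∀ x, ∃ a e, maj a e x
  mono : ∀ {a b e x}, maj a e x → M.le a b → maj b e x
  unique : ∀ {a e x y}, maj a e x → maj a e y → x = y

/-- Length spaces. -/
structure LengthSpace (K : CompModel) (M : ResourceMonoid) where
  carrier : Type
  str : LengthStr K M carrier

namespace LengthSpace

variable {K : CompModel} {M : ResourceMonoid}

abbrev maj (A : LengthSpace K M) : M.carrier → K.L → A.carrier → Prop := A.str.maj

theorem unique' (A : LengthSpace K M) {a b : M.carrier} {e : K.L} {x y : A.carrier}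
    (hx : A.maj a e x) (hy : A.maj b e y) : x = y :=
  A.str.unique (A.str.mono hx (M.le_add_right a b)) (A.str.mono hy (M.le_add_left b a))

/-- `e` realises the function `f : |A| → |B|` and `φ` majorizes it. -/
def Realizes (A B : LengthSpace K M) (φ : M.carrier) (e : K.L) (f : A.carrier → B.carrier) :
    Prop :=
  K.size e ≤ M.norm φ ∧
  ∀ a d x, A.maj a d x → ∃ b c, B.maj b c (f x) ∧ M.le b (φ + a) ∧
    c ∈ K.app e d ∧ K.time e d ≤ M.dist b (φ + a)

/-- Morphisms of length spaces. -/
def Hom (A B : LengthSpace K M) : Type :=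
  {f : A.carrier → B.carrier // ∃ φ e, Realizes A B φ e f}

/-- The space `A ⊸ B`. -/
def hom (A B : LengthSpace K M) : LengthSpace K M where
  carrier := Hom A B
  str :=
    { maj := fun a e f => Realizes A B a e f.1
      size_le := fun h => h.1
      exists_maj := fun f => f.2
      mono := by
        intro φ ψ e f h hle
        refine ⟨le_trans h.1 (M.norm_mono hle), fun a d x hx => ?_⟩
        obtain ⟨b, c, h1, h2, h3, h4⟩ := h.2 a d x hx
        have h5 := M.add_le_add a hle
        exact ⟨b, c, h1, M.le_trans h2 h5, h3, le_trans h4 (M.dist_mono_right h2 h5)⟩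
      unique := by
        intro φ e f g hf hg
        apply Subtype.ext
        funext x
        obtain ⟨a, d, hx⟩ := A.str.exists_maj x
        obtain ⟨b, c, h1, -, h3, -⟩ := hf.2 a d x hx
        obtain ⟨b', c', h1', -, h3', -⟩ := hg.2 a d x hx
        obtain rfl := Part.mem_unique h3 h3'
        exact B.unique' h1 h1' }

/-- The space `A ⊗ B`. -/
def tensor (A B : LengthSpace K M) : LengthSpace K M where
  carrier := A.carrier × B.carrier
  str :=
    { maj := fun a e x => K.size e ≤ M.norm a ∧ ∃ f g b c,
        A.maj b f x.1 ∧ B.maj c g x.2 ∧ e = K.pair f g ∧ M.le (b + c) a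
      size_le := fun h => h.1
      exists_maj := by
        rintro ⟨x, y⟩
        obtain ⟨b, f, hx⟩ := A.str.exists_maj x
        obtain ⟨c, g, hy⟩ := B.str.exists_maj y
        obtain ⟨n, hn⟩ := M.exists_le_dist (K.size (K.pair f g))
        exact ⟨n + (b + c), K.pair f g, le_trans hn (M.norm_mono (M.le_add_right _ _)),
          f, g, b, c, hx, hy, rfl, M.le_add_left _ _⟩
      mono := by
        rintro a a' e x ⟨h, f, g, b, c, h1, h2, h3, h4⟩ hle
        exact ⟨le_trans h (M.norm_mono hle), f, g, b, c, h1, h2, h3, M.le_trans h4 hle⟩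
      unique := by
        rintro a e ⟨x, y⟩ ⟨x', y'⟩ ⟨-, f, g, b, c, h1, h2, h3, -⟩ ⟨-, f', g', b', c', h1', h2', h3', -⟩
        obtain ⟨rfl, rfl⟩ := K.pair_inj (h3.symm.trans h3')
        exact Prod.ext (A.unique' h1 h1') (B.unique' h2 h2') }

/-- The one-point space `I`. -/
def unit (K : CompModel) (M : ResourceMonoid) : LengthSpace K M where
  carrier := Unit
  str :=
    { maj := fun a e _ => K.size e ≤ M.norm a
      size_le := fun h => h
      exists_maj := fun _ => by
        obtain ⟨a, ha⟩ := M.exists_le_dist (K.size (K.Phi []))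
        exact ⟨a, K.Phi [], ha⟩
      mono := fun h hle => le_trans h (M.norm_mono hle)
      unique := fun _ _ => rfl }

/-- The space of binary words. -/
def bin (K : CompModel) (M : ResourceMonoid) : LengthSpace K M where
  carrier := List Bool
  str :=
    { maj := fun a e t => e = K.Phi t ∧ K.size (K.Phi t) ≤ M.norm a
      size_le := by
        rintro a e t ⟨rfl, h⟩
        exact h
      exists_maj := fun t => by
        obtain ⟨a, ha⟩ := M.exists_le_dist (K.size (K.Phi t))
        exact ⟨a, K.Phi t, rfl, ha⟩
      mono := fun h hle => ⟨h.1, le_trans h.2 (M.norm_mono hle)⟩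
      unique := fun h h' => K.Phi_injective (h.1.symm.trans h'.1) }

end LengthSpace

/-! ### The small family of length spaces over which quantifiers range -/

/-- Partial equivalence relations on `L`. -/
structure PartialEquiv (K : CompModel) where
  rel : K.L → K.L → Prop
  symm : ∀ {e d}, rel e d → rel d e
  trans : ∀ {e d c}, rel e d → rel d c → rel e c

/-- The set of equivalence classes of a partial equivalence relation. -/
def PartialEquiv.Classes {K : CompModel} (P : PartialEquiv K) : Type :=
  {s : Set K.L // ∃ e, P.rel e e ∧ s = {d | P.rel e d}}

/-- Length spaces whose underlying set is the set of classes of a partial equivalence relation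
on `L`. -/
structure SmallSpace (K : CompModel) (M : ResourceMonoid) : Type where
  per : PartialEquiv K
  str : LengthStr K M per.Classes

def SmallSpace.toSpace {K : CompModel} {M : ResourceMonoid} (C : SmallSpace K M) :
    LengthSpace K M := ⟨C.per.Classes, C.str⟩

namespace LengthSpace

variable {K : CompModel} {M : ResourceMonoid}

/-- The realisers of an element. -/
def realizers (A : LengthSpace K M) (x : A.carrier) : Set K.L := {e | ∃ a, A.maj a e x}

/-- Two words are related when they realise a common element. -/
def per (A : LengthSpace K M) : PartialEquiv K where
  rel := fun e d => ∃ x, e ∈ A.realizers x ∧ d ∈ A.realizers x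
  symm := fun ⟨x, h, h'⟩ => ⟨x, h', h⟩
  trans := by
    rintro e d c ⟨x, h1, a, ha⟩ ⟨y, ⟨b, hb⟩, h4⟩
    obtain rfl := A.unique' ha hb
    exact ⟨x, h1, h4⟩

theorem class_eq (A : LengthSpace K M) {e : K.L} {x : A.carrier} (he : e ∈ A.realizers x) :
    {d | A.per.rel e d} = A.realizers x := by
  ext d
  constructor
  · rintro ⟨y, ⟨b, hb⟩, hd⟩
    obtain ⟨a, ha⟩ := he
    obtain rfl := A.unique' ha hb
    exact hd
  · exact fun hd => ⟨x, he, hd⟩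

/-- An element is sent to the class of its realisers. -/
def toClass (A : LengthSpace K M) (x : A.carrier) : A.per.Classes :=
  ⟨A.realizers x, by
    obtain ⟨a, e, h⟩ := A.str.exists_maj x
    exact ⟨e, ⟨x, ⟨a, h⟩, ⟨a, h⟩⟩, (A.class_eq ⟨a, h⟩).symm⟩⟩

theorem toClass_bijective (A : LengthSpace K M) : Function.Bijective A.toClass := by
  constructor
  · intro x y h
    obtain ⟨a, e, hx⟩ := A.str.exists_maj x
    have h1 : e ∈ A.realizers y := by
      have h2 : A.realizers x = A.realizers y := congrArg Subtype.val h
      rw [← h2]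
      exact ⟨a, hx⟩
    obtain ⟨b, hb⟩ := h1
    exact A.unique' hx hb
  · rintro ⟨s, e, ⟨x, hx, hx'⟩, hs⟩
    refine ⟨x, Subtype.ext ?_⟩
    exact ((A.class_eq hx).symm.trans hs.symm)

/-- The small space isomorphic to `A`: elements are replaced by the classes of their realisers. -/
def small (A : LengthSpace K M) : SmallSpace K M where
  per := A.per
  str :=
    { maj := fun a e s => ∃ x, A.toClass x = s ∧ A.maj a e x
      size_le := fun ⟨_, _, h⟩ => A.str.size_le h
      exists_maj := fun s => by
        obtain ⟨x, hx⟩ := A.toClass_bijective.2 s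
        obtain ⟨a, e, h⟩ := A.str.exists_maj x
        exact ⟨a, e, x, hx, h⟩
      mono := fun ⟨x, h, h'⟩ hle => ⟨x, h, A.str.mono h' hle⟩
      unique := by
        rintro a e s t ⟨x, rfl, hx⟩ ⟨y, rfl, hy⟩
        rw [A.str.unique hx hy] }

/-- The isomorphism between `A` and `small A`. -/
noncomputable def smallEquiv (A : LengthSpace K M) : A.carrier ≃ A.small.toSpace.carrier :=
  Equiv.ofBijective A.toClass A.toClass_bijective

/-- The product of a family of spaces indexed by all small spaces `C`, restricted to the families
of elements that have a common realiser. -/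
def prod (F : SmallSpace K M → LengthSpace K M) : LengthSpace K M where
  carrier := {x : (C : SmallSpace K M) → (F C).carrier // ∃ a e, ∀ C, (F C).maj a e (x C)}
  str :=
    { maj := fun a e x => ∀ C, (F C).maj a e (x.1 C)
      size_le := fun h => (F (unit K M).small).str.size_le (h _)
      exists_maj := fun x => x.2
      mono := fun h hle C => (F C).str.mono (h C) hle
      unique := fun h h' => Subtype.ext (funext fun C => (F C).str.unique (h C) (h' C)) }

/-- Elements of two spaces sharing a realiser.  It is only used for spaces that have the same
realisability relation up to the isomorphisms `A ≅ small A`; there it is the graph of the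
isomorphism of the two spaces. -/
def Corr (A B : LengthSpace K M) (x : A.carrier) (y : B.carrier) : Prop :=
  ∃ a e, A.maj a e x ∧ B.maj a e y

end LengthSpace

/-! ## The resource monoid of soft length spaces -/

/-- Sum of lists of natural numbers, the shorter one being padded. -/
def addList : List ℕ → List ℕ → List ℕ
  | [], h => h
  | n :: l, [] => n :: l
  | n :: l, m :: h => (n + m) :: addList l h

theorem addList_nil (l : List ℕ) : addList l [] = l := by
  cases l <;> rfl

theorem addList_comm : ∀ l h, addList l h = addList h l
  | [], [] => rfl
  | [], _ :: _ => rfl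
  | _ :: _, [] => rfl
  | n :: l, m :: h => by simp only [addList, addList_comm l h, add_comm n m]

theorem addList_assoc : ∀ l h j, addList (addList l h) j = addList l (addList h j)
  | [], _, _ => rfl
  | n :: l, [], j => rfl
  | n :: l, m :: h, [] => rfl
  | n :: l, m :: h, k :: j => by simp only [addList, addList_assoc l h j, add_assoc]

/-- Pairs of a list and a number. -/
@[ext]
structure Soft where
  lst : List ℕ
  mul : ℕ

namespace Soft

instance : Add Soft := ⟨fun a b => ⟨addList a.lst b.lst, max a.mul b.mul⟩⟩

instance : Zero Soft := ⟨⟨[], 0⟩⟩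

instance : AddCommMonoid Soft where
  add_assoc a b c := Soft.ext (addList_assoc _ _ _) (max_assoc _ _ _)
  zero_add a := Soft.ext rfl (Nat.zero_max _)
  add_zero a := Soft.ext (addList_nil _) (Nat.max_zero _)
  add_comm a b := Soft.ext (addList_comm _ _) (max_comm _ _)
  nsmul := nsmulRec

theorem add_lst (a b : Soft) : (a + b).lst = addList a.lst b.lst := rfl
theorem add_mul' (a b : Soft) : (a + b).mul = max a.mul b.mul := rfl
theorem zero_lst : (0 : Soft).lst = [] := rfl
theorem zero_mul' : (0 : Soft).mul = 0 := rfl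

/-- `leAux e l n h m` is the relation `(l, n) ≤_e (h, m)`. -/
def leAux : ℕ → List ℕ → ℕ → List ℕ → ℕ → Prop
  | e, [], n, [], m => e = 0 ∧ n ≤ m
  | e, [], n, m :: l, p => ∃ d, e ≤ m + p * d ∧ leAux d [] n l p
  | e, n :: l, m, p :: h, q => ∃ d, e + n ≤ p + q * d ∧ leAux d l m h q
  | _, _ :: _, _, [], _ => False

/-- `a ≤ b` if `a ≤_e b` for some `e`. -/
def le (a b : Soft) : Prop := ∃ e, leAux e a.lst a.mul b.lst b.mul

/-- The recursive definition of the difference; the truncated subtraction in the third clause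
is exact whenever `(n :: l, m) ≤ (p :: h, q)`. -/
def distAux : List ℕ → ℕ → List ℕ → ℕ → ℕ
  | [], _, [], _ => 0
  | [], n, m :: l, p => m + p * distAux [] n l p
  | n :: l, m, p :: h, q => (p + q * distAux l m h q) - n
  | _ :: _, _, [], _ => 0

def dist (a b : Soft) : ℕ := distAux a.lst a.mul b.lst b.mul

/-- `!(l, n) = (0 :: l, n)`. -/
def bang (a : Soft) : Soft := ⟨0 :: a.lst, a.mul⟩

theorem leAux_le_dist : ∀ {l h : List ℕ} {e n m}, leAux e l n h m → e ≤ distAux l n h m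
  | [], [], e, n, m, hh => by simp only [leAux] at hh; simp [distAux, hh.1]
  | [], k :: h, e, n, m, hh => by
      simp only [leAux] at hh
      obtain ⟨d, h1, h2⟩ := hh
      have h3 := Nat.mul_le_mul_left m (leAux_le_dist h2)
      simp only [distAux]
      omega
  | k :: l, [], e, n, m, hh => by simp only [leAux] at hh
  | k :: l, j :: h, e, n, m, hh => by
      simp only [leAux] at hh
      obtain ⟨d, h1, h2⟩ := hh
      have h3 := Nat.mul_le_mul_left m (leAux_le_dist h2)
      simp only [distAux]
      omega

theorem leAux_dist : ∀ {l h : List ℕ} {e n m}, leAux e l n h m →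
    leAux (distAux l n h m) l n h m
  | [], [], e, n, m, hh => by simp only [leAux] at hh; simp [leAux, distAux, hh.2]
  | [], k :: h, e, n, m, hh => by
      simp only [leAux] at hh
      obtain ⟨d, h1, h2⟩ := hh
      simp only [leAux]
      exact ⟨_, by simp only [distAux]; exact _root_.le_refl _, leAux_dist h2⟩
  | k :: l, [], e, n, m, hh => by simp only [leAux] at hh
  | k :: l, j :: h, e, n, m, hh => by
      simp only [leAux] at hh
      obtain ⟨d, h1, h2⟩ := hh
      have h3 := Nat.mul_le_mul_left m (leAux_le_dist h2)
      simp only [leAux]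
      exact ⟨_, by simp only [distAux]; omega, leAux_dist h2⟩

theorem leAux_refl : ∀ (l : List ℕ) {n m : ℕ}, n ≤ m → leAux 0 l n l m
  | [], n, m, h => by simp [leAux, h]
  | k :: l, n, m, h => by
      simp only [leAux]
      exact ⟨0, by omega, leAux_refl l h⟩

theorem zero_leAux : ∀ (l : List ℕ) {n m : ℕ}, n ≤ m → leAux 0 [] n l m
  | [], n, m, h => by simp [leAux, h]
  | k :: l, n, m, h => by
      simp only [leAux]
      exact ⟨0, by omega, zero_leAux l h⟩

theorem leAux_mul_le : ∀ {l h : List ℕ} {e n m}, leAux e l n h m → n ≤ m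
  | [], [], e, n, m, hh => by simp only [leAux] at hh; exact hh.2
  | [], k :: h, e, n, m, hh => by
      simp only [leAux] at hh
      obtain ⟨d, -, h2⟩ := hh
      exact leAux_mul_le h2
  | k :: l, [], e, n, m, hh => by simp only [leAux] at hh
  | k :: l, j :: h, e, n, m, hh => by
      simp only [leAux] at hh
      obtain ⟨d, -, h2⟩ := hh
      exact leAux_mul_le h2

theorem leAux_trans : ∀ {l h j : List ℕ} {e d n m k}, leAux e l n h m → leAux d h m j k →
    leAux (e + d) l n j k
  | [], [], [], e, d, n, m, k, h1, h2 => by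
      simp only [leAux] at h1 h2 ⊢
      omega
  | [], [], a :: j, e, d, n, m, k, h1, h2 => by
      have h1' := h1
      simp only [leAux] at h1' h2 ⊢
      obtain ⟨c, h3, h4⟩ := h2
      refine ⟨c, by omega, ?_⟩
      have h5 : leAux 0 [] n [] m := by simp [leAux, h1'.2]
      simpa using leAux_trans h5 h4
  | [], a :: h, [], e, d, n, m, k, h1, h2 => by simp only [leAux] at h2
  | [], a :: h, b :: j, e, d, n, m, k, h1, h2 => by
      have hmk := leAux_mul_le h2
      simp only [leAux] at h1 h2 ⊢
      obtain ⟨c, h3, h4⟩ := h1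
      obtain ⟨c', h5, h6⟩ := h2
      refine ⟨c + c', ?_, leAux_trans h4 h6⟩
      have h7 := Nat.mul_le_mul_right c hmk
      rw [Nat.mul_add]
      omega
  | a :: l, [], j, e, d, n, m, k, h1, h2 => by simp only [leAux] at h1
  | a :: l, b :: h, [], e, d, n, m, k, h1, h2 => by simp only [leAux] at h2
  | a :: l, b :: h, c :: j, e, d, n, m, k, h1, h2 => by
      have hmk := leAux_mul_le h2
      simp only [leAux] at h1 h2 ⊢
      obtain ⟨c, h3, h4⟩ := h1
      obtain ⟨c', h5, h6⟩ := h2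
      refine ⟨c + c', ?_, leAux_trans h4 h6⟩
      have h7 := Nat.mul_le_mul_right c hmk
      rw [Nat.mul_add]
      omega

theorem leAux_max : ∀ {l h : List ℕ} {e n m} (s : ℕ), leAux e l n h m →
    leAux e l (max n s) h (max m s)
  | [], [], e, n, m, s, hh => by simp only [leAux] at hh ⊢; omega
  | [], k :: h, e, n, m, s, hh => by
      simp only [leAux] at hh ⊢
      obtain ⟨d, h1, h2⟩ := hh
      have h3 := Nat.mul_le_mul_right d (le_max_left m s)
      exact ⟨d, by omega, leAux_max s h2⟩
  | k :: l, [], e, n, m, s, hh => by simp only [leAux] at hh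
  | k :: l, j :: h, e, n, m, s, hh => by
      simp only [leAux] at hh ⊢
      obtain ⟨d, h1, h2⟩ := hh
      have h3 := Nat.mul_le_mul_right d (le_max_left m s)
      exact ⟨d, by omega, leAux_max s h2⟩

theorem leAux_add : ∀ {l h : List ℕ} (j : List ℕ) {e n m} (s : ℕ), leAux e l n h m →
    leAux e (addList l j) (max n s) (addList h j) (max m s)
  | l, h, [], e, n, m, s, hh => by
      rw [addList_nil, addList_nil]
      exact leAux_max s hh
  | [], [], r :: j, e, n, m, s, hh => by
      simp only [leAux] at hh
      obtain ⟨rfl, h2⟩ := hh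
      exact leAux_refl _ (by omega)
  | [], k :: h, r :: j, e, n, m, s, hh => by
      simp only [leAux] at hh
      obtain ⟨d, h1, h2⟩ := hh
      have h3 := Nat.mul_le_mul_right d (le_max_left m s)
      have h4 := leAux_add j s h2
      simp only [addList, leAux] at h4 ⊢
      exact ⟨d, by omega, h4⟩
  | k :: l, [], r :: j, e, n, m, s, hh => by simp only [leAux] at hh
  | k :: l, i :: h, r :: j, e, n, m, s, hh => by
      simp only [leAux] at hh
      obtain ⟨d, h1, h2⟩ := hh
      have h3 := Nat.mul_le_mul_right d (le_max_left m s)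
      simp only [addList, leAux]
      exact ⟨d, by omega, leAux_add j s h2⟩

end Soft

/-- The resource monoid of soft length spaces. -/
abbrev softMonoid : ResourceMonoid where
  carrier := Soft
  le := Soft.le
  dist := Soft.dist
  le_refl a := ⟨0, Soft.leAux_refl _ (le_refl _)⟩
  le_trans := fun ⟨_, h⟩ ⟨_, h'⟩ => ⟨_, Soft.leAux_trans h h'⟩
  add_le_add := fun c ⟨e, h⟩ => ⟨e, Soft.leAux_add c.lst c.mul h⟩
  zero_le a := ⟨0, Soft.zero_leAux _ (Nat.zero_le _)⟩
  dist_add_dist_le := fun ⟨_, h⟩ ⟨_, h'⟩ =>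
    Soft.leAux_le_dist (Soft.leAux_trans (Soft.leAux_dist h) (Soft.leAux_dist h'))
  dist_le_dist_add := fun c ⟨_, h⟩ =>
    Soft.leAux_le_dist (Soft.leAux_add c.lst c.mul (Soft.leAux_dist h))
  exists_le_dist n := ⟨⟨[n], 0⟩, by
    simp [Soft.dist, Soft.distAux]⟩

/-- Soft length spaces. -/
abbrev SoftSpace (K : CompModel) : Type 1 := LengthSpace K softMonoid

/-- The soft length space `!A`. -/
def SoftSpace.bang {K : CompModel} (A : SoftSpace K) : SoftSpace K where
  carrier := A.carrier
  str :=
    { maj := fun a e x => K.size e ≤ softMonoid.norm a ∧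
        ∃ b : Soft, A.maj b e x ∧ softMonoid.le b.bang a
      size_le := fun h => h.1
      exists_maj := fun x => by
        obtain ⟨b, e, h⟩ := A.str.exists_maj x
        exact ⟨(b : Soft) + Soft.bang b, e,
          le_trans (A.str.size_le h) (softMonoid.norm_mono (softMonoid.le_add_right _ _)),
          b, h, softMonoid.le_add_left _ _⟩
      mono := fun ⟨h, b, h1, h2⟩ hle =>
        ⟨le_trans h (softMonoid.norm_mono hle), b, h1, softMonoid.le_trans h2 hle⟩
      unique := fun ⟨_, _, h1, _⟩ ⟨_, _, h1', _⟩ => A.unique' h1 h1' }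

/-! ## Formulae and proofs of Soft Affine Logic -/

/-- Formulae, with de Bruijn indices for atoms: `all A` binds index `0` in `A`. -/
inductive Formula : Type
  | atom (n : ℕ)
  | limp (A B : Formula)
  | tens (A B : Formula)
  | all (A : Formula)
  | bang (A : Formula)

namespace Formula

/-- A renaming under a binder. -/
def upRen (r : ℕ → ℕ) : ℕ → ℕ
  | 0 => 0
  | n + 1 => r n + 1

def rename : (ℕ → ℕ) → Formula → Formula
  | r, atom n => atom (r n)
  | r, limp A B => limp (rename r A) (rename r B)
  | r, tens A B => tens (rename r A) (rename r B)
  | r, all A => all (rename (upRen r) A)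
  | r, bang A => bang (rename r A)

/-- The formula `A` in a context with one more atom, with index `0`, that does not occur in it. -/
def shift (A : Formula) : Formula := rename Nat.succ A

/-- A substitution under a binder. -/
def upSubst (s : ℕ → Formula) : ℕ → Formula
  | 0 => atom 0
  | n + 1 => shift (s n)

def subst : (ℕ → Formula) → Formula → Formula
  | s, atom n => s n
  | s, limp A B => limp (subst s A) (subst s B)
  | s, tens A B => tens (subst s A) (subst s B)
  | s, all A => all (subst (upSubst s) A)
  | s, bang A => bang (subst s A)

/-- `A[C/α]`, where `α` is the atom of index `0`. -/
def inst (A C : Formula) : Formula :=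
  subst (fun n => match n with
    | 0 => C
    | n + 1 => atom n) A

/-- `!^n A`. -/
def bangN : ℕ → Formula → Formula
  | 0, A => A
  | n + 1, A => bang (bangN n A)

/-- The formula `α ⊸ α`. -/
def endo : Formula := limp (atom 0) (atom 0)

/-- `∀α. !(α ⊸ α) ⊸ !(α ⊸ α) ⊸ (α ⊸ α)`. -/
def listSAL : Formula := all (limp (bang endo) (limp (bang endo) endo))

end Formula

open Formula

/-- Proofs of Soft Affine Logic.  A context `A₁, …, Aₙ` is the list `[Aₙ, …, A₁]`, so that
`Γ, A` is `A :: Γ` and `Γ, Δ` is `Δ ++ Γ`.  The rule `exch` moves a formula to an arbitrary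
position; it generates all permutations of contexts. -/
inductive Proof : List Formula → Formula → Type
  | ax (A : Formula) : Proof [A] A
  | cut {Γ Δ A B} : Proof Γ A → Proof (A :: Δ) B → Proof (Δ ++ Γ) B
  | weak {Γ A} (B : Formula) : Proof Γ A → Proof (B :: Γ) A
  | exch (A : Formula) (Γ Δ : List Formula) {B} :
      Proof (A :: (Γ ++ Δ)) B → Proof (Γ ++ A :: Δ) B
  | tensL {Γ A B C} : Proof (B :: A :: Γ) C → Proof (tens A B :: Γ) C
  | tensR {Γ Δ A B} : Proof Γ A → Proof Δ B → Proof (Δ ++ Γ) (tens A B)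
  | limpL {Γ Δ A B C} : Proof Γ A → Proof (B :: Δ) C → Proof (limp A B :: (Δ ++ Γ)) C
  | limpR {Γ A B} : Proof (A :: Γ) B → Proof Γ (limp A B)
  | allL {Γ A B} (C : Formula) : Proof (inst A C :: Γ) B → Proof (all A :: Γ) B
  | allR {Γ A} : Proof (Γ.map shift) A → Proof Γ (all A)
  | prom {Γ A} : Proof Γ A → Proof (Γ.map bang) (bang A)
  | contr {Γ A B} (n : ℕ) :
      Proof (List.replicate (n + 1) A ++ Γ) B → Proof (bang A :: Γ) B

/-! ### The proofs representing binary words -/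

namespace Proof

/-- Contraction of `n ≥ 1` copies, or weakening for `n = 0`. -/
def contrWeak {Γ A B} : (n : ℕ) → Proof (List.replicate n A ++ Γ) B → Proof (bang A :: Γ) B
  | 0, π => weak (bang A) π
  | n + 1, π => contr n π

/-- The number of occurrences of `b` in a word. -/
def occ (b : Bool) : List Bool → ℕ
  | [] => 0
  | c :: w => match b, c with
    | false, false => occ b w + 1
    | true, true => occ b w + 1
    | _, _ => occ b w

/-- The proof `s_{b₁} (⋯ (s_{bₙ} x))` of `α` from `x : α` and one assumption `α ⊸ α` for each
letter of `w = b₁ ⋯ bₙ`; the assumptions for the letter `0` (`false`) and those for the letter `1`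
(`true`) are grouped together. -/
def chain : (w : List Bool) →
    Proof (List.replicate (occ true w) endo ++ (List.replicate (occ false w) endo ++ [atom 0]))
      (atom 0)
  | [] => ax (atom 0)
  | true :: w => limpL (Δ := []) (chain w) (ax (atom 0))
  | false :: w => exch endo (List.replicate (occ true w) endo)
      (List.replicate (occ false w) endo ++ [atom 0])
      (limpL (Δ := []) (chain w) (ax (atom 0)))

/-- The cut-free proof `λ s₀. λ s₁. λ x. s_{b₁} (⋯ (s_{bₙ} x))` representing `w = b₁ ⋯ bₙ`. -/
def word (w : List Bool) : Proof [] listSAL :=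
  allR (Γ := []) (limpR (limpR (limpR
    (exch (bang endo) [atom 0] [bang endo]
      (exch (bang endo) [bang endo, atom 0] []
        (contrWeak (occ false w)
          (exch (bang endo) (List.replicate (occ false w) endo) [atom 0]
            (contrWeak (occ true w) (chain w)))))))))

end Proof

/-! ## Realisability semantics -/

variable {K : CompModel}

/-- Extension of an environment: index `0` is sent to `C`. -/
def extend (C : SmallSpace K softMonoid) (η : ℕ → SoftSpace K) : ℕ → SoftSpace K
  | 0 => C.toSpace
  | n + 1 => η n

/-- The realisability semantics of formulae. -/
def sem : Formula → (ℕ → SoftSpace K) → SoftSpace K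
  | atom n, η => η n
  | limp A B, η => LengthSpace.hom (sem A η) (sem B η)
  | tens A B, η => LengthSpace.tensor (sem A η) (sem B η)
  | all A, η => LengthSpace.prod fun C => sem A (extend C η)
  | bang A, η => SoftSpace.bang (sem A η)

/-- The realisability semantics of contexts. -/
def semCtx (η : ℕ → SoftSpace K) : List Formula → SoftSpace K
  | [] => LengthSpace.unit K softMonoid
  | A :: Γ => LengthSpace.tensor (semCtx η Γ) (sem A η)

/-- The elements of the interpretation of a formula or of a context. -/
abbrev El (η : ℕ → SoftSpace K) (A : Formula) : Type := (sem A η).carrier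

abbrev Ctx (η : ℕ → SoftSpace K) (Γ : List Formula) : Type := (semCtx η Γ).carrier

section

variable {η : ℕ → SoftSpace K}

def Ctx.cons {Γ : List Formula} {A : Formula} (γ : Ctx η Γ) (a : El η A) : Ctx η (A :: Γ) :=
  (γ, a)

def Ctx.head {Γ : List Formula} {A : Formula} (γ : Ctx η (A :: Γ)) : El η A := γ.2

def Ctx.tail {Γ : List Formula} {A : Formula} (γ : Ctx η (A :: Γ)) : Ctx η Γ := γ.1

/-- The two halves of an element of the interpretation of `Δ ++ Γ`. -/
def Ctx.left : (Δ : List Formula) → {Γ : List Formula} → Ctx η (Δ ++ Γ) → Ctx η Δ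
  | [], _, _ => ()
  | A :: Δ, Γ, γ => Ctx.cons (A := A) (Ctx.left Δ (Γ := Γ) γ.1) γ.2

def Ctx.right : (Δ : List Formula) → {Γ : List Formula} → Ctx η (Δ ++ Γ) → Ctx η Γ
  | [], _, γ => γ
  | _ :: Δ, Γ, γ => Ctx.right Δ (Γ := Γ) γ.1

def Ctx.append : (Δ : List Formula) → {Γ : List Formula} → Ctx η Δ → Ctx η Γ → Ctx η (Δ ++ Γ)
  | [], _, _, γ => γ
  | A :: Δ, Γ, δ, γ => Ctx.cons (Γ := Δ ++ Γ) (A := A) (Ctx.append Δ δ.1 γ) δ.2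

/-- `n` copies of the same element. -/
def Ctx.copies {A : Formula} (a : El η A) : (n : ℕ) → Ctx η (List.replicate n A)
  | 0 => ()
  | n + 1 => Ctx.cons (Γ := List.replicate n A) (Ctx.copies a n) a

/-- `A` and `!A` have the same elements. -/
def Ctx.unbang : (Γ : List Formula) → Ctx η (Γ.map bang) → Ctx η Γ
  | [], _ => ()
  | A :: Γ, γ => Ctx.cons (A := A) (Ctx.unbang Γ γ.1) γ.2

/-- `!^n A` and `A` have the same elements. -/
def El.unbang {A : Formula} : (n : ℕ) → El η (bangN n A) → El η A
  | 0, a => a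
  | n + 1, a => El.unbang n (show El η (bangN n A) from a)

/-- Application of an element of `A ⊸ B`. -/
def El.app {A B : Formula} (f : El η (limp A B)) (a : El η A) : El η B := Subtype.val f a

/-- The component at `C` of an element of a product. -/
def El.at {A : Formula} (x : El η (all A)) (C : SmallSpace K softMonoid) : El (extend C η) A :=
  Subtype.val x C

/-- Corresponding elements of a context in the environments `η` and `η[α ↦ C]`, where `α` is not
free in the context. -/
def Ctx.Shifted (C : SmallSpace K softMonoid) : (Γ : List Formula) → Ctx η Γ →
    Ctx (extend C η) (Γ.map shift) → Prop
  | [], _, _ => True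
  | A :: Γ, γ, γ' => Ctx.Shifted C Γ γ.1 γ'.1 ∧
      LengthSpace.Corr (sem A η) (sem (shift A) (extend C η)) γ.2 γ'.2

end

/-- The interpretation of a proof of `Γ ⊢ A`, as the graph of a function from the elements of
`Γ` to those of `A`: `Den π η γ a` says that the function maps `γ` to `a`. -/
def Den : {Γ : List Formula} → {A : Formula} → Proof Γ A → (η : ℕ → SoftSpace K) →
    Ctx η Γ → El η A → Prop
  | _, _, .ax _, _, γ, a => a = γ.head
  | _, _, .cut (Δ := Δ) π ρ, η, γ, b =>
      ∃ a, Den π η (Ctx.right Δ γ) a ∧ Den ρ η ((Ctx.left Δ γ).cons a) b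
  | _, _, .weak _ π, η, γ, a => Den π η γ.tail a
  | _, _, .exch A Γ Δ π, η, γ, b =>
      Den π η
        (Ctx.cons (A := A) (Γ := Γ ++ Δ)
          (Ctx.append Γ (Ctx.left Γ γ) (Ctx.right Γ (Γ := A :: Δ) γ).tail)
          (Ctx.right Γ (Γ := A :: Δ) γ).head) b
  | _, _, .tensL (A := A) (B := B) π, η, γ, c =>
      Den π η ((γ.tail.cons (A := A) (Prod.fst γ.head)).cons (A := B) (Prod.snd γ.head)) c
  | _, _, .tensR (Δ := Δ) π ρ, η, γ, p =>
      Den π η (Ctx.right Δ γ) (Prod.fst p) ∧ Den ρ η (Ctx.left Δ γ) (Prod.snd p)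
  | _, _, .limpL (Γ := Γ) (Δ := Δ) π ρ, η, γ, c =>
      ∃ a, Den π η (Ctx.right Δ (Γ := Γ) γ.tail) a ∧
        Den ρ η ((Ctx.left Δ (Γ := Γ) γ.tail).cons (El.app γ.head a)) c
  | _, _, .limpR π, η, γ, f => ∀ a, Den π η (γ.cons a) (El.app f a)
  | _, _, .allL (A := A) C π, η, γ, b =>
      ∃ y : El η (inst A C),
        LengthSpace.Corr (sem A (extend (sem C η).small η)) (sem (inst A C) η)
          (El.at γ.head (sem C η).small) y ∧
        Den π η (γ.tail.cons y) b
  | _, _, .allR (Γ := Γ) π, η, γ, x =>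
      ∀ C, ∃ γ', Ctx.Shifted C Γ γ γ' ∧ Den π (extend C η) γ' (El.at x C)
  | _, _, .prom (Γ := Γ) π, η, γ, a => Den π η (Ctx.unbang Γ γ) a
  | _, _, .contr (Γ := Γ) (A := A) n π, η, γ, b =>
      Den π η (Ctx.append (List.replicate (n + 1) A) (Γ := Γ)
        (Ctx.copies (A := A) γ.head (n + 1)) γ.tail) b

/-! ## The function induced by a proof -/

theorem norm_singleton (n : ℕ) : softMonoid.norm (⟨[n], 0⟩ : Soft) = n := by
  simp [ResourceMonoid.norm, Soft.dist, Soft.distAux]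

theorem norm_add_le (M : ResourceMonoid) (x y : M.carrier) : M.norm x + M.norm y ≤ M.norm (x + y) := by
  have h1 := M.dist_le_dist_add y (M.zero_le x)
  have h2 := M.dist_add_dist_le (M.zero_le y) (M.le_add_left y x)
  rw [zero_add] at h1
  exact le_trans (by rw [Nat.add_comm]; exact Nat.add_le_add_left h1 _) h2

open LengthSpace in
/-- Prepending the letter `b`, as a morphism on the small copy of the space of binary words. -/
noncomputable def succ (b : Bool) :
    Hom (bin K softMonoid).small.toSpace (bin K softMonoid).small.toSpace :=
  ⟨fun s => (bin K softMonoid).smallEquiv (b :: (bin K softMonoid).smallEquiv.symm s), by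
    obtain ⟨e, c, he⟩ := K.exists_succ b
    refine ⟨(⟨[c], 0⟩ + ⟨[c + K.size e], 0⟩ : Soft), e, ?_, ?_⟩
    · refine le_trans ?_ (norm_add_le softMonoid _ _)
      rw [norm_singleton, norm_singleton]
      omega
    · rintro a d s ⟨t, rfl, rfl, ht⟩
      have hs : (bin K softMonoid).smallEquiv.symm ((bin K softMonoid).toClass t) = t :=
        (bin K softMonoid).smallEquiv.symm_apply_apply t
      have h0 := norm_add_le softMonoid (⟨[c + K.size e], 0⟩ : Soft) a
      have h1 := softMonoid.dist_le_dist_add ((⟨[c + K.size e], 0⟩ : Soft) + a)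
        (softMonoid.zero_le (⟨[c], 0⟩ : Soft))
      rw [zero_add, ← add_assoc] at h1
      rw [norm_singleton] at h0
      obtain ⟨hm, htime, hsize⟩ := he t
      refine ⟨(⟨[c + K.size e], 0⟩ : Soft) + a, K.Phi (b :: t), ⟨b :: t,
        congrArg (fun u : List Bool => (bin K softMonoid).toClass (b :: u)) hs.symm, rfl, by omega⟩,
        ?_, hm, ?_⟩
      · rw [add_assoc]
        exact softMonoid.le_add_left _ _
      · have h2 : softMonoid.dist 0 (⟨[c], 0⟩ : Soft) = c := norm_singleton c
        rw [h2] at h1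
        exact le_trans htime h1⟩

/-- The map from the space of lists to binary words given by internal application to the two
successor morphisms and the empty word, at the space of binary words. -/
noncomputable def readOut {η : ℕ → SoftSpace K} (x : El η listSAL) : List Bool :=
  let B := LengthSpace.bin K softMonoid
  let step (b : Bool) : El (extend B.small η) (bang endo) := succ b
  let y : El (extend B.small η) (limp (bang endo) (limp (bang endo) endo)) := El.at x B.small
  let z : El (extend B.small η) endo := El.app (El.app y (step false)) (step true)
  B.smallEquiv.symm (El.app z (B.smallEquiv []))

/-- `f` is induced by the interpretation of `π`: the proof `π` denotes a morphism `F`, and on every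
word `w` the value `f w` is obtained by applying `F` to the interpretation of the closed proof
representing `w`, and reading out the result. -/
def Induces {j k : ℕ} (η : ℕ → SoftSpace K)
    (π : Proof [] (limp (bangN j listSAL) (bangN k listSAL))) (f : List Bool → List Bool) : Prop :=
  ∃ F : El η (limp (bangN j listSAL) (bangN k listSAL)), Den π η () F ∧
    ∀ w, ∃ x : El η (bangN j listSAL), Den (Proof.word w) η () (El.unbang j x) ∧
      f w = readOut (El.unbang k (El.app F x))

end SAL

/-! A proof is realised by an algorithm whose running time is bounded by a distance in the resource
monoid. The norm of $(l,n)$ is $\sum_i l_i n^i$. A word of length $N$ has a majorizer whose entries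
and multiplicity are linear in $N$, and whose number of entries does not depend on the word. Hence
times are polynomial in $N$.

Soundness. By induction on proofs, `soundness` shows that `Den` is the graph of a family of
functions, one for each environment, with one majorizer and one algorithm for the whole family
(`Uniform`). This uniformity is what $\forall$-right needs. Two rules depend on the soft monoid. For
$\forall$-right, the majorizers of the results may vary with $C$; `Soft.exists_sub` provides a
largest $\beta$ with $\beta\le_t\alpha$, which serves all $C$ at once. For contraction,
`Soft.leBy_smul` says that $!\beta$ together with multiplicity $N$ dominates $r\beta$ for $r\le N$,
with a surplus; the time for copying, linear in the size of the copied realiser, is paid by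
additional copies of $\beta$ (`exists_uniform_dup`).

Words. The code `U w` iterates two given codes along $w$. A fixed algorithm `V` curries it twice and
yields a realiser of the denotation of $\pi_w$ with majorizer $([m],m)$, $m$ linear in $|w|$: the
multiplicity pays for using each $s_b$ up to $|w|$ times (`exists_word_realizers`,
`exists_realizer_listSAL`). After $j$ promotions the majorizer is $([m,\dots,m],m)$ with $j+1$
entries. Adding the fixed majorizer of "apply $F$ and read out" gives an element whose norm is
polynomially bounded in $|w|$ (`exists_polynomial_distAux`), and this norm bounds the time.

Machines. Realisers of words lie in $L$, not necessarily in the range of $\Phi$, so they have to be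
produced from the input. A fixed algorithm `E b` turns `U w` into `U (w ++ [b])` in constant time. A
machine (`Driver`) therefore starts from `U []`, runs `E b` for each input letter $b$, then the
algorithm that computes $\Phi(f(w))$, then $\Phi^{-1}$. The time of every call of an algorithm of
the model is bounded through the abstract size of `U w`, which is linear in $|w|$, and not through
the length of the word on the stack. So the true lengths grow by a polynomial amount per letter and
do not compound. -/

namespace SAL

/-! ## Graded order of a resource monoid -/

namespace ResourceMonoid

variable (M : ResourceMonoid)

/-- The graded relation `a ≤_t b`. -/
def LeBy (t : ℕ) (a b : M.carrier) : Prop := M.le a b ∧ t ≤ M.dist a b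

variable {M} {s t n : ℕ} {a b c d : M.carrier}

theorem LeBy.refl (a : M.carrier) : M.LeBy 0 a a := ⟨M.le_refl a, Nat.zero_le _⟩

theorem LeBy.trans (h : M.LeBy s a b) (h' : M.LeBy t b c) : M.LeBy (s + t) a c :=
  ⟨M.le_trans h.1 h'.1,
    _root_.le_trans (Nat.add_le_add h.2 h'.2) (M.dist_add_dist_le h.1 h'.1)⟩

theorem LeBy.mono (h : M.LeBy t a b) (hs : s ≤ t) : M.LeBy s a b := ⟨h.1, hs.trans h.2⟩

theorem LeBy.add_right (h : M.LeBy t a b) (c : M.carrier) : M.LeBy t (a + c) (b + c) :=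
  ⟨M.add_le_add c h.1, h.2.trans (M.dist_le_dist_add c h.1)⟩

theorem LeBy.add_left (h : M.LeBy t a b) (c : M.carrier) : M.LeBy t (c + a) (c + b) := by
  rw [add_comm c a, add_comm c b]
  exact h.add_right c

theorem LeBy.add (h : M.LeBy s a b) (h' : M.LeBy t c d) : M.LeBy (s + t) (a + c) (b + d) :=
  (h.add_right c).trans (h'.add_left b)

theorem LeBy.of_le (h : M.le a b) : M.LeBy 0 a b := ⟨h, Nat.zero_le _⟩

theorem LeBy.of_norm (h : n ≤ M.norm a) : M.LeBy n 0 a := ⟨M.zero_le a, h⟩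

/-- Distances from zero add up along a chain. This is how a time bound given by a distance becomes a
bound by the norm of the majorizer. -/
theorem LeBy.norm_le (h : M.LeBy t a b) : t + M.norm a ≤ M.norm b := by
  have h1 := ((LeBy.of_norm (_root_.le_refl (M.norm a))).trans h).2
  rw [Nat.add_comm]
  exact h1

/-- An additional summand of norm `n` pays for `n` units of time. -/
theorem LeBy.add_norm (h : n ≤ M.norm c) (a : M.carrier) : M.LeBy n a (c + a) := by
  have h1 := (LeBy.of_norm h).add_right a
  rwa [zero_add] at h1

/-- An element of norm at least `n`. -/
noncomputable def const (M : ResourceMonoid) (n : ℕ) : M.carrier :=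
  Classical.choose (M.exists_le_dist n)

theorem le_norm_const (M : ResourceMonoid) (n : ℕ) : n ≤ M.norm (M.const n) :=
  Classical.choose_spec (M.exists_le_dist n)

end ResourceMonoid

open ResourceMonoid

/-! ## Evaluation of algorithms in bounded time -/

namespace CompModel

variable (K : CompModel)

/-- `K.Eval e x y t`: the algorithm `e` maps `x` to `y` in time at most `t`. -/
def Eval (e x y : K.L) (t : ℕ) : Prop := y ∈ K.app e x ∧ K.time e x ≤ t

variable {K}

theorem Eval.mono {e x y : K.L} {s t : ℕ} (h : K.Eval e x y s) (hst : s ≤ t) : K.Eval e x y t :=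
  ⟨h.1, h.2.trans hst⟩

theorem Eval.unique {e x y z : K.L} {s t : ℕ} (h : K.Eval e x y s) (h' : K.Eval e x z t) :
    y = z := Part.mem_unique h.1 h'.1

theorem exists_comp_code (e d : K.L) : ∃ (z : K.L) (k : ℕ), ∀ w u v s t,
    K.Eval e w u s → K.Eval d u v t → K.Eval z w v (s + t + k) := by
  obtain ⟨_, k, h⟩ := K.exists_comp
  obtain ⟨z, -, -, -, hz⟩ := h e d
  refine ⟨z, k, fun w u v s t h1 h2 => ?_⟩
  obtain ⟨h3, h4⟩ := hz w u v h1.1 h2.1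
  exact ⟨h3, h4.trans (by have := h1.2; have := h2.2; omega)⟩

theorem exists_tens_code (e : K.L) : ∃ (z : K.L) (k : ℕ), ∀ x u w t,
    K.Eval e x u t → K.Eval z (K.pair x w) (K.pair u w) (t + k) := by
  obtain ⟨_, k, h⟩ := K.exists_tens
  obtain ⟨z, -, -, -, hz⟩ := h e
  refine ⟨z, k, fun x u w t h1 => ?_⟩
  obtain ⟨h3, h4⟩ := hz x w u h1.1
  exact ⟨h3, h4.trans (Nat.add_le_add_right h1.2 k)⟩

/-- Swapping and rebracketing alternately:
$((x,y),z)\mapsto(z,(x,y))\mapsto((z,x),y)\mapsto(y,(z,x))\mapsto((y,z),x)\mapsto(x,(y,z))$. -/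
theorem exists_assr_code : ∃ (e : K.L) (k : ℕ), ∀ x y z,
    K.Eval e (K.pair (K.pair x y) z) (K.pair x (K.pair y z)) k := by
  obtain ⟨s, k, hs⟩ := K.exists_swap
  obtain ⟨a, l, ha⟩ := K.exists_assl
  obtain ⟨e₁, k₁, h₁⟩ := exists_comp_code (K := K) s a
  obtain ⟨e₂, k₂, h₂⟩ := exists_comp_code e₁ s
  obtain ⟨e₃, k₃, h₃⟩ := exists_comp_code e₂ a
  obtain ⟨e₄, k₄, h₄⟩ := exists_comp_code e₃ s
  exact ⟨e₄, _, fun x y z => h₄ _ _ _ _ _ (h₃ _ _ _ _ _ (h₂ _ _ _ _ _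
    (h₁ _ _ _ _ _ (hs _ _) (ha _ _ _)) (hs _ _)) (ha _ _ _)) (hs _ _)⟩

end CompModel

open CompModel

/-! ## Uniformly realised families of functions -/

namespace LengthSpace

variable {K : CompModel} {M : ResourceMonoid}

/-- Naming the time bound `t` separately lets time estimates be composed by the calculus of `LeBy`.
-/
theorem realizes_iff {A B : LengthSpace K M} {φ : M.carrier} {e : K.L}
    {f : A.carrier → B.carrier} : Realizes A B φ e f ↔ K.size e ≤ M.norm φ ∧
      ∀ a d x, A.maj a d x → ∃ b c t, B.maj b c (f x) ∧ M.LeBy t b (φ + a) ∧ K.Eval e d c t := by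
  refine and_congr_right fun _ => ⟨fun h a d x hx => ?_, fun h a d x hx => ?_⟩
  · obtain ⟨b, c, h1, h2, h3, h4⟩ := h a d x hx
    exact ⟨b, c, _, h1, ⟨h2, h4⟩, h3, le_refl _⟩
  · obtain ⟨b, c, t, h1, h2, h3⟩ := h a d x hx
    exact ⟨b, c, h1, h2.1, h3.1, h3.2.trans h2.2⟩

theorem Realizes.mono {A B : LengthSpace K M} {φ ψ : M.carrier} {e : K.L}
    {f : A.carrier → B.carrier} (h : Realizes A B φ e f) (hle : M.le φ ψ) : Realizes A B ψ e f := by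
  have h1 : (hom A B).maj ψ e ⟨f, φ, e, h⟩ := (hom A B).str.mono (a := φ) h hle
  exact h1

/-- The summand `k` pays for the constant `cp` in the size of a pair; norms are superadditive, so
`a` and `b` pay for the components. -/
theorem tensor_maj {A B : LengthSpace K M} {a b k : M.carrier} {e d : K.L} {x : A.carrier}
    {y : B.carrier} (hk : K.cp ≤ M.norm k) (hx : A.maj a e x) (hy : B.maj b d y) :
    (tensor A B).maj (k + (a + b)) (K.pair e d) (x, y) := by
  refine ⟨?_, e, d, a, b, hx, hy, rfl, M.le_add_left _ _⟩
  have h1 := A.str.size_le hx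
  have h2 := B.str.size_le hy
  have h3 := norm_add_le M k (a + b)
  have h4 := norm_add_le M a b
  rw [K.size_pair]
  omega

variable {ι : Type*} {A B C D : ι → LengthSpace K M}

/-- The functions `f i` have a common realiser. -/
def Uniform (A B : ι → LengthSpace K M) (f : ∀ i, (A i).carrier → (B i).carrier) : Prop :=
  ∃ φ e, ∀ i, Realizes (A i) (B i) φ e (f i)

/-- Functions realised by an algorithm running in constant time. -/
theorem Uniform.of_eval {f : ∀ i, (A i).carrier → (B i).carrier} (e : K.L) (n : ℕ) (k : M.carrier)
    (h : ∀ i a d x, (A i).maj a d x → ∃ c, (B i).maj (k + a) c (f i x) ∧ K.Eval e d c n) :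
    Uniform A B f := by
  refine ⟨M.const (n + K.size e) + k, e, fun i => realizes_iff.2 ⟨?_, fun a d x hx => ?_⟩⟩
  · have h1 := norm_add_le M (M.const (n + K.size e)) k
    have h2 := M.le_norm_const (n + K.size e)
    omega
  · obtain ⟨c, h1, h2⟩ := h i a d x hx
    refine ⟨k + a, c, n, h1, ?_, h2⟩
    have h3 := LeBy.add_norm (M.le_norm_const (n + K.size e)) (k + a)
    rw [← add_assoc] at h3
    exact h3.mono (Nat.le_add_right _ _)

/-- Functions that preserve realisers. -/
theorem Uniform.of_maj {f : ∀ i, (A i).carrier → (B i).carrier}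
    (h : ∀ i a d x, (A i).maj a d x → (B i).maj a d (f i x)) : Uniform A B f := by
  obtain ⟨e, n, he⟩ := K.exists_id
  exact Uniform.of_eval e n 0 fun i a d x hx => ⟨d, by rw [zero_add]; exact h i a d x hx, he d⟩

theorem Uniform.id (A : ι → LengthSpace K M) : Uniform A A fun _ x => x :=
  Uniform.of_maj fun _ _ _ _ h => h

/-- Used for $\forall$-right, where a statement about all environments is read at the environments
`extend C η`. -/
theorem Uniform.reindex {κ : Type*} {f : ∀ i, (A i).carrier → (B i).carrier} (h : Uniform A B f)
    (r : κ → ι) : Uniform (fun j => A (r j)) (fun j => B (r j)) (fun j => f (r j)) := by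
  obtain ⟨φ, e, h⟩ := h
  exact ⟨φ, e, fun j => h (r j)⟩

theorem Realizes.comp {A B C : LengthSpace K M} {φ ψ : M.carrier} {e d z : K.L} {n : ℕ}
    {f : A.carrier → B.carrier} {g : B.carrier → C.carrier}
    (hz : ∀ w u v s t, K.Eval e w u s → K.Eval d u v t → K.Eval z w v (s + t + n))
    (hf : Realizes A B φ e f) (hg : Realizes B C ψ d g) :
    Realizes A C (M.const (n + K.size z) + (ψ + φ)) z (fun x => g (f x)) := by
  have hn := M.le_norm_const (n + K.size z)
  refine realizes_iff.2 ⟨?_, fun a w x hx => ?_⟩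
  · have h1 := norm_add_le M (M.const (n + K.size z)) (ψ + φ)
    omega
  · obtain ⟨b, u, s, h1, h2, h3⟩ := (realizes_iff.1 hf).2 a w x hx
    obtain ⟨c, v, t, h4, h5, h6⟩ := (realizes_iff.1 hg).2 b u _ h1
    refine ⟨c, v, s + t + n, h4, ?_, hz w u v s t h3 h6⟩
    have h7 := (h2.add_left ψ).trans
      ((LeBy.add_norm hn (ψ + (φ + a))).mono (Nat.le_add_right n (K.size z)))
    have h8 := h5.trans h7
    rw [← add_assoc ψ, ← add_assoc (M.const _)] at h8
    exact h8.mono (by omega)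

theorem Uniform.comp {f : ∀ i, (A i).carrier → (B i).carrier}
    {g : ∀ i, (B i).carrier → (C i).carrier} (hg : Uniform B C g) (hf : Uniform A B f) :
    Uniform A C fun i x => g i (f i x) := by
  obtain ⟨φ, e, hf⟩ := hf
  obtain ⟨ψ, d, hg⟩ := hg
  obtain ⟨z, n, hz⟩ := exists_comp_code e d
  exact ⟨_, z, fun i => (hf i).comp hz (hg i)⟩

theorem Uniform.tensLeft {f : ∀ i, (A i).carrier → (B i).carrier} (hf : Uniform A B f)
    (C : ι → LengthSpace K M) :
    Uniform (fun i => tensor (A i) (C i)) (fun i => tensor (B i) (C i))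
      fun i x => (f i x.1, x.2) := by
  obtain ⟨φ, e, hf⟩ := hf
  obtain ⟨z, n, hz⟩ := exists_tens_code e
  have hn := M.le_norm_const (n + K.size z)
  refine ⟨M.const (n + K.size z) + (M.const K.cp + φ), z, fun i => realizes_iff.2 ⟨?_, ?_⟩⟩
  · have h1 := norm_add_le M (M.const (n + K.size z)) (M.const K.cp + φ)
    omega
  · rintro a _ ⟨x, y⟩ ⟨-, d, c, b₁, b₂, hx, hy, rfl, hb⟩
    obtain ⟨b, u, t, h1, h2, h3⟩ := (realizes_iff.1 (hf i)).2 b₁ d x hx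
    refine ⟨_, _, t + n, tensor_maj (M.le_norm_const K.cp) h1 hy, ?_, hz _ _ _ _ h3⟩
    have h4 := (h2.add_right b₂).add_left (M.const K.cp)
    rw [add_assoc φ] at h4
    have h5 := (h4.trans (((LeBy.of_le hb).add_left φ).add_left (M.const K.cp))).trans
      ((LeBy.add_norm hn _).mono (Nat.le_add_right n (K.size z)))
    rw [← add_assoc (M.const K.cp) φ, ← add_assoc (M.const (n + _))] at h5
    exact h5.mono (by omega)

theorem Uniform.swap (A B : ι → LengthSpace K M) :
    Uniform (fun i => tensor (A i) (B i)) (fun i => tensor (B i) (A i))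
      fun _ x => (x.2, x.1) := by
  obtain ⟨e, n, he⟩ := K.exists_swap
  refine Uniform.of_eval e n (M.const K.cp) ?_
  rintro i a _ ⟨x, y⟩ ⟨-, d, c, b₁, b₂, hx, hy, rfl, hb⟩
  refine ⟨_, (tensor _ _).str.mono (tensor_maj (M.le_norm_const K.cp) hy hx) ?_, he d c⟩
  rw [add_comm b₂]
  exact ((LeBy.of_le hb).add_left _).1

theorem Uniform.snd (A B : ι → LengthSpace K M) :
    Uniform (fun i => tensor (A i) (B i)) B fun _ x => x.2 := by
  obtain ⟨e, n, he⟩ := K.exists_throwfirst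
  refine Uniform.of_eval e n 0 ?_
  rintro i a _ ⟨x, y⟩ ⟨-, d, c, b₁, b₂, hx, hy, rfl, hb⟩
  refine ⟨_, (B i).str.mono hy ?_, he d c⟩
  rw [zero_add]
  exact M.le_trans (M.le_add_left _ _) hb

theorem Uniform.fst (A B : ι → LengthSpace K M) :
    Uniform (fun i => tensor (A i) (B i)) A fun _ x => x.1 :=
  (Uniform.snd B A).comp (Uniform.swap A B)

theorem Uniform.tensRight {f : ∀ i, (A i).carrier → (B i).carrier} (hf : Uniform A B f)
    (C : ι → LengthSpace K M) :
    Uniform (fun i => tensor (C i) (A i)) (fun i => tensor (C i) (B i))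
      fun i x => (x.1, f i x.2) :=
  (Uniform.swap B C).comp ((hf.tensLeft C).comp (Uniform.swap C A))

theorem Uniform.assl (A B C : ι → LengthSpace K M) :
    Uniform (fun i => tensor (A i) (tensor (B i) (C i)))
      (fun i => tensor (tensor (A i) (B i)) (C i)) fun _ x => ((x.1, x.2.1), x.2.2) := by
  obtain ⟨e, n, he⟩ := K.exists_assl
  refine Uniform.of_eval e n (M.const K.cp + M.const K.cp) ?_
  rintro i a _ ⟨x, y, z⟩ ⟨-, d, _, b₁, b₂, hx, ⟨-, c, c', b₃, b₄, hy, hz, rfl, hb'⟩, rfl, hb⟩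
  have hc := M.le_norm_const K.cp
  refine ⟨_, (tensor _ _).str.mono (tensor_maj hc (tensor_maj hc hx hy) hz) ?_, he d c c'⟩
  have h1 := (((LeBy.of_le hb').add_left b₁).trans (LeBy.of_le hb)).add_left
    (M.const K.cp + M.const K.cp)
  have h2 := h1.1
  simp only [add_assoc] at h2 ⊢
  exact h2

theorem Uniform.swapLast (A B C : ι → LengthSpace K M) :
    Uniform (fun i => tensor (tensor (A i) (B i)) (C i))
      (fun i => tensor (tensor (A i) (C i)) (B i)) fun _ x => ((x.1.1, x.2), x.1.2) :=
  ((Uniform.swap C A).tensLeft B).comp ((Uniform.assl C A B).comp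
    (Uniform.swap (fun i => tensor (A i) (B i)) C))

theorem Uniform.assr (A B C : ι → LengthSpace K M) :
    Uniform (fun i => tensor (tensor (A i) (B i)) (C i))
      (fun i => tensor (A i) (tensor (B i) (C i))) fun _ x => (x.1.1, (x.1.2, x.2)) :=
  (Uniform.swap (fun i => tensor (B i) (C i)) A).comp
    ((Uniform.assl B C A).comp ((Uniform.swap (fun i => tensor (C i) (A i)) B).comp
      ((Uniform.assl C A B).comp (Uniform.swap (fun i => tensor (A i) (B i)) C))))

/-- Pairing with a constant that has a common realiser. -/
theorem Uniform.pairConst {x : ∀ i, (B i).carrier} {b : M.carrier} {d : K.L}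
    (hx : ∀ i, (B i).maj b d (x i)) (A : ι → LengthSpace K M) :
    Uniform A (fun i => tensor (A i) (B i)) fun i y => (y, x i) := by
  obtain ⟨e, n, he⟩ := K.exists_tensconst d
  refine Uniform.of_eval e n (M.const K.cp + b) ?_
  intro i a c y hy
  refine ⟨_, ?_, he c⟩
  have h := tensor_maj (M.le_norm_const K.cp) hy (hx i)
  rwa [add_comm a b, ← add_assoc] at h

theorem Uniform.const {x : ∀ i, (B i).carrier} {b : M.carrier} {d : K.L}
    (hx : ∀ i, (B i).maj b d (x i)) (A : ι → LengthSpace K M) :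
    Uniform A B fun i _ => x i :=
  (Uniform.snd A B).comp (Uniform.pairConst hx A)

theorem Uniform.eval (A B : ι → LengthSpace K M) :
    Uniform (fun i => tensor (hom (A i) (B i)) (A i)) B fun _ x => x.1.1 x.2 := by
  obtain ⟨e, n, he⟩ := K.exists_eval
  have hn := M.le_norm_const (n + K.size e)
  refine ⟨M.const (n + K.size e), e, fun i => realizes_iff.2 ⟨by omega, ?_⟩⟩
  rintro a _ ⟨f, x⟩ ⟨-, d, c, b₁, b₂, hf, hx, rfl, hb⟩
  obtain ⟨b, u, t, h1, h2, h3⟩ := (realizes_iff.1 hf).2 b₂ c x hx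
  obtain ⟨h4, h5⟩ := he d c u h3.1
  refine ⟨b, u, t + n, h1, ?_, h4, h5.trans (Nat.add_le_add_right h3.2 n)⟩
  exact ((h2.trans (LeBy.of_le hb)).trans (LeBy.add_norm hn a)).mono (by omega)

/-- The code `y` depends on `d` alone, not on the spaces, the function or the majorizer; so the same
`y` serves a whole family, and it can be computed from `d` by the fixed code `e`. Of the three
summands `k`, the outermost pays for the time to build a closure. The other two belong to the
closure: one pays for `cp` when the argument pair is formed, one for the time overhead of running
it, and together they cover its size. -/
theorem exists_curry_realizer (K : CompModel) (M : ResourceMonoid) : ∃ (e : K.L) (n : ℕ),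
    ∀ d, ∃ y, K.Eval e d y n ∧ K.size y ≤ K.size d + n ∧
      ∀ (k φ : M.carrier) (A B C : LengthSpace K M)
        (f : (tensor A B).carrier → C.carrier), n ≤ M.norm k → Realizes (tensor A B) C φ d f →
        ∃ g : A.carrier → (hom B C).carrier, (∀ x z, (g x).1 z = f (x, z)) ∧
          Realizes A (hom B C) (k + (k + (k + φ))) y g := by
  obtain ⟨e, n, he⟩ := K.exists_curry
  refine ⟨e, n + n + K.cp, fun d => ?_⟩
  obtain ⟨y, h1, h2, h3, h4⟩ := he d
  refine ⟨y, ⟨h1, by omega⟩, by omega, fun k φ A B C f hk hf => ?_⟩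
  have key : ∀ a z x, A.maj a z x → ∃ c, K.Eval y z c n ∧
      Realizes B C (k + (k + φ) + a) c fun w => f (x, w) := by
    intro a z x hx
    obtain ⟨c, h5, h6, h7, h8⟩ := h4 z
    refine ⟨c, ⟨h5, h7⟩, realizes_iff.2 ⟨?_, fun b w v hv => ?_⟩⟩
    · have := norm_add_le M (k + (k + φ)) a
      have := norm_add_le M k (k + φ)
      have := norm_add_le M k φ
      have := A.str.size_le hx
      have := hf.1
      omega
    · obtain ⟨r, u, t, h9, h10, h11⟩ := (realizes_iff.1 hf).2 _ _ _
        (tensor_maj (k := k) (by omega) hx hv)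
      obtain ⟨h12, h13⟩ := h8 w u h11.1
      refine ⟨r, u, t + n, h9, ?_, h12, h13.trans (Nat.add_le_add_right h11.2 n)⟩
      have h14 := h10.trans (LeBy.add_norm hk _)
      rw [show k + (φ + (k + (a + b))) = k + (k + φ) + a + b by abel] at h14
      exact h14.mono (by omega)
  have hex : ∀ x, ∃ φ e, Realizes B C φ e fun w => f (x, w) := fun x => by
    obtain ⟨a, z, hx⟩ := A.str.exists_maj x
    obtain ⟨c, -, hc⟩ := key a z x hx
    exact ⟨_, c, hc⟩
  refine ⟨fun x => ⟨fun w => f (x, w), hex x⟩, fun _ _ => rfl, realizes_iff.2 ⟨?_, ?_⟩⟩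
  · have := norm_add_le M k (k + (k + φ))
    have := norm_add_le M k (k + φ)
    have := norm_add_le M k φ
    have := hf.1
    omega
  · intro a z x hx
    obtain ⟨c, h5, h6⟩ := key a z x hx
    refine ⟨_, c, n, h6, ?_, h5⟩
    have h7 := LeBy.add_norm hk (k + (k + φ) + a)
    rw [← add_assoc k (k + (k + φ)) a] at h7
    exact h7.mono (by omega)

theorem Uniform.curry {f : ∀ i, (tensor (A i) (B i)).carrier → (C i).carrier}
    (hf : Uniform (fun i => tensor (A i) (B i)) C f) :
    ∃ g : ∀ i, (A i).carrier → (hom (B i) (C i)).carrier,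
      (∀ i x z, (g i x).1 z = f i (x, z)) ∧ Uniform A (fun i => hom (B i) (C i)) g := by
  obtain ⟨φ, d, hf⟩ := hf
  obtain ⟨e, n, he⟩ := exists_curry_realizer K M
  obtain ⟨y, -, -, h⟩ := he d
  choose g hg hg' using fun i => h (M.const n) φ (A i) (B i) (C i) (f i) (M.le_norm_const n) (hf i)
  exact ⟨g, hg, _, y, hg'⟩

end LengthSpace
end SAL

/-! ### Constructions that depend on the soft resource monoid. -/

namespace SAL

open ResourceMonoid CompModel LengthSpace

/-! ## Subtraction, multiples and promotion in the soft resource monoid -/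

namespace Soft

/-- Let `r` be the least slack in the tail with `t ≤ p + q * r`. Any `(l, n)` that is below by at
least `t` has tail slack `d ≥ r`, so `r` can be subtracted from the tail recursively and `p + q * r
- t` kept as the new head; then `q * d` splits as `q * r + q * (d - r)`. The existence hypothesis
guarantees that some slack suffices: for `q = 0` or an empty list it may fail. -/
theorem leAux_exists_sub : ∀ (h : List ℕ) (q t : ℕ), (∃ l n e, t ≤ e ∧ leAux e l n h q) →
    ∃ h', leAux t h' q h q ∧ ∀ l n e, t ≤ e → leAux e l n h q → leAux (e - t) l n h' q
  | [], q, t, ⟨[], n, e, hte, hh⟩ => by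
      simp only [leAux] at hh
      obtain rfl : t = 0 := by omega
      exact ⟨[], by simp [leAux], fun l n e _ h => h⟩
  | [], q, t, ⟨k :: l, n, e, hte, hh⟩ => by simp only [leAux] at hh
  | p :: h, q, t, hex => by
      have key : ∀ l n e, t ≤ e → leAux e l n (p :: h) q →
          ∃ l' d, leAux d l' n h q ∧ t ≤ p + q * d := by
        rintro (_ | ⟨k, l⟩) n e hte hh
        · simp only [leAux] at hh
          obtain ⟨d, h1, h2⟩ := hh
          exact ⟨_, d, h2, by omega⟩
        · simp only [leAux] at hh
          obtain ⟨d, h1, h2⟩ := hh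
          exact ⟨_, d, h2, by omega⟩
      have hP : ∃ d, t ≤ p + q * d := by
        obtain ⟨l, n, e, hte, hh⟩ := hex
        obtain ⟨_, d, -, hd⟩ := key l n e hte hh
        exact ⟨d, hd⟩
      have hmin : ∀ d, t ≤ p + q * d → Nat.find hP ≤ d := fun d hd => Nat.find_min' hP hd
      have hfind := Nat.find_spec hP
      generalize Nat.find hP = r at hmin hfind
      obtain ⟨h', h1, h2⟩ := leAux_exists_sub h q r (by
        obtain ⟨l, n, e, hte, hh⟩ := hex
        obtain ⟨l', d, hl', hd⟩ := key l n e hte hh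
        exact ⟨l', n, d, hmin d hd, hl'⟩)
      refine ⟨(p + q * r - t) :: h', ?_, ?_⟩
      · simp only [leAux]
        exact ⟨r, by omega, h1⟩
      · rintro (_ | ⟨k, l⟩) n e hte hh
        all_goals
          simp only [leAux] at hh ⊢
          obtain ⟨d, h3, h4⟩ := hh
          have hrd := hmin d (by omega)
          refine ⟨d - r, ?_, h2 _ _ _ hrd h4⟩
          have h5 : q * d = q * r + q * (d - r) := by
            rw [← Nat.mul_add, Nat.add_sub_cancel' hrd]
          omega

/-- Among the elements `b` with `b ≤_t a` there is a largest one. -/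
theorem exists_sub {t : ℕ} {a b : Soft} (h : softMonoid.LeBy t b a) :
    ∃ c : Soft, softMonoid.LeBy t c a ∧ ∀ d : Soft, softMonoid.LeBy t d a → softMonoid.le d c := by
  have key : ∀ {d : Soft}, softMonoid.LeBy t d a →
      t ≤ dist d a ∧ leAux (dist d a) d.lst d.mul a.lst a.mul := by
    rintro d ⟨⟨e, h1⟩, h2⟩
    exact ⟨h2, leAux_dist h1⟩
  obtain ⟨l, h1, h2⟩ := leAux_exists_sub a.lst a.mul t ⟨_, _, _, key h⟩
  exact ⟨⟨l, a.mul⟩, ⟨⟨t, h1⟩, leAux_le_dist h1⟩, fun d hd => ⟨_, h2 _ _ _ (key hd).1 (key hd).2⟩⟩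

theorem bang_add (a b : Soft) : (a + b).bang = a.bang + b.bang := rfl

/-- The distance below the new head is weighted by the multiplicity of `b`, so multiplicity at least
`1` keeps it and multiplicity `0` would erase it. -/
theorem leBy_bang {t : ℕ} {a b : Soft} (h : softMonoid.LeBy t a b) (hb : 1 ≤ b.mul) :
    softMonoid.LeBy t a.bang b.bang := by
  obtain ⟨⟨e, h1⟩, h2⟩ := h
  have h3 : leAux t a.bang.lst a.bang.mul b.bang.lst b.bang.mul := by
    simp only [bang, leAux]
    refine ⟨_, ?_, leAux_dist h1⟩
    have h4 := Nat.mul_le_mul_right (distAux a.lst a.mul b.lst b.mul) hb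
    have h5 : t ≤ distAux a.lst a.mul b.lst b.mul := h2
    omega
  exact ⟨⟨t, h3⟩, leAux_le_dist h3⟩

/-- Multiples. -/
def smul (r : ℕ) (a : Soft) : Soft := ⟨a.lst.map (r * ·), a.mul⟩

theorem addList_map (r s : ℕ) : ∀ l : List ℕ,
    addList (l.map (r * ·)) (l.map (s * ·)) = l.map ((r + s) * ·)
  | [] => rfl
  | n :: l => by simp only [List.map_cons, addList, addList_map r s l, Nat.add_mul]

theorem add_smul (r s : ℕ) (a : Soft) : smul (r + s) a = smul r a + smul s a :=
  Soft.ext (addList_map r s a.lst).symm (max_self _).symm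

theorem one_smul (a : Soft) : smul 1 a = a := by
  simp [smul]

/-- The norm is linear in the entries as long as the multiplicity is kept. -/
theorem norm_smul (r : ℕ) (a : Soft) : softMonoid.norm (smul r a) = r * softMonoid.norm a := by
  obtain ⟨l, m⟩ := a
  change distAux [] 0 (l.map (r * ·)) m = r * distAux [] 0 l m
  induction l with
  | nil => rfl
  | cons n l ih =>
      simp only [List.map_cons, distAux, ih]
      ring

/-- Against the shifted list, every entry `n` counts `N` times, of which `r` are consumed and `N -
r` are left over. With $D$ the norm of the tail, the induction step is the identity
$k+(N-r)(n+ND)+rn=k+N(n+(N-r)D)$. -/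
theorem leAux_map (r k m N : ℕ) (hm : m ≤ N) (hr : r ≤ N) : ∀ l : List ℕ,
    leAux (k + (N - r) * distAux [] 0 l N) (l.map (r * ·)) m (k :: l) N
  | [] => by
      simp only [List.map_nil, distAux, leAux]
      exact ⟨0, by omega, rfl, hm⟩
  | n :: l => by
      have ih := leAux_map r n m N hm hr l
      simp only [List.map_cons, distAux, leAux]
      refine ⟨_, ?_, ih⟩
      obtain ⟨s, rfl⟩ := Nat.exists_eq_add_of_le hr
      rw [Nat.add_sub_cancel_left]
      apply le_of_eq
      ring

/-- A promoted resource together with the multiplicity `N` majorizes multiples. -/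
theorem leBy_smul (r k N : ℕ) (a : Soft) (hr : r ≤ N) :
    softMonoid.LeBy (k + (N - r) * softMonoid.norm a) (smul r a) ((⟨[k], N⟩ : Soft) + a.bang) := by
  have h1 : ((⟨[k], N⟩ : Soft) + a.bang) = ⟨k :: a.lst, max N a.mul⟩ := by
    apply Soft.ext
    · rw [add_lst]
      simp [bang, addList]
    · rw [add_mul']
      rfl
  rw [h1]
  have h2 := leAux_map r k a.mul (max N a.mul) (le_max_right _ _) (hr.trans (le_max_left _ _)) a.lst
  refine ⟨⟨_, h2⟩, le_trans ?_ (leAux_le_dist h2)⟩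
  have h3 : softMonoid.norm a ≤ distAux [] 0 a.lst (max N a.mul) := by
    clear h2 h1
    obtain ⟨l, m⟩ := a
    change distAux [] 0 l m ≤ distAux [] 0 l (max N m)
    induction l with
    | nil => simp [distAux]
    | cons n l ih =>
        simp only [distAux]
        exact Nat.add_le_add_left (Nat.mul_le_mul (le_max_right _ _) ih) _
  exact Nat.add_le_add_left (Nat.mul_le_mul (Nat.sub_le_sub_right (le_max_left _ _) _) h3) _

theorem le_norm_single (n m : ℕ) : n ≤ softMonoid.norm (⟨[n], m⟩ : Soft) := by
  simp [ResourceMonoid.norm, dist, distAux]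

end Soft

/-! ### Tupling and promotion. -/

namespace LengthSpace

variable {K : CompModel} {ι : Type*}

/-- Tupling: a common realiser of a family of functions realises the function into the product. -/
theorem Realizes.tuple {A : SoftSpace K} {F : SmallSpace K softMonoid → SoftSpace K} {φ : Soft}
    {e : K.L} {f : ∀ C, A.carrier → (F C).carrier} (h : ∀ C, Realizes A (F C) φ e (f C)) :
    ∃ g : A.carrier → (prod F).carrier, (∀ x C, (g x).1 C = f C x) ∧ Realizes A (prod F) φ e g := by
  have key : ∀ a d x, A.maj a d x → ∃ b c, (∀ C, (F C).maj b c (f C x)) ∧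
      softMonoid.LeBy (K.time e d) b (φ + a) ∧ c ∈ K.app e d := by
    intro a d x hx
    -- One arbitrary component fixes the output `c₀`, which is the same for all components as
    -- application is single-valued, and shows that something lies below `φ + a` by at least the
    -- time used. The largest such element then majorizes every component.
    obtain ⟨b₀, c₀, -, h2, h3, h4⟩ := (h (unit K softMonoid).small).2 a d x hx
    obtain ⟨b, h5, h6⟩ := Soft.exists_sub (t := K.time e d) (a := φ + a) (b := b₀) ⟨h2, h4⟩
    refine ⟨b, c₀, fun C => ?_, h5, h3⟩
    obtain ⟨b₁, c₁, h1', h2', h3', h4'⟩ := (h C).2 a d x hx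
    obtain rfl := Part.mem_unique h3 h3'
    exact (F C).str.mono h1' (h6 b₁ ⟨h2', h4'⟩)
  refine ⟨fun x => ⟨fun C => f C x, ?_⟩, fun _ _ => rfl, (h (unit K softMonoid).small).1,
    fun a d x hx => ?_⟩
  · obtain ⟨a, d, hx⟩ := A.str.exists_maj x
    obtain ⟨b, c, h1, -⟩ := key a d x hx
    exact ⟨b, c, h1⟩
  · obtain ⟨b, c, h1, h2, h3⟩ := key a d x hx
    exact ⟨b, c, h1, h2.1, h3, h2.2⟩

variable {A B : ι → SoftSpace K}

theorem Uniform.bang {f : ∀ i, (A i).carrier → (B i).carrier} (hf : Uniform A B f) :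
    Uniform (fun i => (A i).bang) (fun i => (B i).bang) f := by
  obtain ⟨φ, e, hf⟩ := hf
  let φ' : Soft := φ
  -- This summand makes the multiplicity at least `1`, so that promotion does not multiply the paid
  -- time by `0`.
  let u : Soft := ⟨[], 1⟩
  have hs := softMonoid.le_norm_const (K.size e)
  refine ⟨softMonoid.const (K.size e) + (φ' + u).bang, e, fun i => realizes_iff.2 ⟨?_, ?_⟩⟩
  · exact hs.trans (softMonoid.norm_mono (softMonoid.le_add_right _ _))
  · rintro a d x ⟨-, β, hx, hβ⟩
    obtain ⟨b, c, t, h1, h2, h3⟩ := (realizes_iff.1 (hf i)).2 β d x hx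
    have hmul : ∀ v : Soft, 1 ≤ (v + u).mul := fun v => le_max_right _ _
    have h4 := Soft.leBy_bang (h2.add_right u) (hmul _)
    have h5 := (LeBy.of_norm ((B i).str.size_le h1)).trans (LeBy.of_le (softMonoid.le_add_right b u))
    have h6 := (Soft.leBy_bang h5 (hmul _)).norm_le
    refine ⟨_, c, t, ⟨(Nat.le_add_right _ _).trans h6, b + u, (B i).str.mono h1
      (softMonoid.le_add_right _ _), softMonoid.le_refl _⟩, ?_, h3⟩
    have h7 : softMonoid.LeBy 0 (φ' + β + u).bang ((φ' + u).bang + a) := by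
      rw [add_right_comm, Soft.bang_add (φ' + u)]
      exact (LeBy.of_le hβ).add_left _
    have h8 := (h4.trans h7).trans (LeBy.of_le (softMonoid.le_add_left _ (softMonoid.const (K.size e))))
    rw [← add_assoc] at h8
    exact h8

/-- Promotion of contexts with several formulae. The cost of pairing arises below the `!`, hence the
constant `k` enters as `k.bang`. -/
theorem Uniform.bangTensor (A B : ι → SoftSpace K) :
    Uniform (fun i => tensor (A i).bang (B i).bang) (fun i => SoftSpace.bang (tensor (A i) (B i)))
      fun _ x => x := by
  obtain ⟨e, n, he⟩ := K.exists_id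
  let k : Soft := softMonoid.const K.cp
  refine Uniform.of_eval e n k.bang ?_
  rintro i a _ ⟨x, y⟩ ⟨hs, d, c, b₁, b₂, ⟨-, β₁, hx, hβ₁⟩, ⟨-, β₂, hy, hβ₂⟩, rfl, hb⟩
  refine ⟨_, ⟨hs.trans (softMonoid.norm_mono (softMonoid.le_add_left _ _)), _,
    tensor_maj (softMonoid.le_norm_const K.cp) hx hy, ?_⟩, he _⟩
  exact ((((LeBy.of_le hβ₁).add (LeBy.of_le hβ₂)).trans (LeBy.of_le hb)).add_left k.bang).1

theorem Uniform.bangUnit (K : CompModel) : Uniform (fun _ : ι => unit K softMonoid)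
    (fun _ => SoftSpace.bang (unit K softMonoid)) fun _ x => x := by
  obtain ⟨b, d, h⟩ := (SoftSpace.bang (unit K softMonoid)).str.exists_maj ()
  exact Uniform.const (fun _ => h) _

end LengthSpace

/-- The space `A` with realisers majorized by `s + 1` times the resources. -/
def SoftSpace.multiple {K : CompModel} (s : ℕ) (A : SoftSpace K) : SoftSpace K where
  carrier := A.carrier
  str :=
    { maj := fun a e x => ∃ b : Soft, A.maj b e x ∧ softMonoid.le (Soft.smul (s + 1) b) a
      size_le := by
        rintro a e x ⟨b, h1, h2⟩
        have h3 := softMonoid.norm_mono h2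
        rw [Soft.norm_smul, Nat.add_mul] at h3
        have h4 := A.str.size_le h1
        omega
      exists_maj := fun x => by
        obtain ⟨b, e, h⟩ := A.str.exists_maj x
        exact ⟨_, e, b, h, softMonoid.le_refl _⟩
      mono := fun ⟨b, h1, h2⟩ h => ⟨b, h1, softMonoid.le_trans h2 h⟩
      unique := fun ⟨_, h1, _⟩ ⟨_, h1', _⟩ => A.unique' h1 h1' }

/-! ### Contraction through multiples. -/

namespace LengthSpace

variable {K : CompModel} {ι : Type*}

/-- The majorizer `⟨[0], s + 1⟩` contributes only multiplicity: it makes the promoted resource count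
at least `s + 1` times. -/
theorem Uniform.bangMultiple (s : ℕ) (A : ι → SoftSpace K) :
    Uniform (fun i => (A i).bang) (fun i => (A i).multiple s) fun _ x => x := by
  obtain ⟨e, n, he⟩ := K.exists_id
  refine Uniform.of_eval e n (⟨[0], s + 1⟩ : Soft) ?_
  rintro i a d x ⟨-, β, hx, hβ⟩
  refine ⟨d, ⟨β, hx, ?_⟩, he d⟩
  exact ((Soft.leBy_smul (s + 1) 0 (s + 1) β (le_refl _)).trans ((LeBy.of_le hβ).add_left _)).1

/-- Through $(y,x)$, $((y,y),x)$ and $(x,(y,y))$; only the duplication takes more than constant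
time. -/
theorem exists_dup_code (K : CompModel) : ∃ (e : K.L) (c : ℕ), ∀ x y,
    K.Eval e (K.pair x y) (K.pair (K.pair x y) y) (c * K.size y + c) := by
  obtain ⟨s, k, hs⟩ := K.exists_swap
  obtain ⟨a, l, ha⟩ := K.exists_assl
  obtain ⟨r, c, hr⟩ := K.exists_contr
  obtain ⟨t, k₁, ht⟩ := exists_tens_code (K := K) r
  obtain ⟨e₁, k₂, h₁⟩ := exists_comp_code (K := K) s t
  obtain ⟨e₂, k₃, h₂⟩ := exists_comp_code (K := K) e₁ s
  obtain ⟨e₃, k₄, h₃⟩ := exists_comp_code (K := K) e₂ a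
  refine ⟨e₃, c + (k + k₁ + k₂ + k + k₃ + l + k₄), fun x y => ?_⟩
  refine (h₃ _ _ _ _ _ (h₂ _ _ _ _ _ (h₁ _ _ _ _ _ (hs x y) (ht y _ x _ (hr y)))
    (hs _ _)) (ha x y y)).mono ?_
  rw [Nat.add_mul]
  omega

/-- Of the `s + 2 + c` multiples of `β` on the left, `c` pay for the time `c * K.size g` of copying,
one majorizes the new copy and `s + 1` remain. As `c` does not depend on `s`, the duplication can be
repeated. -/
theorem exists_uniform_dup (K : CompModel) : ∃ c : ℕ, ∀ (s : ℕ) {ι : Type*} (A B : ι → SoftSpace K),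
    Uniform (fun i => tensor (B i) ((A i).multiple (s + 1 + c)))
      (fun i => tensor (tensor (B i) (A i)) ((A i).multiple s)) fun _ x => (x, x.2) := by
  obtain ⟨e, c, he⟩ := exists_dup_code K
  refine ⟨c, fun s ι A B => ?_⟩
  let k := softMonoid.const K.cp
  have hk := softMonoid.le_norm_const K.cp
  let k' := softMonoid.const (c + K.size e)
  have hk' : c + K.size e ≤ softMonoid.norm k' := softMonoid.le_norm_const (c + K.size e)
  refine ⟨k' + (k + k), e, fun i => realizes_iff.2 ⟨?_, ?_⟩⟩
  · have h1 := softMonoid.norm_mono (softMonoid.le_add_right k' (k + k))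
    exact le_trans (by omega) h1
  · rintro a _ ⟨x, y⟩ ⟨-, d, g, b₁, b₂, hx, ⟨β, hy, hβ⟩, rfl, hb⟩
    have hy' : ((A i).multiple s).maj (Soft.smul (s + 1) β) g y := ⟨β, hy, softMonoid.le_refl _⟩
    refine ⟨_, _, _, tensor_maj hk (tensor_maj hk hx hy) hy', ?_, he d g⟩
    have hg := (A i).str.size_le hy
    have h0 : c * K.size g ≤ softMonoid.norm (Soft.smul c β) := by
      rw [Soft.norm_smul]
      exact Nat.mul_le_mul_left c hg
    have hsm : Soft.smul (s + 1 + c + 1) β = Soft.smul c β + (β + Soft.smul (s + 1) β) := by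
      rw [show s + 1 + c + 1 = c + (1 + (s + 1)) by omega, Soft.add_smul, Soft.add_smul 1,
        Soft.one_smul]
    rw [hsm] at hβ
    have h1 : softMonoid.LeBy (c * K.size g) (b₁ + (β + Soft.smul (s + 1) β)) a :=
      (((LeBy.add_norm h0 _).trans (LeBy.of_le hβ)).add_left b₁).trans (LeBy.of_le hb)
    have h2 := (h1.add_left (k + k)).trans ((LeBy.add_norm hk' _).mono (Nat.le_add_right c _))
    have h3 : k + (k + (b₁ + β) + Soft.smul (s + 1) β) = k + k + (b₁ + (β + Soft.smul (s + 1) β)) := by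
      abel
    rw [← add_assoc k'] at h2
    exact h3 ▸ h2

end LengthSpace
end SAL

/-! ### Interpretation of formulae and proofs. -/

namespace SAL

open ResourceMonoid CompModel LengthSpace Formula

/-! ## Isomorphic spaces with the same realisers -/

namespace LengthSpace

variable {K : CompModel} {M : ResourceMonoid}

/-- Bijections that preserve and reflect realisers. -/
structure Iso (A B : LengthSpace K M) where
  equiv : A.carrier ≃ B.carrier
  maj_iff : ∀ a e x, B.maj a e (equiv x) ↔ A.maj a e x

/-- Turns the relational clauses of `Den` for the quantifier rules into equations. -/
theorem Iso.corr_iff {A B : LengthSpace K M} (σ : Iso A B) {x : A.carrier} {y : B.carrier} :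
    Corr A B x y ↔ y = σ.equiv x := by
  constructor
  · rintro ⟨a, e, h, h'⟩
    exact B.unique' h' ((σ.maj_iff a e x).2 h)
  · rintro rfl
    obtain ⟨a, e, h⟩ := A.str.exists_maj x
    exact ⟨a, e, h, (σ.maj_iff a e x).2 h⟩

def Iso.refl (A : LengthSpace K M) : Iso A A := ⟨Equiv.refl _, fun _ _ _ => Iff.rfl⟩

theorem Iso.maj_symm_iff {A B : LengthSpace K M} (σ : Iso A B) (a : M.carrier) (e : K.L)
    (y : B.carrier) : A.maj a e (σ.equiv.symm y) ↔ B.maj a e y := by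
  rw [← σ.maj_iff, σ.equiv.apply_symm_apply]

def Iso.symm {A B : LengthSpace K M} (σ : Iso A B) : Iso B A :=
  ⟨σ.equiv.symm, fun a e y => σ.maj_symm_iff a e y⟩

theorem Iso.realizes {A A' B B' : LengthSpace K M} (σ : Iso A A') (τ : Iso B B')
    {φ : M.carrier} {e : K.L} {f : A.carrier → B.carrier} (h : Realizes A B φ e f) :
    Realizes A' B' φ e fun x => τ.equiv (f (σ.equiv.symm x)) := by
  refine ⟨h.1, fun a d x hx => ?_⟩
  obtain ⟨b, c, h1, h2⟩ := h.2 a d _ ((σ.maj_symm_iff a d x).2 hx)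
  exact ⟨b, c, (τ.maj_iff _ _ _).2 h1, h2⟩

def Iso.hom {A A' B B' : LengthSpace K M} (σ : Iso A A') (τ : Iso B B') :
    Iso (hom A B) (LengthSpace.hom A' B') where
  equiv :=
    { toFun := fun f => ⟨fun x => τ.equiv (f.1 (σ.equiv.symm x)), by
        obtain ⟨φ, e, h⟩ := f.2
        exact ⟨φ, e, σ.realizes τ h⟩⟩
      invFun := fun f => ⟨fun x => τ.equiv.symm (f.1 (σ.equiv x)), by
        obtain ⟨φ, e, h⟩ := f.2
        exact ⟨φ, e, σ.symm.realizes τ.symm h⟩⟩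
      left_inv := fun f => Subtype.ext (funext fun x => by simp)
      right_inv := fun f => Subtype.ext (funext fun x => by simp) }
  maj_iff := fun a e f => by
    refine ⟨fun h => ?_, fun h => σ.realizes τ h⟩
    have h1 : Realizes A B a e fun x => τ.equiv.symm (τ.equiv (f.1 (σ.equiv.symm (σ.equiv x)))) :=
      σ.symm.realizes τ.symm h
    simp only [Equiv.symm_apply_apply] at h1
    exact h1

def Iso.tensor {A A' B B' : LengthSpace K M} (σ : Iso A A') (τ : Iso B B') :
    Iso (tensor A B) (LengthSpace.tensor A' B') where
  equiv := σ.equiv.prodCongr τ.equiv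
  maj_iff := fun _ _ x => and_congr_right fun _ =>
    exists_congr fun f => exists_congr fun g => exists_congr fun b => exists_congr fun c =>
      and_congr (σ.maj_iff b f x.1) (and_congr_left fun _ => τ.maj_iff c g x.2)

def Iso.prod {F G : SmallSpace K M → LengthSpace K M} (σ : ∀ C, Iso (F C) (G C)) :
    Iso (prod F) (LengthSpace.prod G) where
  equiv :=
    { toFun := fun x => ⟨fun C => (σ C).equiv (x.1 C), by
        obtain ⟨a, e, h⟩ := x.2
        exact ⟨a, e, fun C => ((σ C).maj_iff _ _ _).2 (h C)⟩⟩
      invFun := fun x => ⟨fun C => (σ C).equiv.symm (x.1 C), by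
        obtain ⟨a, e, h⟩ := x.2
        exact ⟨a, e, fun C => ((σ C).maj_symm_iff _ _ _).2 (h C)⟩⟩
      left_inv := fun x => Subtype.ext (funext fun C => by simp)
      right_inv := fun x => Subtype.ext (funext fun C => by simp) }
  maj_iff := fun a e x => forall_congr' fun C => (σ C).maj_iff _ _ _

noncomputable def Iso.small (A : LengthSpace K M) : Iso A A.small.toSpace where
  equiv := A.smallEquiv
  maj_iff := fun a e x => by
    constructor
    · rintro ⟨y, h, h'⟩
      rwa [← A.smallEquiv.injective h]
    · exact fun h => ⟨x, rfl, h⟩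

end LengthSpace

def SoftSpace.isoBang {K : CompModel} {A B : SoftSpace K} (σ : Iso A B) : Iso A.bang B.bang where
  equiv := σ.equiv
  maj_iff := fun _ e x => and_congr_right fun _ =>
    exists_congr fun b => and_congr_left fun _ => σ.maj_iff b e x

/-! ## Renaming and substitution -/

variable {K : CompModel}

theorem extend_upRen (C : SmallSpace K softMonoid) (η : ℕ → SoftSpace K) (r : ℕ → ℕ) :
    (fun n => extend C η (upRen r n)) = extend C fun n => η (r n) := by
  funext n
  cases n <;> rfl

theorem sem_rename (A : Formula) : ∀ (r : ℕ → ℕ) (η : ℕ → SoftSpace K),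
    sem (rename r A) η = sem A fun n => η (r n) := by
  induction A with
  | atom n => exact fun _ _ => rfl
  | limp A B ihA ihB => intro r η; simp only [rename, sem, ihA, ihB]
  | tens A B ihA ihB => intro r η; simp only [rename, sem, ihA, ihB]
  | all A ih => intro r η; simp only [rename, sem, ih, extend_upRen]
  | bang A ih => intro r η; simp only [rename, sem, ih]

theorem sem_shift (A : Formula) (C : SmallSpace K softMonoid) (η : ℕ → SoftSpace K) :
    sem (shift A) (extend C η) = sem A η := sem_rename A _ _

theorem extend_upSubst (C : SmallSpace K softMonoid) (η : ℕ → SoftSpace K) (s : ℕ → Formula) :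
    (fun n => sem (upSubst s n) (extend C η)) = extend C fun n => sem (s n) η := by
  funext n
  cases n with
  | zero => rfl
  | succ n => exact sem_shift _ _ _

theorem sem_subst (A : Formula) : ∀ (s : ℕ → Formula) (η : ℕ → SoftSpace K),
    sem (subst s A) η = sem A fun n => sem (s n) η := by
  induction A with
  | atom n => exact fun _ _ => rfl
  | limp A B ihA ihB => intro s η; simp only [subst, sem, ihA, ihB]
  | tens A B ihA ihB => intro s η; simp only [subst, sem, ihA, ihB]
  | all A ih => intro s η; simp only [subst, sem, ih, extend_upSubst]
  | bang A ih => intro s η; simp only [subst, sem, ih]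

theorem sem_iso (A : Formula) : ∀ {η η' : ℕ → SoftSpace K},
    (∀ n, Nonempty (Iso (η n) (η' n))) → Nonempty (Iso (sem A η) (sem A η')) := by
  induction A with
  | atom n => exact fun h => h n
  | limp A B ihA ihB =>
      intro η η' h
      obtain ⟨σ⟩ := ihA h
      obtain ⟨τ⟩ := ihB h
      exact ⟨σ.hom τ⟩
  | tens A B ihA ihB =>
      intro η η' h
      obtain ⟨σ⟩ := ihA h
      obtain ⟨τ⟩ := ihB h
      exact ⟨σ.tensor τ⟩
  | all A ih =>
      intro η η' h
      have h1 : ∀ C, Nonempty (Iso (sem A (extend C η)) (sem A (extend C η'))) := fun C =>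
        ih fun n => by
          cases n with
          | zero => exact ⟨Iso.refl _⟩
          | succ n => exact h n
      exact ⟨Iso.prod fun C => (h1 C).some⟩
  | bang A ih =>
      intro η η' h
      obtain ⟨σ⟩ := ih h
      exact ⟨SoftSpace.isoBang σ⟩

/-- Substitution commutes with the semantics on the nose; only an isomorphism results here because
the bound atom is sent to the small copy of `sem C η` and not to that space itself. -/
theorem inst_iso (A C : Formula) (η : ℕ → SoftSpace K) :
    Nonempty (Iso (sem A (extend (sem C η).small η)) (sem (inst A C) η)) := by
  rw [inst, sem_subst]
  refine sem_iso A fun n => ?_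
  cases n with
  | zero => exact ⟨(Iso.small _).symm⟩
  | succ n => exact ⟨Iso.refl _⟩

/-- The environment extended by `C` gives shifted formulae the same spaces, so the transport of
contexts preserves realisers and corresponding contexts determine each other. -/
theorem exists_shifted (C : SmallSpace K softMonoid) (η : ℕ → SoftSpace K) : ∀ Γ : List Formula,
    ∃ σ : Ctx η Γ → Ctx (extend C η) (Γ.map shift),
      (∀ a e γ, (semCtx η Γ).maj a e γ → (semCtx (extend C η) (Γ.map shift)).maj a e (σ γ)) ∧
      ∀ γ γ', Ctx.Shifted C Γ γ γ' ↔ γ' = σ γ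
  | [] => ⟨fun _ => (), fun _ _ _ h => h, fun _ _ => ⟨fun _ => rfl, fun _ => trivial⟩⟩
  | A :: Γ => by
      obtain ⟨σ, h1, h2⟩ := exists_shifted C η Γ
      obtain ⟨τ⟩ : Nonempty (Iso (sem A η) (sem (shift A) (extend C η))) := by
        rw [sem_shift]
        exact ⟨Iso.refl _⟩
      refine ⟨fun γ => (σ γ.1, τ.equiv γ.2), ?_, fun γ γ' => ?_⟩
      · rintro a e γ ⟨h, d, c, b₁, b₂, h3, h4, h5, h6⟩
        exact ⟨h, d, c, b₁, b₂, h1 _ _ _ h3, (τ.maj_iff _ _ _).2 h4, h5, h6⟩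
      · exact (and_congr (h2 _ _) τ.corr_iff).trans
          ⟨fun h => Prod.ext h.1 h.2, fun h => ⟨congrArg Prod.fst h, congrArg Prod.snd h⟩⟩

/-! ## Maps between contexts -/

theorem uniform_split (Δ Γ : List Formula) :
    Uniform (fun η : ℕ → SoftSpace K => semCtx η (Δ ++ Γ))
      (fun η => tensor (semCtx η Δ) (semCtx η Γ))
      fun _ γ => (Ctx.left Δ (Γ := Γ) γ, Ctx.right Δ (Γ := Γ) γ) := by
  induction Δ with
  | nil =>
      obtain ⟨a, e, h⟩ := (unit K softMonoid).str.exists_maj ()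
      exact (Uniform.swap _ _).comp (Uniform.pairConst (B := fun _ => unit K softMonoid)
        (x := fun _ => ()) (fun _ => h) _)
  | cons A Δ ih => exact (Uniform.swapLast _ _ _).comp (ih.tensLeft fun η => sem A η)

theorem uniform_append (Δ Γ : List Formula) :
    Uniform (fun η : ℕ → SoftSpace K => tensor (semCtx η Δ) (semCtx η Γ))
      (fun η => semCtx η (Δ ++ Γ)) fun _ γ => Ctx.append Δ γ.1 γ.2 := by
  induction Δ with
  | nil => exact Uniform.snd _ _
  | cons A Δ ih => exact (ih.tensLeft fun η => sem A η).comp (Uniform.swapLast _ _ _)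

theorem uniform_exch (A : Formula) (Γ Δ : List Formula) :
    Uniform (fun η : ℕ → SoftSpace K => semCtx η (Γ ++ A :: Δ))
      (fun η => semCtx η (A :: (Γ ++ Δ))) fun _ γ =>
        Ctx.cons (A := A) (Γ := Γ ++ Δ)
          (Ctx.append Γ (Ctx.left Γ γ) (Ctx.right Γ (Γ := A :: Δ) γ).tail)
          (Ctx.right Γ (Γ := A :: Δ) γ).head :=
  ((uniform_append Γ Δ).tensLeft fun η => sem A η).comp
    ((Uniform.assl _ _ _).comp (uniform_split Γ (A :: Δ)))

theorem uniform_unbang (Γ : List Formula) :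
    Uniform (fun η : ℕ → SoftSpace K => semCtx η (Γ.map bang))
      (fun η => SoftSpace.bang (semCtx η Γ)) fun _ γ => Ctx.unbang Γ γ := by
  induction Γ with
  | nil => exact Uniform.bangUnit K
  | cons A Γ ih => exact (Uniform.bangTensor _ _).comp (ih.tensLeft fun η => (sem A η).bang)

/-- Each copy is one application of `exists_uniform_dup`, and raises the required multiple by a
constant. -/
theorem uniform_copies (A : Formula) (Γ : List Formula) (n : ℕ) : ∃ s : ℕ,
    Uniform (fun η : ℕ → SoftSpace K => tensor (semCtx η Γ) ((sem A η).multiple s))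
      (fun η => semCtx η (List.replicate n A ++ Γ)) fun _ γ =>
        Ctx.append (List.replicate n A) (Γ := Γ) (Ctx.copies (A := A) γ.2 n) γ.1 := by
  induction n with
  | zero => exact ⟨0, Uniform.fst _ _⟩
  | succ n ih =>
      obtain ⟨s, hs⟩ := ih
      obtain ⟨c, hc⟩ := exists_uniform_dup K
      exact ⟨_, (hs.tensLeft fun η => sem A η).comp ((Uniform.swapLast _ _ _).comp
        (hc s (fun η => sem A η) fun η => semCtx η Γ))⟩

/-! ## Soundness -/

/-- Indexing by pairs of an environment and a small space makes the realiser common to both, so it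
survives the formation of the product for every environment. -/
theorem Uniform.tuple {A : (ℕ → SoftSpace K) → SoftSpace K}
    {B : (ℕ → SoftSpace K) → SoftSpace K}
    {f : ∀ η C, (A η).carrier → (B (extend C η)).carrier}
    (h : Uniform (fun p : (ℕ → SoftSpace K) × SmallSpace K softMonoid => A p.1)
      (fun p => B (extend p.2 p.1)) fun p => f p.1 p.2) :
    ∃ g : ∀ η, (A η).carrier → (prod fun C => B (extend C η)).carrier,
      (∀ η x C, (g η x).1 C = f η C x) ∧ Uniform A (fun η => prod fun C => B (extend C η)) g := by
  obtain ⟨φ, e, h⟩ := h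
  choose g h1 h2 using fun η => Realizes.tuple (F := fun C => B (extend C η)) fun C => h (η, C)
  exact ⟨g, h1, φ, e, h2⟩

/-- Quantifying over all environments inside the induction makes the hypothesis strong enough for
$\forall$-right. That `Den` is a graph gives existence and uniqueness of denotations simultaneously.
-/
theorem soundness {Γ : List Formula} {A : Formula} (π : Proof Γ A) :
    ∃ F : ∀ η : ℕ → SoftSpace K, Ctx η Γ → El η A,
      Uniform (fun η => semCtx η Γ) (fun η => sem A η) F ∧
      ∀ η γ a, Den π η γ a ↔ a = F η γ := by
  induction π with
  | ax A => exact ⟨fun _ γ => γ.2, Uniform.snd _ _, fun _ _ _ => Iff.rfl⟩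
  | @cut Γ Δ A B π ρ ihπ ihρ =>
      obtain ⟨F, hF, hF'⟩ := ihπ
      obtain ⟨G, hG, hG'⟩ := ihρ
      refine ⟨fun η γ => G η (Ctx.cons (Ctx.left Δ γ) (F η (Ctx.right Δ γ))),
        hG.comp ((hF.tensRight fun η => semCtx η Δ).comp (uniform_split Δ Γ)), fun η γ b => ?_⟩
      simp only [Den, hF', hG', exists_eq_left]
  | weak B π ih =>
      obtain ⟨F, hF, hF'⟩ := ih
      exact ⟨fun η γ => F η γ.1, hF.comp (Uniform.fst _ _), fun η γ a => hF' η γ.1 a⟩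
  | exch A Γ Δ π ih =>
      obtain ⟨F, hF, hF'⟩ := ih
      exact ⟨_, hF.comp (uniform_exch A Γ Δ), fun η γ a => hF' η _ a⟩
  | tensL π ih =>
      obtain ⟨F, hF, hF'⟩ := ih
      exact ⟨_, hF.comp (Uniform.assl _ _ _), fun η γ a => hF' η _ a⟩
  | @tensR Γ Δ A B π ρ ihπ ihρ =>
      obtain ⟨F, hF, hF'⟩ := ihπ
      obtain ⟨G, hG, hG'⟩ := ihρ
      refine ⟨fun η γ => (F η (Ctx.right Δ γ), G η (Ctx.left Δ γ)),
        (Uniform.swap _ _).comp ((hG.tensLeft _).comp ((hF.tensRight _).comp (uniform_split Δ Γ))),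
        fun η γ p => ?_⟩
      simp only [Den, hF', hG']
      exact ⟨fun h => Prod.ext h.1 h.2, fun h => ⟨congrArg Prod.fst h, congrArg Prod.snd h⟩⟩
  | @limpL Γ Δ A B C π ρ ihπ ihρ =>
      obtain ⟨F, hF, hF'⟩ := ihπ
      obtain ⟨G, hG, hG'⟩ := ihρ
      refine ⟨fun η γ => G η (Ctx.cons (Ctx.left Δ γ.1) (El.app γ.2 (F η (Ctx.right Δ γ.1)))),
        hG.comp (((Uniform.eval (fun η => sem A η) (fun η => sem B η)).tensRight
          fun η => semCtx η Δ).comp (((Uniform.swap _ _).tensRight _).comp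
          (((hF.tensLeft fun η => sem (limp A B) η).tensRight fun η => semCtx η Δ).comp
          ((Uniform.assr _ _ _).comp ((uniform_split Δ Γ).tensLeft fun η => sem (limp A B) η))))),
        fun η γ b => ?_⟩
      simp only [Den, hF', hG', exists_eq_left]
      rfl
  | @limpR Γ A B π ih =>
      obtain ⟨F, hF, hF'⟩ := ih
      obtain ⟨g, hg, hg'⟩ := Uniform.curry (A := fun η => semCtx η Γ) (B := fun η => sem A η) hF
      refine ⟨g, hg', fun η γ f => ?_⟩
      simp only [Den, hF']
      constructor
      · exact fun h => Subtype.ext (funext fun a => (h a).trans (hg η γ a).symm)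
      · rintro rfl a
        exact hg η γ a
  | @allL Γ A B C π ih =>
      obtain ⟨F, hF, hF'⟩ := ih
      let σ := fun η : ℕ → SoftSpace K => (inst_iso A C η).some
      -- A realiser of a family realises each of its components, so projection is realised by the
      -- identity algorithm.
      have h1 : Uniform (fun η => sem (all A) η) (fun η => sem (inst A C) η)
          fun η x => (σ η).equiv (El.at x (sem C η).small) :=
        Uniform.of_maj fun η a d x hx => ((σ η).maj_iff _ _ _).2 (hx _)
      refine ⟨_, hF.comp (h1.tensRight fun η => semCtx η Γ), fun η γ b => ?_⟩
      simp only [Den, hF', (σ η).corr_iff, exists_eq_left]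
      rfl
  | @allR Γ A π ih =>
      obtain ⟨F, hF, hF'⟩ := ih
      choose σ h1 h2 using fun (η : ℕ → SoftSpace K) (C : SmallSpace K softMonoid) =>
        exists_shifted C η Γ
      -- The induction hypothesis at all environments `extend C η` at once, with the context
      -- transported from `η`.
      have h3 := (hF.reindex fun p : (ℕ → SoftSpace K) × SmallSpace K softMonoid =>
        extend p.2 p.1).comp (A := fun p => semCtx p.1 Γ) (f := fun p => σ p.1 p.2)
        (Uniform.of_maj fun p => h1 p.1 p.2)
      obtain ⟨g, hg, hg'⟩ := Uniform.tuple (A := fun η => semCtx η Γ) (B := fun η => sem A η)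
        (f := fun η C γ => F (extend C η) (σ η C γ)) h3
      refine ⟨g, hg', fun η γ x => ?_⟩
      simp only [Den, hF', h2, exists_eq_left]
      constructor
      · exact fun h => Subtype.ext (funext fun C => (h C).trans (hg η γ C).symm)
      · rintro rfl C
        exact hg η γ C
  | @prom Γ A π ih =>
      obtain ⟨F, hF, hF'⟩ := ih
      exact ⟨_, hF.bang.comp (uniform_unbang Γ), fun η γ a => hF' η _ a⟩
  | @contr Γ A B n π ih =>
      obtain ⟨F, hF, hF'⟩ := ih
      obtain ⟨s, hs⟩ := uniform_copies (K := K) A Γ (n + 1)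
      exact ⟨_, hF.comp (hs.comp ((Uniform.bangMultiple s fun η => sem A η).tensRight _)),
        fun η γ a => hF' η _ a⟩

end SAL

/-! ### Binary words as proofs and as realisers. -/

namespace SAL

open ResourceMonoid CompModel LengthSpace Formula

variable {K : CompModel}

/-! ## The denotation of the proofs representing words -/

section

variable {η : ℕ → SoftSpace K}

theorem Ctx.left_append : ∀ (Δ : List Formula) {Γ : List Formula} (δ : Ctx η Δ) (γ : Ctx η Γ),
    Ctx.left Δ (Ctx.append Δ δ γ) = δ
  | [], _, _, _ => rfl
  | _ :: Δ, Γ, δ, γ => Prod.ext (Ctx.left_append Δ (Γ := Γ) δ.1 γ) rfl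

theorem Ctx.right_append : ∀ (Δ : List Formula) {Γ : List Formula} (δ : Ctx η Δ) (γ : Ctx η Γ),
    Ctx.right Δ (Ctx.append Δ δ γ) = γ
  | [], _, _, _ => rfl
  | _ :: Δ, Γ, δ, γ => Ctx.right_append Δ (Γ := Γ) δ.1 γ

/-- The iteration `s_{b₁} (⋯ (s_{bₙ} x))`. -/
def iterate {X : Type*} (s₀ s₁ : X → X) (x : X) (w : List Bool) : X :=
  w.foldr (fun b y => cond b (s₁ y) (s₀ y)) x

theorem den_contrWeak {Γ : List Formula} {A B : Formula} : ∀ (n : ℕ)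
    (π : Proof (List.replicate n A ++ Γ) B) (γ : Ctx η (bang A :: Γ)) (b : El η B),
    Den (Proof.contrWeak n π) η γ b ↔
      Den π η (Ctx.append (List.replicate n A) (Γ := Γ) (Ctx.copies (A := A) γ.head n) γ.tail) b
  | 0, _, _, _ => Iff.rfl
  | _ + 1, _, _, _ => Iff.rfl

theorem den_exch_append {A B : Formula} {Γ Δ : List Formula} (π : Proof (A :: (Γ ++ Δ)) B)
    (γ : Ctx η Γ) (δ : Ctx η (A :: Δ)) (b : El η B) :
    Den (Proof.exch A Γ Δ π) η (Ctx.append Γ γ δ) b ↔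
      Den π η (Ctx.cons (A := A) (Γ := Γ ++ Δ) (Ctx.append Γ γ δ.tail) δ.head) b := by
  simp only [Den, Ctx.left_append, Ctx.right_append]

theorem den_chain (s₀ s₁ : El η endo) (a : El η (atom 0)) : ∀ w : List Bool,
    Den (Proof.chain w) η (Ctx.append (List.replicate (Proof.occ true w) endo)
      (Ctx.copies (A := endo) s₁ (Proof.occ true w))
      (Ctx.append (List.replicate (Proof.occ false w) endo)
        (Ctx.copies (A := endo) s₀ (Proof.occ false w))
        (Ctx.cons (Γ := []) (A := atom 0) () a))) (iterate s₀.1 s₁.1 a w)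
  | [] => rfl
  | true :: w => ⟨_, den_chain s₀ s₁ a w, rfl⟩
  | false :: w => (den_exch_append (Γ := List.replicate (Proof.occ true w) endo)
      (Δ := List.replicate (Proof.occ false w) endo ++ [atom 0]) _
      (Ctx.copies (A := endo) s₁ (Proof.occ true w)) _ _).2 ⟨_, den_chain s₀ s₁ a w, rfl⟩

/-- Determines the denotation by its values only, so that an element built together with a good
realiser can be recognised as the denotation. -/
theorem den_word (w : List Bool) (x : El η listSAL)
    (hx : ∀ (C : SmallSpace K softMonoid) (s₀ s₁ : El (extend C η) endo)
      (a : El (extend C η) (atom 0)),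
      El.app (El.app (B := endo) (El.app (A := bang endo) (B := limp (bang endo) endo)
        (El.at x C) s₀) s₁) a = iterate s₀.1 s₁.1 a w) :
    Den (Proof.word w) η () x := by
  intro C
  refine ⟨(), trivial, fun s₀ s₁ a => ?_⟩
  refine (den_contrWeak (A := endo) (Γ := [bang endo, atom 0]) (Proof.occ false w) _
    (((((), a), s₁), s₀) : Ctx (extend C η) [bang endo, bang endo, atom 0]) _).2 ?_
  refine (den_exch_append (A := bang endo) (Δ := [atom 0]) _ _ _ _).2 ?_
  refine (den_contrWeak (A := endo) _ _ _ _).2 ?_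
  have key : ∀ b, b = iterate (Subtype.val s₀) (Subtype.val s₁) a w →
      Den (Proof.chain w) (extend C η) (Ctx.append (List.replicate (Proof.occ true w) endo)
        (Ctx.copies (A := endo) s₁ (Proof.occ true w))
        (Ctx.append (List.replicate (Proof.occ false w) endo)
          (Ctx.copies (A := endo) s₀ (Proof.occ false w))
          (Ctx.cons (Γ := []) (A := atom 0) () a))) b := by
    rintro _ rfl
    exact den_chain s₀ s₁ a w
  exact key _ (hx C s₀ s₁ a)

end

/-! ## Realisers of words -/

/-- The pair of codes is duplicated: one copy is used to apply the code selected by `b`, the other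
is kept for the remaining letters. The duplication causes the term linear in the size of the pair.
-/
theorem exists_step_code (K : CompModel) (b : Bool) : ∃ (e : K.L) (c : ℕ), ∀ d₀ d₁ x y t,
    K.Eval (cond b d₁ d₀) x y t →
    K.Eval e (K.pair (K.pair d₀ d₁) x) (K.pair (K.pair d₀ d₁) y)
      (t + (c * K.size (K.pair d₀ d₁) + c)) := by
  obtain ⟨pick, k₀, hpick⟩ : ∃ (e : K.L) (k : ℕ), ∀ d₀ d₁,
      K.Eval e (K.pair d₀ d₁) (cond b d₁ d₀) k := by
    obtain ⟨p, k, hp⟩ := K.exists_throwfirst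
    cases b with
    | true => exact ⟨p, k, hp⟩
    | false =>
        obtain ⟨s, l, hs⟩ := K.exists_swap
        obtain ⟨e, m, he⟩ := exists_comp_code (K := K) s p
        exact ⟨e, _, fun d₀ d₁ => he _ _ _ _ _ (hs _ _) (hp _ _)⟩
  obtain ⟨s, k₁, hs⟩ := K.exists_swap
  obtain ⟨ev, k₂, hev⟩ := K.exists_eval
  obtain ⟨r, c, hr⟩ := K.exists_contr
  obtain ⟨as, k₃, has⟩ := exists_assr_code (K := K)
  obtain ⟨tr, k₄, htr⟩ := exists_tens_code (K := K) r
  obtain ⟨tp, k₅, htp⟩ := exists_tens_code (K := K) pick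
  obtain ⟨ap, k₆, hap⟩ := exists_comp_code (K := K) tp ev
  obtain ⟨tap, k₇, htap⟩ := exists_tens_code (K := K) ap
  obtain ⟨e₁, k₈, he₁⟩ := exists_comp_code (K := K) tr as
  obtain ⟨e₂, k₉, he₂⟩ := exists_comp_code (K := K) e₁ s
  obtain ⟨e₃, k₁₀, he₃⟩ := exists_comp_code (K := K) e₂ tap
  obtain ⟨e₄, k₁₁, he₄⟩ := exists_comp_code (K := K) e₃ s
  refine ⟨e₄, c + (k₄ + k₃ + k₈ + k₁ + k₉ + (k₀ + k₅ + k₂ + k₆ + k₇) + k₁₀ + k₁ + k₁₁),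
    fun d₀ d₁ x y t h => ?_⟩
  have h1 : K.Eval ap (K.pair (K.pair d₀ d₁) x) y (k₀ + k₅ + (t + k₂) + k₆) := by
    obtain ⟨h2, h3⟩ := hev _ _ _ h.1
    exact hap _ _ _ _ _ (htp _ _ x _ (hpick d₀ d₁)) ⟨h2, h3.trans (Nat.add_le_add_right h.2 _)⟩
  refine (he₄ _ _ _ _ _ (he₃ _ _ _ _ _ (he₂ _ _ _ _ _ (he₁ _ _ _ _ _
    (htr _ _ x _ (hr (K.pair d₀ d₁))) (has _ _ _)) (hs _ _)) (htap _ _ _ _ h1)) (hs _ _)).mono ?_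
  rw [Nat.add_mul]
  omega

/-- Algorithms for words, computed letter by letter, that iterate the two functions given by the
codes `d₀` and `d₁`. -/
theorem exists_word_codes (K : CompModel) : ∃ (U : List Bool → K.L) (E : Bool → K.L) (k : ℕ),
    (∀ w b, K.Eval (E b) (U w) (U (w ++ [b])) k) ∧ (∀ w, K.size (U w) ≤ k * w.length + k) ∧
    (∀ d₀ d₁ x, K.Eval (U []) (K.pair (K.pair d₀ d₁) x) x k) ∧
    ∀ w b d₀ d₁ x y z s t, K.Eval (cond b d₁ d₀) x y s →
      K.Eval (U w) (K.pair (K.pair d₀ d₁) y) z t →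
      K.Eval (U (w ++ [b])) (K.pair (K.pair d₀ d₁) x) z
        (s + t + (k * K.size (K.pair d₀ d₁) + k)) := by
  obtain ⟨p, k₀, hp⟩ := K.exists_throwfirst
  obtain ⟨cm, k₁, hcm⟩ := K.exists_comp
  choose st c hst using exists_step_code K
  choose f hf1 hf2 hf3 hf4 using fun b u => hcm (st b) u
  -- Composition `f b u` runs the step for `b` before `u`, so the last letter of the word acts
  -- first, as in $s_{b_1}(\cdots(s_{b_n}x))$. The empty word discards the codes.
  let U : List Bool → K.L := fun w => w.foldl (fun u b => f b u) p
  have hU : ∀ w b, U (w ++ [b]) = f b (U w) := fun w b => by simp [U]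
  obtain ⟨s, k₂, hs⟩ := K.exists_swap
  -- `E b` maps $u$ to $(u,st_b)$, then to $(st_b,u)$, then composes: constant time, whatever the
  -- length of the word.
  choose tc k₃ htc using fun b => K.exists_tensconst (st b)
  choose e₁ k₄ he₁ using fun b => exists_comp_code (K := K) (tc b) s
  choose e₂ k₅ he₂ using fun b => exists_comp_code (K := K) (e₁ b) cm
  have hE : ∀ w b, K.Eval (e₂ b) (U w) (U (w ++ [b])) (k₃ b + k₂ + k₄ b + k₁ + k₅ b) := by
    intro w b
    rw [hU]
    exact he₂ b _ _ _ _ _ (he₁ b _ _ _ _ _ (htc b _) (hs _ _)) ⟨hf1 b _, hf3 b _⟩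
  let k := K.size p + k₀ + k₁ + ((k₃ true + k₂ + k₄ true + k₁ + k₅ true) +
    (k₃ false + k₂ + k₄ false + k₁ + k₅ false)) + (c true + c false) +
    (K.size (st true) + K.size (st false))
  have hk : k = K.size p + k₀ + k₁ + ((k₃ true + k₂ + k₄ true + k₁ + k₅ true) +
    (k₃ false + k₂ + k₄ false + k₁ + k₅ false)) + (c true + c false) +
    (K.size (st true) + K.size (st false)) := rfl
  clear_value k
  refine ⟨U, e₂, k, fun w b => (hE w b).mono ?_, fun w => ?_, fun d₀ d₁ x => ?_, ?_⟩
  · cases b <;> omega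
  · induction w using List.reverseRecOn with
    | nil =>
        have : K.size (U []) = K.size p := rfl
        omega
    | append_singleton w b ih =>
        rw [hU, List.length_append, List.length_singleton, Nat.mul_add]
        have := hf2 b (U w)
        have : K.size (st b) ≤ K.size (st true) + K.size (st false) := by cases b <;> omega
        omega
  · have h : K.Eval p (K.pair (K.pair d₀ d₁) x) x k₀ := hp _ _
    exact h.mono (by omega)
  · intro w b d₀ d₁ x y z s t h1 h2
    have h3 := hst b d₀ d₁ x y s h1
    obtain ⟨h4, h5⟩ := hf4 b (U w) _ _ _ h3.1 h2.1
    rw [hU]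
    refine ⟨h4, h5.trans ?_⟩
    have h6 := h3.2
    have h7 := h2.2
    have h8 : c b ≤ c true + c false := by cases b <;> omega
    have h9 : c b * K.size (K.pair d₀ d₁) + (c true + c false) + k₁ ≤
        k * K.size (K.pair d₀ d₁) + k :=
      by
      have h10 : c b * K.size (K.pair d₀ d₁) ≤ k * K.size (K.pair d₀ d₁) :=
        Nat.mul_le_mul_right _ (by omega)
      omega
    omega

/-- The function `((s₀, s₁), x) ↦ s_{b₁} (⋯ (s_{bₙ} x))` is realised with linear resources. -/
theorem exists_word_realizers (K : CompModel) : ∃ (U : List Bool → K.L) (E : Bool → K.L) (k : ℕ),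
    (∀ w b, K.Eval (E b) (U w) (U (w ++ [b])) k) ∧ (∀ w, K.size (U w) ≤ k * w.length + k) ∧
    ∀ (A : SoftSpace K) (w : List Bool), Realizes
      (tensor (tensor (SoftSpace.bang (hom A A)) (SoftSpace.bang (hom A A))) A) A
      (⟨[k * w.length + k], k * w.length + k⟩ : Soft) (U w)
      fun p => iterate p.1.1.1 p.1.2.1 p.2 w := by
  obtain ⟨U, E, k, h1, h2, h3, h4⟩ := exists_word_codes K
  -- The resources of the two codes are used once per letter. The argument and its majorizer are
  -- generalised because the last letter, applied first, replaces them.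
  have key : ∀ (A : SoftSpace K) (f₀ f₁ : Hom A A) (β₀ β₁ : Soft) (d₀ d₁ : K.L),
      (hom A A).maj β₀ d₀ f₀ → (hom A A).maj β₁ d₁ f₁ → ∀ (w : List Bool) (γ : Soft) (x : K.L)
      (a : A.carrier), A.maj γ x a → ∃ (b : Soft) (c : K.L) (t : ℕ),
        A.maj b c (iterate f₀.1 f₁.1 a w) ∧
        softMonoid.LeBy t b (Soft.smul w.length (β₀ + β₁) + γ) ∧
        K.Eval (U w) (K.pair (K.pair d₀ d₁) x) c
          (t + (w.length * (k * K.size (K.pair d₀ d₁) + k) + k)) := by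
    intro A f₀ f₁ β₀ β₁ d₀ d₁ hf₀ hf₁ w
    induction w using List.reverseRecOn with
    | nil =>
        intro γ x a ha
        refine ⟨γ, x, 0, ha, LeBy.of_le (softMonoid.le_add_left _ _), ?_⟩
        simpa using h3 d₀ d₁ x
    | append_singleton w b ih =>
        intro γ x a ha
        obtain ⟨b₁, y, s, h5, h6, h7⟩ : ∃ (b₁ : Soft) (y : K.L) (s : ℕ),
            A.maj b₁ y (iterate f₀.1 f₁.1 a [b]) ∧ softMonoid.LeBy s b₁ (β₀ + β₁ + γ) ∧
            K.Eval (cond b d₁ d₀) x y s := by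
          cases b with
          | false =>
              obtain ⟨b₁, y, s, h5, h6, h7⟩ := (realizes_iff.1 hf₀).2 γ x a ha
              refine ⟨b₁, y, s, h5, h6.trans (LeBy.of_le ?_), h7⟩
              exact softMonoid.add_le_add γ (softMonoid.le_add_right β₀ β₁)
          | true =>
              obtain ⟨b₁, y, s, h5, h6, h7⟩ := (realizes_iff.1 hf₁).2 γ x a ha
              refine ⟨b₁, y, s, h5, h6.trans (LeBy.of_le ?_), h7⟩
              exact softMonoid.add_le_add γ (softMonoid.le_add_left β₁ β₀)
        obtain ⟨b₂, z, t, h8, h9, h10⟩ := ih b₁ y _ h5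
        refine ⟨b₂, z, t + s, ?_, ?_, (h4 w b d₀ d₁ x y z s _ h7 h10).mono ?_⟩
        · simpa [iterate] using h8
        · have h11 := h9.trans (h6.add_left (Soft.smul w.length (β₀ + β₁)))
          rw [List.length_append, List.length_singleton, Soft.add_smul, Soft.one_smul]
          rw [← add_assoc (Soft.smul w.length (β₀ + β₁) : softMonoid.carrier)] at h11
          exact h11
        · rw [List.length_append, List.length_singleton, Nat.add_mul]
          omega
  -- In `m`, the `1` ensures multiplicity at least `w.length`, one `k` pays for duplicating the
  -- codes in proportion to their norms, and `k * K.cp` with the other `k` for the parts of the time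
  -- independent of the codes.
  let m := k * K.cp + k + k + 1
  refine ⟨U, E, m, fun w b => (h1 w b).mono (by simp only [m]; omega), fun w => ?_, fun A w => ?_⟩
  · refine (h2 w).trans (Nat.add_le_add (Nat.mul_le_mul_right _ ?_) ?_) <;> simp only [m] <;> omega
  · refine realizes_iff.2 ⟨?_, ?_⟩
    · refine le_trans ?_ (Soft.le_norm_single _ _)
      refine (h2 w).trans (Nat.add_le_add (Nat.mul_le_mul_right _ ?_) ?_) <;>
        simp only [m] <;> omega
    · rintro a _ ⟨⟨f₀, f₁⟩, x⟩ ⟨-, _, x', b₁, γ, ⟨-, d₀, d₁, b₂, b₃, ⟨-, β₀, hf₀, h5⟩,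
        ⟨-, β₁, hf₁, h6⟩, rfl, h7⟩, hx, rfl, h8⟩
      obtain ⟨b, c, t, h9, h10, h11⟩ := key A f₀ f₁ β₀ β₁ d₀ d₁ hf₀ hf₁ w γ x' x hx
      refine ⟨b, c, _, h9, ?_, h11⟩
      -- Only `w.length` of the available multiples majorize the result; the surplus multiples and
      -- the head `m * w.length + m` pay for the time.
      have h12 := Soft.leBy_smul w.length (m * w.length + m) (m * w.length + m) (β₀ + β₁) (by
        have : 1 * w.length ≤ m * w.length := Nat.mul_le_mul_right _ (by simp only [m]; omega)
        omega)
      have h13 := ((((LeBy.of_le h5).add (LeBy.of_le h6)).trans (LeBy.of_le h7)).add_right γ).trans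
        (LeBy.of_le h8)
      have h14 := h10.trans (h12.add_right γ)
      rw [add_assoc (⟨[_], _⟩ : softMonoid.carrier)] at h14
      have h15 := h14.trans (h13.add_left _)
      refine h15.mono ?_
      have h16 := (hom A A).str.size_le hf₀
      have h17 := (hom A A).str.size_le hf₁
      have h18 := norm_add_le softMonoid β₀ β₁
      have h19 : w.length * (k * K.size (K.pair d₀ d₁)) ≤
          (w.length * k) * softMonoid.norm (β₀ + β₁ : Soft) + w.length * k * K.cp := by
        rw [← mul_assoc, ← Nat.mul_add]
        refine Nat.mul_le_mul_left _ ?_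
        rw [K.size_pair]
        omega
      have h20 : (w.length * k) * softMonoid.norm (β₀ + β₁ : Soft) ≤
          (m * w.length + m - w.length) * softMonoid.norm (β₀ + β₁ : Soft) := by
        refine Nat.mul_le_mul_right _ ?_
        have : m * w.length = k * K.cp * w.length + k * w.length + k * w.length + w.length := by
          simp only [m]; ring
        have := Nat.mul_comm w.length k
        omega
      have h21 : w.length * k * K.cp + w.length * k + k ≤ m * w.length + m := by
        have : m * w.length = k * K.cp * w.length + k * w.length + k * w.length + w.length := by
          simp only [m]; ring
        have : w.length * k * K.cp = k * K.cp * w.length := by ring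
        have := Nat.mul_comm w.length k
        have : k ≤ m := by simp only [m]; omega
        omega
      rw [Nat.mul_add]
      omega

end SAL

namespace SAL

open ResourceMonoid CompModel LengthSpace Formula

variable {K : CompModel}

/-! ## Realisers of the denotations of words -/

/-- Currying twice is a fixed algorithm, so `V` does not depend on `w`, and the realiser `y` does
not depend on the environment or on the component of the product. -/
theorem exists_realizer_listSAL (K : CompModel) :
    ∃ (U : List Bool → K.L) (E : Bool → K.L) (V : K.L) (k : ℕ),
    (∀ w b, K.Eval (E b) (U w) (U (w ++ [b])) k) ∧ (∀ w, K.size (U w) ≤ k * w.length + k) ∧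
    ∀ w, ∃ y, K.Eval V (U w) y k ∧ ∀ η : ℕ → SoftSpace K, ∃ x : El η listSAL,
      Den (Proof.word w) η () x ∧
      (sem listSAL η).maj (⟨[k * w.length + k], k * w.length + k⟩ : Soft) y x := by
  obtain ⟨U, E, k, h1, h2, h3⟩ := exists_word_realizers K
  obtain ⟨e, n, he⟩ := exists_curry_realizer K softMonoid
  obtain ⟨V, l, hV⟩ := exists_comp_code e e
  let m := k + (n + n + n + n + n + n) + l
  have hm : m = k + (n + n + n + n + n + n) + l := rfl
  clear_value m
  refine ⟨U, E, V, m, fun w b => (h1 w b).mono (by omega), fun w =>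
    (h2 w).trans (Nat.add_le_add (Nat.mul_le_mul_right _ (by omega)) (by omega)), fun w => ?_⟩
  obtain ⟨y₁, h4, -, h5⟩ := he (U w)
  obtain ⟨y₂, h6, -, h7⟩ := he y₁
  refine ⟨y₂, (hV _ _ _ _ _ h4 h6).mono (by omega), fun η => ?_⟩
  let u : Soft := ⟨[n], 0⟩
  have hu : n ≤ softMonoid.norm u := Soft.le_norm_single n 0
  choose g₁ h8 h9 using fun A : SoftSpace K => h5 u _ _ _ _ _ hu (h3 A w)
  choose g₂ h10 h11 using fun A : SoftSpace K => h7 u _ _ _ _ _ hu (h9 A)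
  have h12 : ∀ A : SoftSpace K, (hom (SoftSpace.bang (hom A A))
      (hom (SoftSpace.bang (hom A A)) (hom A A))).maj
      (⟨[m * w.length + m], m * w.length + m⟩ : Soft) y₂ ⟨g₂ A, _, _, h11 A⟩ := by
    intro A
    refine (h11 A).mono ?_
    have h13 : k * w.length ≤ m * w.length := Nat.mul_le_mul_right _ (by omega)
    refine ⟨0, ?_⟩
    -- Each of the two curryings adds `u` three times, which gives six summands `n`.
    change Soft.leAux 0 [n + (n + (n + (n + (n + (n + (k * w.length + k))))))]
      (max 0 (max 0 (max 0 (max 0 (max 0 (max 0 (k * w.length + k))))))) _ _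
    simp only [Soft.leAux, Nat.zero_max]
    exact ⟨0, by omega, rfl, by omega⟩
  refine ⟨⟨fun C => ⟨g₂ C.toSpace, _, _, h11 C.toSpace⟩, _, y₂, fun C => h12 C.toSpace⟩,
    den_word w _ fun C s₀ s₁ a => ?_, fun C => h12 C.toSpace⟩
  exact (congrArg (fun r : Hom C.toSpace C.toSpace => r.1 a)
    ((h10 C.toSpace s₀ s₁))).trans (h8 C.toSpace (s₀, s₁) a)

/-- Promotion puts `0` in front of the list; it is replaced by `m`, which covers the size of `e`
even if the multiplicity is `0`. The number of entries depends on `j` only, and so does the degree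
of the resulting bound. -/
theorem exists_maj_bangN {η : ℕ → SoftSpace K} {A : Formula} {m n : ℕ} {e : K.L} {x : El η A}
    (hx : (sem A η).maj (⟨[m], n⟩ : Soft) e x) : ∀ j : ℕ, ∃ y : El η (bangN j A),
      El.unbang j y = x ∧ (sem (bangN j A) η).maj (⟨List.replicate (j + 1) m, n⟩ : Soft) e y
  | 0 => ⟨x, rfl, hx⟩
  | j + 1 => by
      obtain ⟨y, h1, h2⟩ := exists_maj_bangN hx j
      refine ⟨y, h1, ?_, _, h2, 0, ?_⟩
      · have h3 : K.size e ≤ m := by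
          simpa [ResourceMonoid.norm, Soft.dist, Soft.distAux] using (sem A η).str.size_le hx
        refine h3.trans ?_
        change m ≤ m + n * _
        exact Nat.le_add_right _ _
      · change Soft.leAux 0 (0 :: List.replicate (j + 1) m) n (m :: List.replicate (j + 1) m) n
        simp only [Soft.leAux]
        exact ⟨0, by omega, Soft.leAux_refl _ (le_refl _)⟩

theorem unbang_injective {η : ℕ → SoftSpace K} {A : Formula} : ∀ j : ℕ,
    Function.Injective (El.unbang (η := η) (A := A) j)
  | 0 => fun _ _ h => h
  | j + 1 => fun _ _ h => unbang_injective j h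

/-- Dereliction is contraction with a single copy. -/
theorem uniform_unbangN (A : Formula) : ∀ j : ℕ,
    Uniform (fun η : ℕ → SoftSpace K => sem (bangN j A) η) (fun η => sem A η)
      fun _ x => El.unbang j x
  | 0 => Uniform.id _
  | j + 1 => by
      have h : Uniform (fun η : ℕ → SoftSpace K => (sem (bangN j A) η).multiple 0)
          (fun η => sem (bangN j A) η) fun _ x => x := by
        refine Uniform.of_maj ?_
        rintro η a d x ⟨b, h1, h2⟩
        rw [Nat.zero_add, Soft.one_smul] at h2
        exact (sem (bangN j A) η).str.mono h1 h2
      exact (uniform_unbangN A j).comp (h.comp (Uniform.bangMultiple 0 _))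

/-- Reading out a word is realisable. -/
theorem uniform_readOut (η : ℕ → SoftSpace K) :
    Uniform (fun _ : Unit => sem listSAL η) (fun _ => bin K softMonoid) fun _ x => readOut x := by
  let B := bin K softMonoid
  let S := B.small.toSpace
  let T : SoftSpace K := hom (SoftSpace.bang (hom S S)) (hom (SoftSpace.bang (hom S S)) (hom S S))
  have app : ∀ {A C : SoftSpace K} (x : A.carrier),
      Uniform (fun _ : Unit => hom A C) (fun _ => C) fun _ f => f.1 x := fun {A C} x => by
    obtain ⟨a, e, h⟩ := A.str.exists_maj x
    exact (Uniform.eval (fun _ => A) fun _ => C).comp (Uniform.pairConst (fun _ => h) _)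
  have h1 : Uniform (fun _ : Unit => sem listSAL η) (fun _ => T) fun _ x => El.at x B.small :=
    Uniform.of_maj fun _ a d x hx => hx B.small
  have h2 : Uniform (fun _ : Unit => S) (fun _ => B) fun _ x => B.smallEquiv.symm x :=
    Uniform.of_maj fun _ a d x hx => ((Iso.small B).maj_symm_iff a d x).2 hx
  exact h2.comp ((app (C := S) (B.smallEquiv [])).comp
    ((app (A := SoftSpace.bang (hom S S)) (C := hom S S) (succ true)).comp
    ((app (A := SoftSpace.bang (hom S S)) (C := hom (SoftSpace.bang (hom S S)) (hom S S))
      (succ false)).comp h1)))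

/-! ### The polynomial bound on abstract time. -/

/-- Horner's scheme over a list of fixed length, with the multiplicity `max q m` estimated by `q +
m`. -/
theorem exists_polynomial_distAux : ∀ (l : List ℕ) (q r : ℕ), ∃ p : Polynomial ℕ, ∀ m,
    Soft.distAux [] 0 (addList l (List.replicate r m)) (max q m) ≤ p.eval m
  | [], q, 0 => ⟨0, fun m => by simp [addList, Soft.distAux]⟩
  | n :: l, q, 0 => by
      obtain ⟨p, hp⟩ := exists_polynomial_distAux l q 0
      refine ⟨.C n + (.C q + .X) * p, fun m => ?_⟩
      have h := hp m
      rw [List.replicate_zero, addList_nil] at h ⊢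
      simp only [Soft.distAux, Polynomial.eval_add, Polynomial.eval_mul, Polynomial.eval_C,
        Polynomial.eval_X]
      exact Nat.add_le_add_left (Nat.mul_le_mul (by omega) h) _
  | [], q, r + 1 => by
      obtain ⟨p, hp⟩ := exists_polynomial_distAux [] q r
      refine ⟨.X + (.C q + .X) * p, fun m => ?_⟩
      have h := hp m
      simp only [addList] at h
      simp only [List.replicate_succ, addList, Soft.distAux, Polynomial.eval_add,
        Polynomial.eval_mul, Polynomial.eval_C, Polynomial.eval_X]
      exact Nat.add_le_add_left (Nat.mul_le_mul (by omega) h) _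
  | n :: l, q, r + 1 => by
      obtain ⟨p, hp⟩ := exists_polynomial_distAux l q r
      refine ⟨.C n + .X + (.C q + .X) * p, fun m => ?_⟩
      simp only [List.replicate_succ, addList, Soft.distAux, Polynomial.eval_add,
        Polynomial.eval_mul, Polynomial.eval_C, Polynomial.eval_X]
      exact Nat.add_le_add_left (Nat.mul_le_mul (by omega) (hp m)) _

theorem eval_mono (p : Polynomial ℕ) {m n : ℕ} (h : m ≤ n) : p.eval m ≤ p.eval n := by
  simp only [Polynomial.eval_eq_sum_range]
  exact Finset.sum_le_sum fun i _ => Nat.mul_le_mul_left _ (Nat.pow_le_pow_left h i)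

/-- The function induced by a proof, with algorithms that compute it. -/
theorem exists_algorithm (η : ℕ → SoftSpace K) {j k : ℕ}
    (π : Proof [] (limp (bangN j listSAL) (bangN k listSAL))) :
    ∃ f : List Bool → List Bool, Induces η π f ∧ (∀ g, Induces η π g → g = f) ∧
      ∃ (U : List Bool → K.L) (E : Bool → K.L) (V : K.L) (n : ℕ) (p : Polynomial ℕ),
        (∀ w b, K.Eval (E b) (U w) (U (w ++ [b])) n) ∧ (∀ w, K.size (U w) ≤ n * w.length + n) ∧
        ∀ w, K.Eval V (U w) (K.Phi (f w)) (p.eval w.length) := by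
  obtain ⟨H, -, hH⟩ := soundness (K := K) π
  obtain ⟨U, E, V, m, h1, h2, h3⟩ := exists_realizer_listSAL K
  choose y h4 h5 using h3
  choose x h6 h7 using fun w => h5 w η
  choose z h8 h9 using fun w => exists_maj_bangN (h7 w) j
  let F : El η (limp (bangN j listSAL) (bangN k listSAL)) := H η ()
  have hF : Uniform (fun _ : Unit => sem (bangN j listSAL) η) (fun _ => bin K softMonoid)
      fun _ x => readOut (El.unbang k (El.app F x)) := by
    have h10 : Uniform (fun _ : Unit => sem (bangN j listSAL) η)
        (fun _ => sem (bangN k listSAL) η) fun _ x => El.app F x := by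
      obtain ⟨φ, e, h⟩ := Subtype.property F
      exact ⟨φ, e, fun _ => h⟩
    exact (uniform_readOut η).comp (((uniform_unbangN listSAL k).reindex fun _ => η).comp h10)
  obtain ⟨φ, e, hφ⟩ := hF
  obtain ⟨W, c, hW⟩ := exists_comp_code V e
  -- The majorizer `φ` is independent of the word, and the `j + 1` equal entries come from the
  -- promoted word.
  obtain ⟨p, hp⟩ := exists_polynomial_distAux (Soft.lst φ) (Soft.mul φ) (j + 1)
  refine ⟨fun w => readOut (El.unbang k (El.app F (z w))), ⟨F, (hH η () F).2 rfl, fun w =>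
    ⟨z w, by rw [h8]; exact h6 w, rfl⟩⟩, ?_, U, E, W, m,
    .C m + p.comp (.C m * .X + .C m) + .C c, h1, h2, fun w => ?_⟩
  · rintro g ⟨G, hG, hg⟩
    obtain rfl := (hH η () G).1 hG
    funext w
    obtain ⟨x', h10, h11⟩ := hg w
    obtain ⟨J, -, hJ⟩ := soundness (K := K) (Proof.word w)
    have h12 : x' = z w := unbang_injective j
      (((hJ η () _).1 h10).trans ((hJ η () _).1 (by rw [h8]; exact h6 w)).symm)
    rw [h11, h12]
  · obtain ⟨b, d, t, ⟨rfl, -⟩, h10, h11⟩ := (realizes_iff.1 (hφ ())).2 _ _ _ (h9 w)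
    refine (hW _ _ _ _ _ (h4 w) h11).mono ?_
    have h12 : t ≤ p.eval (m * w.length + m) :=
      (Nat.le_add_right _ _).trans (h10.norm_le.trans (hp _))
    simp only [Polynomial.eval_add, Polynomial.eval_mul, Polynomial.eval_C, Polynomial.eval_X,
      Polynomial.eval_comp]
    omega

end SAL

/-! ### Realisation by Turing machines. -/

namespace SAL

open Turing StateTransition

attribute [local instance] FinTM2.kFin FinTM2.ΛFin FinTM2.σFin

/-! ## Runs of deterministic machines -/

/-- `f` leads from `a` to `b` in at most `n` steps. -/
def StepsTo {σ : Type*} (f : σ → Option σ) (n : ℕ) (a b : σ) : Prop :=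
  Nonempty (EvalsToInTime f a (some b) n)

section

variable {σ τ : Type*} {f : σ → Option σ} {g : τ → Option τ} {a b c : σ} {m n : ℕ}

theorem StepsTo.trans (h : StepsTo f m a b) (h' : StepsTo f n b c) : StepsTo f (m + n) a c := by
  obtain ⟨h⟩ := h
  obtain ⟨h'⟩ := h'
  rw [Nat.add_comm]
  exact ⟨EvalsToInTime.trans f m n a b _ h h'⟩

theorem StepsTo.mono (h : StepsTo f m a b) (hmn : m ≤ n) : StepsTo f n a b := by
  obtain ⟨h⟩ := h
  exact ⟨h.toEvalsTo, h.steps_le_m.trans hmn⟩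

theorem StepsTo.single (h : f a = some b) : StepsTo f 1 a b := ⟨⟨1, h⟩, le_refl 1⟩

theorem StepsTo.head (h : f a = some b) (h' : StepsTo f n b c) : StepsTo f (n + 1) a c :=
  ((StepsTo.single h).trans h').mono (by omega)

/-- Invariants of a run, for the form in which runs are defined: iterates of a partial step function
that have not yet failed. -/
theorem iterate_bind_induction {P : ℕ → σ → Prop} (h0 : P 0 a)
    (hs : ∀ n b c, P n b → f b = some c → P (n + 1) c) :
    ∀ (n : ℕ) (b : σ), (flip bind f)^[n] (some a) = some b → P n b
  | 0, b, h => by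
      obtain rfl := Option.some.inj h
      exact h0
  | n + 1, b, h => by
      rw [Function.iterate_succ_apply'] at h
      cases h1 : (flip bind f)^[n] (some a) with
      | none =>
          rw [h1] at h
          cases h
      | some c =>
          rw [h1] at h
          exact hs n c b (iterate_bind_induction h0 hs n c h1) h

theorem StepsTo.map {tr : σ → τ} (htr : ∀ a b, f a = some b → g (tr a) = some (tr b))
    (h : StepsTo f n a b) : StepsTo g n (tr a) (tr b) := by
  obtain ⟨⟨⟨k, h⟩, hk⟩⟩ := h
  refine ⟨⟨⟨k, ?_⟩, hk⟩⟩
  refine iterate_bind_induction (P := fun n b => (flip bind g)^[n] (some (tr a)) = some (tr b)) rfl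
    (fun n b c h1 h2 => ?_) k b h
  rw [Function.iterate_succ_apply', h1]
  exact htr b c h2

end

/-! ## The length of the output -/

/-- An upper bound for the number of letters written by a statement. -/
def pushes {K : Type*} {Γ : K → Type*} {Λ σ : Type*} : TM2.Stmt Γ Λ σ → ℕ
  | .push _ _ q => pushes q + 1
  | .peek _ _ q => pushes q
  | .pop _ _ q => pushes q
  | .load _ q => pushes q
  | .branch _ q₁ q₂ => pushes q₁ + pushes q₂
  | .goto _ => 0
  | .halt => 0

theorem length_stepAux_le {K : Type*} [DecidableEq K] {Γ : K → Type*} {Λ σ : Type*} (k : K) :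
    ∀ (q : TM2.Stmt Γ Λ σ) (v : σ) (S : ∀ k, List (Γ k)),
      ((TM2.stepAux q v S).stk k).length ≤ (S k).length + pushes q
  | .push j f q, v, S => by
      refine (length_stepAux_le k q v _).trans ?_
      simp only [pushes]
      by_cases h : k = j
      · subst h
        simp only [Function.update_self, List.length_cons]
        omega
      · rw [Function.update_of_ne h]
        omega
  | .peek _ f q, v, S => length_stepAux_le k q _ S
  | .pop j f q, v, S => by
      refine (length_stepAux_le k q _ _).trans (Nat.add_le_add_right ?_ _)
      by_cases h : k = j
      · subst h
        simp
      · rw [Function.update_of_ne h]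
  | .load a q, v, S => length_stepAux_le k q _ S
  | .branch f q₁ q₂, v, S => by
      have h1 := length_stepAux_le k q₁ v S
      have h2 := length_stepAux_le k q₂ v S
      simp only [TM2.stepAux, pushes]
      cases f v <;> simp only [cond_true, cond_false] <;> omega
  | .goto _, _, _ => Nat.le_add_right _ _
  | .halt, _, _ => Nat.le_add_right _ _

theorem initList_stk (tm : FinTM2) (s : List (tm.Γ tm.k₀)) :
    (initList tm s).stk = Function.update (fun _ => []) tm.k₀ s := by
  funext k
  unfold initList Function.update
  by_cases h : k = tm.k₀
  · subst h
    simp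
  · simp [h]

theorem haltList_stk (tm : FinTM2) (s : List (tm.Γ tm.k₁)) :
    (haltList tm s).stk = Function.update (fun _ => []) tm.k₁ s := by
  funext k
  unfold haltList Function.update
  by_cases h : k = tm.k₁
  · subst h
    simp
  · simp [h]

/-- The length of the output is bounded by the length of the input and the time. -/
theorem exists_output_length_le (tm : FinTM2) : ∃ C : ℕ, ∀ s s' t,
    Nonempty (TM2OutputsInTime tm s (some s') t) → s'.length ≤ s.length + C * t := by
  -- One step executes the statement of one label, so the sum over all labels bounds the growth of
  -- any stack in a step.
  refine ⟨∑ l : tm.Λ, pushes (tm.m l), fun s s' t ⟨⟨⟨n, hn⟩, ht⟩⟩ => ?_⟩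
  have h := iterate_bind_induction (f := tm.step) (a := initList tm s)
    (P := fun n c => (c.stk tm.k₁).length ≤ s.length + (∑ l : tm.Λ, pushes (tm.m l)) * n) ?_ ?_
    n (haltList tm s') hn
  · rw [haltList_stk, Function.update_self] at h
    exact h.trans (Nat.add_le_add_left (Nat.mul_le_mul_left _ ht) _)
  · rw [initList_stk]
    by_cases h : tm.k₁ = tm.k₀
    · have : ∀ k, k = tm.k₀ → (Function.update (fun _ => []) tm.k₀ s k : List (tm.Γ k)).length ≤
          s.length := by
        rintro k rfl
        simp
      exact (this _ h).trans (Nat.le_add_right _ _)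
    · rw [Function.update_of_ne h]
      exact Nat.zero_le _
  · rintro n ⟨_ | l, v, S⟩ c h1 h2
    · cases h2
    · obtain rfl := Option.some.inj h2
      refine (length_stepAux_le tm.k₁ (tm.m l) v S).trans ?_
      have h3 : pushes (tm.m l) ≤ ∑ l : tm.Λ, pushes (tm.m l) :=
        Finset.single_le_sum (f := fun l => pushes (tm.m l)) (fun _ _ => Nat.zero_le _)
          (Finset.mem_univ l)
      have h4 : (S tm.k₁).length ≤ s.length + (∑ l : tm.Λ, pushes (tm.m l)) * n := h1
      rw [Nat.mul_add]
      omega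

end SAL

namespace SAL

open Turing StateTransition

attribute [local instance] FinTM2.kFin FinTM2.ΛFin FinTM2.σFin

/-! ## A machine calling other machines -/

/-- Machines that are called as subroutines by a main program.  The data are kept, in reversed
order, on a stack with alphabet `H`.  The program writes `start`, calls a routine for each letter
of its input, then the routine `last`; the label `after i` tells how to continue after routine `i`
(`none` means that the data are the result). -/
structure Driver where
  ι : Type
  [fintypeι : Fintype ι]
  [decidableEqι : DecidableEq ι]
  R : ι → FinTM2
  H : Type
  [fintypeH : Fintype H]
  [inhabitedH : Inhabited H]
  inp : ∀ i, H → (R i).Γ (R i).k₀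
  out : ∀ i, (R i).Γ (R i).k₁ → H
  start : List H
  call : Bool → ι
  last : ι
  after : ι → Option (Option ι)
  res : H → Bool

attribute [instance] Driver.fintypeι Driver.decidableEqι Driver.fintypeH Driver.inhabitedH

namespace Driver

variable (D : Driver)

/-- Stacks: the data, the input, the output and the stackFun of the routines. -/
abbrev K : Type := Option Bool ⊕ Σ i, (D.R i).K

abbrev Γ : D.K → Type
  | .inl none => D.H
  | .inl (some _) => Bool
  | .inr p => (D.R p.1).Γ p.2

/-- Control labels of the main program. -/
abbrev Λ : Type := Option Bool ⊕ ((D.ι × Bool) ⊕ Σ i, (D.R i).Λ)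

abbrev σ : Type := (∀ i, (D.R i).σ) × Option D.H × Option Bool

variable {D}

abbrev begin' : D.Λ := .inl none
abbrev read : D.Λ := .inl (some false)
abbrev finish : D.Λ := .inl (some true)
abbrev enter (i : D.ι) : D.Λ := .inr (.inl (i, false))
abbrev leave (i : D.ι) : D.Λ := .inr (.inl (i, true))
abbrev within (i : D.ι) (l : (D.R i).Λ) : D.Λ := .inr (.inr ⟨i, l⟩)

/-- The label after routine `i`: the next letter, another routine, or the end. -/
def next (i : D.ι) : D.Λ :=
  match D.after i with
  | none => finish
  | some none => read
  | some (some j) => enter j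

/-- The statements of routine `i` as statements of the main program. -/
def embed (i : D.ι) : TM2.Stmt (D.R i).Γ (D.R i).Λ (D.R i).σ → TM2.Stmt D.Γ D.Λ D.σ
  | .push k f q => .push (.inr ⟨i, k⟩) (fun v => f (v.1 i)) (embed i q)
  | .peek k f q => .peek (.inr ⟨i, k⟩) (fun v x => (Function.update v.1 i (f (v.1 i) x), v.2))
      (embed i q)
  | .pop k f q => .pop (.inr ⟨i, k⟩) (fun v x => (Function.update v.1 i (f (v.1 i) x), v.2))
      (embed i q)
  | .load f q => .load (fun v => (Function.update v.1 i (f (v.1 i)), v.2)) (embed i q)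
  | .branch f q₁ q₂ => .branch (fun v => f (v.1 i)) (embed i q₁) (embed i q₂)
  | .goto l => .goto fun v => within i (l (v.1 i))
  -- Halting of a routine returns control to the main program.
  | .halt => .goto fun _ => leave i

/-- Pushing a list of data. -/
def pushData : List D.H → TM2.Stmt D.Γ D.Λ D.σ → TM2.Stmt D.Γ D.Λ D.σ
  | [], q => q
  | x :: l, q => .push (.inl none) (fun _ => x) (pushData l q)

/-- The program. -/
def program : D.Λ → TM2.Stmt D.Γ D.Λ D.σ
  | .inl none => pushData D.start (.goto fun _ => read)
  | .inl (some false) => .pop (.inl (some false)) (fun v x => (v.1, v.2.1, x))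
      (.goto fun v => v.2.2.elim (enter D.last) fun b => enter (D.call b))
  | .inl (some true) => .pop (.inl none) (fun v x => (v.1, x, v.2.2))
      (.branch (fun v => v.2.1.isSome)
        (.push (.inl (some true)) (fun v => D.res (v.2.1.getD default)) (.goto fun _ => finish))
        .halt)
  | .inr (.inl (i, false)) => .pop (.inl none) (fun v x => (v.1, x, v.2.2))
      (.branch (fun v => v.2.1.isSome)
        (.push (.inr ⟨i, (D.R i).k₀⟩) (fun v => D.inp i (v.2.1.getD default))
          (.goto fun _ => enter i))
        (.goto fun _ => within i (D.R i).main))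
  | .inr (.inl (i, true)) => .pop (.inr ⟨i, (D.R i).k₁⟩)
      (fun v x => (v.1, x.map (D.out i), v.2.2))
      (.branch (fun v => v.2.1.isSome)
        (.push (.inl none) (fun v => v.2.1.getD default) (.goto fun _ => leave i))
        (.goto fun _ => next i))
  | .inr (.inr ⟨i, l⟩) => embed i ((D.R i).m l)

variable (D) in
def machine : FinTM2 where
  K := D.K
  k₀ := .inl (some false)
  k₁ := .inl (some true)
  Γ := D.Γ
  Λ := D.Λ
  main := begin'
  σ := D.σ
  initialState := (fun i => (D.R i).initialState, none, none)
  Γk₀Fin := inferInstanceAs (Fintype Bool)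
  m := program

/-- The contents of the stacks. -/
def stackFun (h : List D.H) (w o : List Bool) (S : ∀ i k, List ((D.R i).Γ k)) :
    ∀ k : D.K, List (D.Γ k)
  | .inl none => h
  | .inl (some false) => w
  | .inl (some true) => o
  | .inr p => S p.1 p.2

theorem update_stackFun_data (h h' : List D.H) (w o : List Bool) (S : ∀ i k, List ((D.R i).Γ k)) :
    Function.update (stackFun h w o S) (.inl none) h' = stackFun h' w o S := by
  funext k
  rcases k with (_ | _ | _) | p <;> simp [stackFun, Function.update]

theorem update_stackFun_input (h : List D.H) (w w' o : List Bool)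
    (S : ∀ i k, List ((D.R i).Γ k)) :
    Function.update (stackFun h w o S) (.inl (some false)) w' = stackFun h w' o S := by
  funext k
  rcases k with (_ | _ | _) | p <;> simp [stackFun, Function.update]

theorem update_stackFun_output (h : List D.H) (w o o' : List Bool)
    (S : ∀ i k, List ((D.R i).Γ k)) :
    Function.update (stackFun h w o S) (.inl (some true)) o' = stackFun h w o' S := by
  funext k
  rcases k with (_ | _ | _) | p <;> simp [stackFun, Function.update]

theorem update_stackFun_routine (h : List D.H) (w o : List Bool) (S : ∀ i k, List ((D.R i).Γ k))
    (i : D.ι) (T : ∀ k, List ((D.R i).Γ k)) (k : (D.R i).K) (l : List ((D.R i).Γ k)) :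
    Function.update (stackFun h w o (Function.update S i T)) (.inr ⟨i, k⟩) l =
      stackFun h w o (Function.update S i (Function.update T k l)) := by
  funext k'
  rcases k' with (_ | _ | _) | ⟨j, k'⟩
  · simp [stackFun, Function.update]
  · simp [stackFun, Function.update]
  · simp [stackFun, Function.update]
  · by_cases hij : j = i
    · subst hij
      by_cases hk : k' = k
      · subst hk
        simp [stackFun]
      · rw [Function.update_of_ne (by simpa using hk)]
        simp [stackFun, hk]
    · rw [Function.update_of_ne (fun h => hij (by cases h; rfl))]
      simp [stackFun, hij]

theorem stackFun_routine (h : List D.H) (w o : List Bool) (S : ∀ i k, List ((D.R i).Γ k))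
    (i : D.ι) (T : ∀ k, List ((D.R i).Γ k)) (k : (D.R i).K) :
    stackFun h w o (Function.update S i T) (.inr ⟨i, k⟩) = T k := by
  simp [stackFun]

/-- A configuration of the main program in which routine `i` is in configuration `c`. -/
def lift (i : D.ι) (V : ∀ i, (D.R i).σ) (r : Option D.H × Option Bool) (h : List D.H)
    (w o : List Bool) (S : ∀ i k, List ((D.R i).Γ k))
    (c : TM2.Cfg (D.R i).Γ (D.R i).Λ (D.R i).σ) : TM2.Cfg D.Γ D.Λ D.σ :=
  ⟨some (c.l.elim (leave i) (within i)), (Function.update V i c.var, r),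
    stackFun h w o (Function.update S i c.stk)⟩

theorem stepAux_embed (i : D.ι) (V : ∀ i, (D.R i).σ) (r : Option D.H × Option Bool) (h : List D.H)
    (w o : List Bool) (S : ∀ i k, List ((D.R i).Γ k)) :
    ∀ (q : TM2.Stmt (D.R i).Γ (D.R i).Λ (D.R i).σ) (v : (D.R i).σ) (T : ∀ k, List ((D.R i).Γ k)),
      TM2.stepAux (embed i q) (Function.update V i v, r) (stackFun h w o (Function.update S i T)) =
        lift i V r h w o S (TM2.stepAux q v T)
  | .push k f q, v, T => by
      rw [embed, TM2.stepAux, stackFun_routine, update_stackFun_routine, stepAux_embed i V r h w o S q]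
      simp
  | .peek k f q, v, T => by
      rw [embed, TM2.stepAux, stackFun_routine]
      simp only [Function.update_self, Function.update_idem]
      exact stepAux_embed i V r h w o S q _ _
  | .pop k f q, v, T => by
      rw [embed, TM2.stepAux, stackFun_routine, update_stackFun_routine]
      simp only [Function.update_self, Function.update_idem]
      exact stepAux_embed i V r h w o S q _ _
  | .load f q, v, T => by
      rw [embed, TM2.stepAux]
      simp only [Function.update_self, Function.update_idem]
      exact stepAux_embed i V r h w o S q _ _
  | .branch f q₁ q₂, v, T => by
      simp only [embed, TM2.stepAux, Function.update_self]
      cases f v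
      · exact stepAux_embed i V r h w o S q₂ _ _
      · exact stepAux_embed i V r h w o S q₁ _ _
  | .goto l, v, T => by
      simp [embed, TM2.stepAux, lift]
  | .halt, v, T => by
      simp [embed, TM2.stepAux, lift]

variable (D) in
/-- The step function of the main program. -/
def run : TM2.Cfg D.Γ D.Λ D.σ → Option (TM2.Cfg D.Γ D.Λ D.σ) := TM2.step program

theorem run_eq (l : D.Λ) (v : D.σ) (S : ∀ k, List (D.Γ k)) :
    D.run ⟨some l, v, S⟩ = some (TM2.stepAux (program l) v S) := rfl

/-- The steps of a routine are steps of the main program. -/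
theorem stepsTo_lift (i : D.ι) (V : ∀ i, (D.R i).σ) (r : Option D.H × Option Bool) (h : List D.H)
    (w o : List Bool) (S : ∀ i k, List ((D.R i).Γ k)) {n : ℕ} {c d : (D.R i).Cfg}
    (hs : StepsTo (D.R i).step n c d) :
    StepsTo D.run n (lift i V r h w o S c) (lift i V r h w o S d) := by
  refine hs.map (tr := lift i V r h w o S) ?_
  rintro ⟨_ | l, v, T⟩ c hc
  · cases hc
  · obtain rfl := Option.some.inj hc
    exact congrArg some (stepAux_embed i V r h w o S ((D.R i).m l) v T)

/-- Configurations of the main program between calls. -/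
def cfg (l : D.Λ) (x : Option D.H) (r : Option Bool) (h : List D.H) (w o : List Bool) :
    TM2.Cfg D.Γ D.Λ D.σ :=
  ⟨some l, (fun i => (D.R i).initialState, x, r), stackFun h w o fun _ _ => []⟩

/-- Configurations of the main program where exactly one stack of the routines is in use. -/
def cfgAt (l : D.Λ) (x : Option D.H) (r : Option Bool) (h : List D.H) (w o : List Bool)
    (i : D.ι) (k : (D.R i).K) (s : List ((D.R i).Γ k)) : TM2.Cfg D.Γ D.Λ D.σ :=
  ⟨some l, (fun i => (D.R i).initialState, x, r),
    stackFun h w o (Function.update (fun _ _ => []) i (Function.update (fun _ => []) k s))⟩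

theorem cfgAt_nil (l : D.Λ) (x : Option D.H) (r : Option Bool) (h : List D.H) (w o : List Bool)
    (i : D.ι) (k : (D.R i).K) : cfgAt l x r h w o i k [] = cfg l x r h w o := by
  have h1 : Function.update (fun _ => []) k [] = (fun k => [] : ∀ k, List ((D.R i).Γ k)) :=
    Function.update_eq_self k _
  have h2 : Function.update (fun _ _ => []) i (fun _ => []) =
      (fun _ _ => [] : ∀ i k, List ((D.R i).Γ k)) := Function.update_eq_self i _
  rw [cfgAt, cfg, h1, h2]

/-- Moving letters between stacks reverses them, so the reversed data arrive in the right order. The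
additional step is the pop that finds the stack empty. -/
theorem stepsTo_enter (r : Option Bool) (w o : List Bool) (i : D.ι) : ∀ (h : List D.H)
    (x : Option D.H) (s : List ((D.R i).Γ (D.R i).k₀)),
    StepsTo D.run (h.length + 1) (cfgAt (enter i) x r h w o i _ s)
      (cfgAt (within i (D.R i).main) none r [] w o i _ ((h.map (D.inp i)).reverse ++ s))
  | [], x, s => by
      refine StepsTo.single ?_
      rw [cfgAt, run_eq, program, TM2.stepAux, update_stackFun_data]
      rfl
  | y :: h, x, s => by
      refine StepsTo.head (b := cfgAt (enter i) (some y) r h w o i _ (D.inp i y :: s)) ?_ ?_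
      · rw [cfgAt, run_eq, program, TM2.stepAux, update_stackFun_data]
        simp only [TM2.stepAux, stackFun, List.head?_cons, Option.isSome_some, cond_true,
          List.tail_cons, Option.getD_some, Function.update_self, update_stackFun_routine,
          Function.update_idem]
        rfl
      · have h1 := stepsTo_enter r w o i h (some y) (D.inp i y :: s)
        simpa using h1

theorem stepsTo_leave (r : Option Bool) (w o : List Bool) (i : D.ι) :
    ∀ (s : List ((D.R i).Γ (D.R i).k₁)) (x : Option D.H) (h : List D.H),
    StepsTo D.run (s.length + 1) (cfgAt (leave i) x r h w o i _ s)
      (cfg (next i) none r ((s.map (D.out i)).reverse ++ h) w o)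
  | [], x, h => by
      refine StepsTo.single ?_
      rw [cfgAt, run_eq, program, TM2.stepAux, update_stackFun_routine, stackFun_routine]
      simp only [TM2.stepAux, Function.update_self, List.head?_nil, Option.map_none,
        Option.isSome_none, cond_false, List.tail_nil, Function.update_idem]
      exact congrArg some (cfgAt_nil (next i) none r h w o i _)
  | y :: s, x, h => by
      refine StepsTo.head (b := cfgAt (leave i) (some (D.out i y)) r (D.out i y :: h) w o i _ s) ?_ ?_
      · rw [cfgAt, run_eq, program, TM2.stepAux, update_stackFun_routine, stackFun_routine]
        simp only [TM2.stepAux, Function.update_self, List.head?_cons, Option.map_some,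
          Option.isSome_some, cond_true, List.tail_cons, Option.getD_some, Function.update_idem,
          update_stackFun_data]
        rfl
      · have h1 := stepsTo_leave r w o i s (some (D.out i y)) (D.out i y :: h)
        simpa using h1

/-- A call of a routine. -/
theorem stepsTo_call (r : Option Bool) (w o : List Bool) (i : D.ι) {x y : List D.H}
    {s : List ((D.R i).Γ (D.R i).k₁)} {t : ℕ} (hs : s.map (D.out i) = y)
    (h : Nonempty (TM2OutputsInTime (D.R i) (x.map (D.inp i)) (some s) t)) :
    StepsTo D.run (x.length + t + y.length + 2) (cfg (enter i) none r x.reverse w o)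
      (cfg (next i) none r y.reverse w o) := by
  have h1 := stepsTo_enter r w o i x.reverse none []
  have h2 := stepsTo_lift i (fun i => (D.R i).initialState) (none, r) [] w o (fun _ _ => []) h
  have h3 := stepsTo_leave r w o i s none []
  have h4 : lift i (fun i => (D.R i).initialState) (none, r) [] w o (fun _ _ => [])
      (initList (D.R i) (x.map (D.inp i))) =
      cfgAt (within i (D.R i).main) none r [] w o i _ (x.map (D.inp i)) := by
    unfold lift cfgAt
    rw [initList_stk]
    simp [initList]
  -- A halting configuration has the initial internal state and all stacks but the output empty, so
  -- the routine can be called again.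
  have h5 : lift i (fun i => (D.R i).initialState) (none, r) [] w o (fun _ _ => [])
      (haltList (D.R i) s) = cfgAt (leave i) none r [] w o i _ s := by
    unfold lift cfgAt
    rw [haltList_stk]
    simp [haltList]
  rw [h4, h5] at h2
  rw [cfgAt_nil, List.append_nil, List.map_reverse, List.reverse_reverse] at h1
  rw [hs, List.append_nil] at h3
  refine ((h1.trans h2).trans h3).mono ?_
  rw [← hs, List.length_map, List.length_reverse]
  omega

theorem stepsTo_finish (r : Option Bool) : ∀ (h : List D.H) (x : Option D.H) (o : List Bool),
    StepsTo D.run (h.length + 1) (cfg finish x r h [] o)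
      ⟨none, (fun i => (D.R i).initialState, none, r),
        stackFun [] [] ((h.map D.res).reverse ++ o) fun _ _ => []⟩
  | [], x, o => by
      refine StepsTo.single ?_
      rw [cfg, run_eq, program, TM2.stepAux, update_stackFun_data]
      rfl
  | y :: h, x, o => by
      refine StepsTo.head (b := cfg finish (some y) r h [] (D.res y :: o)) ?_ ?_
      · rw [cfg, run_eq, program, TM2.stepAux, update_stackFun_data]
        simp only [TM2.stepAux, stackFun, List.head?_cons, Option.isSome_some, cond_true,
          List.tail_cons, Option.getD_some, update_stackFun_output]
        rfl
      · have h1 := stepsTo_finish r h (some y) (D.res y :: o)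
        simpa using h1

theorem stepAux_pushData (q : TM2.Stmt D.Γ D.Λ D.σ) (v : D.σ) (w o : List Bool)
    (S : ∀ i k, List ((D.R i).Γ k)) : ∀ l h : List D.H,
    TM2.stepAux (pushData l q) v (stackFun h w o S) =
      TM2.stepAux q v (stackFun (l.reverse ++ h) w o S)
  | [], h => rfl
  | x :: l, h => by
      rw [pushData, TM2.stepAux, update_stackFun_data, stepAux_pushData]
      simp [stackFun]

theorem stepsTo_begin (w : List Bool) :
    StepsTo D.run 1 (cfg begin' none none [] w []) (cfg read none none D.start.reverse w []) := by
  refine StepsTo.single ?_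
  rw [cfg, run_eq, program, stepAux_pushData, List.append_nil]
  rfl

theorem stepsTo_read (r : Option Bool) (h : List D.H) (w o : List Bool) :
    StepsTo D.run 1 (cfg read none r h w o) (cfg (w.head?.elim (enter D.last) fun b =>
      enter (D.call b)) none w.head? h w.tail o) := by
  refine StepsTo.single ?_
  rw [cfg, run_eq, program, TM2.stepAux, update_stackFun_input]
  rfl

/-- Calling a routine for each letter. -/
theorem stepsTo_loop (hnext : ∀ b, D.after (D.call b) = some none) (Y : List Bool → List D.H)
    (B : ℕ) : ∀ (v w : List Bool) (r : Option Bool),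
    (∀ u b u', w = u ++ b :: u' → StepsTo D.run B
      (cfg (enter (D.call b)) none (some b) (Y (v ++ u)).reverse u' [])
      (cfg (next (D.call b)) none (some b) (Y (v ++ u ++ [b])).reverse u' [])) →
    StepsTo D.run (w.length * (B + 1) + 1) (cfg read none r (Y v).reverse w [])
      (cfg (enter D.last) none none (Y (v ++ w)).reverse [] [])
  | v, [], r, _ => by
      have h1 := stepsTo_read r (Y v).reverse [] []
      rw [List.append_nil, List.length_nil, Nat.zero_mul, Nat.zero_add]
      exact h1
  | v, b :: w, r, h => by
      have h1 := stepsTo_read r (Y v).reverse (b :: w) []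
      have h2 := h [] b w rfl
      rw [List.append_nil] at h2
      have h3 := stepsTo_loop hnext Y B (v ++ [b]) w (some b) fun u c u' hw => by
        have h4 := h (b :: u) c u' (by rw [hw]; rfl)
        simpa using h4
      have h5 : next (D.call b) = read := by rw [next, hnext]
      rw [h5] at h2
      have h6 := (h1.trans h2).trans h3
      rw [List.append_assoc] at h6
      refine h6.mono ?_
      rw [List.length_cons, Nat.add_mul]
      omega

theorem outputs_of_stepsTo {w y : List Bool} {x : List D.H} {n : ℕ} (hy : x.map D.res = y)
    (h : StepsTo D.run n (cfg begin' none none [] w []) (cfg finish none none x.reverse [] [])) :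
    Nonempty (TM2OutputsInTime D.machine w (some y) (n + x.length + 1)) := by
  subst hy
  have h1 := h.trans (stepsTo_finish none x.reverse none [])
  rw [List.append_nil, List.map_reverse, List.reverse_reverse, List.length_reverse] at h1
  have h2 : initList D.machine w = cfg begin' none none [] w [] := by
    have h3 : (initList D.machine w).stk = (cfg (D := D) begin' none none [] w []).stk := by
      refine (initList_stk D.machine w).trans ?_
      have h4 := update_stackFun_input (D := D) [] [] w [] fun _ _ => []
      refine Eq.trans ?_ h4
      congr 1
      funext k
      rcases k with (_ | _ | _) | p <;> rfl
    exact congrArg (fun S => (⟨some begin', (fun i => (D.R i).initialState, none, none), S⟩ :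
      TM2.Cfg D.Γ D.Λ D.σ)) h3
  have h5 : haltList D.machine (x.map D.res) = ⟨none, (fun i => (D.R i).initialState, none, none),
        stackFun [] [] (x.map D.res) fun _ _ => []⟩ := by
    have h3 : (haltList D.machine (x.map D.res)).stk =
        stackFun (D := D) [] [] (x.map D.res) fun _ _ => [] := by
      refine (haltList_stk D.machine (x.map D.res)).trans ?_
      have h4 := update_stackFun_output (D := D) [] [] [] (x.map D.res) fun _ _ => []
      refine Eq.trans ?_ h4
      congr 1
      funext k
      rcases k with (_ | _ | _) | p <;> rfl
    exact congrArg (fun S => (⟨none, (fun i => (D.R i).initialState, none, none), S⟩ :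
      TM2.Cfg D.Γ D.Λ D.σ)) h3
  have h6 : StepsTo D.run (n + (x.length + 1)) (initList D.machine w)
      (haltList D.machine (x.map D.res)) := by
    rw [h2, h5]
    exact h1
  exact h6

end Driver
end SAL

namespace SAL

open Turing StateTransition

/-! ## Polynomial time by iteration -/

/-- The program that iterates `M b` over the letters `b` of the input and then applies `N` and
`Q`. -/
abbrev foldDriver {S : Type} [Fintype S] [Inhabited S] (M : Bool → TM2ComputableAux S S)
    (N : TM2ComputableAux S S) (Q : TM2ComputableAux S Bool) (start : List S) : Driver where
  ι := Option (Option Bool)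
  R
    | some (some b) => (M b).tm
    | some none => N.tm
    | none => Q.tm
  -- The last routine writes letters of another alphabet on the same stack. The defaults are for
  -- letters of the wrong kind, which never reach a routine.
  H := S ⊕ Bool
  inp
    | some (some b) => Sum.elim (M b).inputAlphabet.symm fun _ => (M b).inputAlphabet.symm default
    | some none => Sum.elim N.inputAlphabet.symm fun _ => N.inputAlphabet.symm default
    | none => Sum.elim Q.inputAlphabet.symm fun _ => Q.inputAlphabet.symm default
  out
    | some (some b) => fun x => .inl ((M b).outputAlphabet x)
    | some none => fun x => .inl (N.outputAlphabet x)
    | none => fun x => .inr (Q.outputAlphabet x)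
  start := start.map .inl
  call b := some (some b)
  last := some none
  after
    | some (some _) => some none
    | some none => some (some none)
    | none => none
  res := Sum.elim (fun _ => false) id

/-- The machine `M` outputs `y` on input `x` in time `t`. -/
def Outputs {S T : Type} (M : TM2ComputableAux S T) (x : List S) (y : List T) (t : ℕ) : Prop :=
  Nonempty (TM2OutputsInTime M.tm (x.map M.inputAlphabet.invFun)
    (some (y.map M.outputAlphabet.invFun)) t)

theorem exists_length_le {S T : Type} (M : TM2ComputableAux S T) : ∃ C : ℕ, ∀ x y t,
    Outputs M x y t → y.length ≤ x.length + C * t := by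
  obtain ⟨C, hC⟩ := exists_output_length_le M.tm
  refine ⟨C, fun x y t h => ?_⟩
  have h1 := hC _ _ _ h
  simpa using h1

/-- The time of each call of `M b` is bounded in terms of `w.length`, not of the length of `Y w`. So
each call lengthens the data by a polynomial amount, and the iteration stays polynomial. -/
theorem polyTime_of_machines {S : Type} [Fintype S] [Inhabited S]
    (M : Bool → TM2ComputableAux S S) (N : TM2ComputableAux S S) (Q : TM2ComputableAux S Bool)
    (Y Z : List Bool → List S) (f : List Bool → List Bool) (p q : Polynomial ℕ)
    (hM : ∀ w b, Outputs (M b) (Y w) (Y (w ++ [b])) (p.eval w.length))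
    (hN : ∀ w, Outputs N (Y w) (Z w) (p.eval w.length))
    (hQ : ∀ w, Outputs Q (Z w) (f w) (q.eval (Z w).length)) : PolyTime f := by
  choose C hC using fun b => exists_length_le (M b)
  obtain ⟨CN, hCN⟩ := exists_length_le N
  obtain ⟨CQ, hCQ⟩ := exists_length_le Q
  let c := C true + C false
  have hY : ∀ w, (Y w).length ≤ (Y []).length + w.length * (c * p.eval w.length) := by
    intro w
    induction w using List.reverseRecOn with
    | nil => exact Nat.le_add_right _ _
    | append_singleton w b ih =>
        have h1 := hC b _ _ _ (hM w b)
        have h2 : p.eval w.length ≤ p.eval (w.length + 1) := eval_mono p (Nat.le_succ _)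
        have h3 : C b * p.eval w.length ≤ c * p.eval (w.length + 1) :=
          Nat.mul_le_mul (by cases b <;> simp [c]) h2
        have h4 : w.length * (c * p.eval w.length) ≤ w.length * (c * p.eval (w.length + 1)) :=
          Nat.mul_le_mul_left _ (Nat.mul_le_mul_left _ h2)
        rw [List.length_append, List.length_singleton, Nat.add_mul]
        omega
  let LY : Polynomial ℕ := .C (Y []).length + .X * (.C c * p)
  let LZ : Polynomial ℕ := LY + .C CN * p
  let Lf : Polynomial ℕ := LZ + .C CQ * q.comp LZ
  have hLY : ∀ w n, w.length ≤ n → (Y w).length ≤ LY.eval n := by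
    intro w n hn
    refine le_trans ?_ (eval_mono LY hn)
    simpa [LY] using hY w
  have hLZ : ∀ w, (Z w).length ≤ LZ.eval w.length := by
    intro w
    have h1 := hCN _ _ _ (hN w)
    have h2 := hLY w _ (le_refl _)
    simp only [LZ, Polynomial.eval_add, Polynomial.eval_mul, Polynomial.eval_C]
    omega
  have hqZ : ∀ w, q.eval (Z w).length ≤ q.eval (LZ.eval w.length) := fun w => eval_mono q (hLZ w)
  have hLf : ∀ w, (f w).length ≤ Lf.eval w.length := by
    intro w
    have h1 := hCQ _ _ _ (hQ w)
    have h2 := hLZ w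
    have h3 := Nat.mul_le_mul_left CQ (hqZ w)
    simp only [Lf, Polynomial.eval_add, Polynomial.eval_mul, Polynomial.eval_C,
      Polynomial.eval_comp]
    omega
  let D := foldDriver M N Q (Y [])
  -- The summands are the start, the loop over the letters, the calls of `N` and `Q`, and the
  -- copying of the result. Each call costs its running time plus the lengths of its input and
  -- output, which are moved letter by letter.
  let T : Polynomial ℕ := 1 + (.X * (LY + p + LY + 2 + 1) + 1) + (LY + p + LZ + 2) +
    (LZ + q.comp LZ + Lf + 2) + Lf + 1
  have hrun : ∀ w : List Bool, Nonempty (TM2OutputsInTime D.machine w (some (f w)) (T.eval w.length)) := by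
    intro w
    have hbegin := Driver.stepsTo_begin (D := D) w
    have hloop := Driver.stepsTo_loop (D := D) (fun b => rfl) (fun u => (Y u).map .inl)
      ((LY + p + LY + 2).eval w.length) [] w none (by
        rintro u b u' rfl
        refine (Driver.stepsTo_call (D := D) (some b) u' [] (some (some b))
          (x := (Y u).map .inl) (y := (Y (u ++ [b])).map .inl)
          (s := (Y (u ++ [b])).map (M b).outputAlphabet.invFun) (t := p.eval u.length) ?_ ?_).mono ?_
        · simp [D]
        · have h1 := hM u b
          simpa [D, Outputs] using h1
        · have h1 : u.length ≤ (u ++ b :: u').length := by simp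
          have h2 := hLY u _ h1
          have h3 := hLY (u ++ [b]) (u ++ b :: u').length (by simp)
          have h4 := eval_mono p h1
          simp only [List.length_map, Polynomial.eval_add, Polynomial.eval_ofNat]
          omega)
    have hlast := Driver.stepsTo_call (D := D) none [] [] (some none)
      (x := (Y w).map .inl) (y := (Z w).map .inl)
      (s := (Z w).map N.outputAlphabet.invFun) (t := p.eval w.length) (by simp [D])
      (by simpa [D, Outputs] using hN w)
    have hinv := Driver.stepsTo_call (D := D) none [] [] none
      (x := (Z w).map .inl) (y := (f w).map .inr)
      (s := (f w).map Q.outputAlphabet.invFun) (t := q.eval (Z w).length) (by simp [D])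
      (by simpa [D, Outputs] using hQ w)
    have hall := ((hbegin.trans hloop).trans hlast).trans hinv
    obtain ⟨h⟩ := Driver.outputs_of_stepsTo (y := f w) (by simp [D]) hall
    refine ⟨⟨h.toEvalsTo, h.steps_le_m.trans ?_⟩⟩
    have h2 := hLY w _ (le_refl _)
    have h3 := hLZ w
    have h4 := hLf w
    have h5 := hqZ w
    simp only [T, List.length_map, Polynomial.eval_add, Polynomial.eval_mul, Polynomial.eval_X,
      Polynomial.eval_comp, Polynomial.eval_one, Polynomial.eval_ofNat]
    omega
  exact ⟨{ tm := D.machine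
           inputAlphabet := Equiv.refl Bool
           outputAlphabet := Equiv.refl Bool
           time := T
           outputsFun := fun w => by
            have h := (hrun w).some
            have h1 : ∀ u : List Bool, u.map (Equiv.refl Bool).invFun = u := fun u => by simp
            exact (h1 (id w)).symm ▸ (h1 (id (f w))).symm ▸ h }⟩

/-- Over an empty alphabet there is only one word, which contradicts the injectivity of `Phi`. -/
theorem CompModel.sym_nonempty (K : CompModel) : Nonempty K.Sym := by
  by_contra h
  rw [not_nonempty_iff] at h
  have h1 : K.Phi [] = K.Phi [true] := Subtype.ext (Subsingleton.elim _ _)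
  exact absurd (K.Phi_injective h1) (by simp)

/-- Iterating algorithms over the letters of a word takes polynomial time when the lengths of the
intermediate results grow linearly. -/
theorem polyTime_of_algorithms (K : CompModel) (f : List Bool → List Bool) (U : List Bool → K.L)
    (E : Bool → K.L) (V : K.L) (n : ℕ) (p : Polynomial ℕ)
    (hE : ∀ w b, K.Eval (E b) (U w) (U (w ++ [b])) n) (hU : ∀ w, K.size (U w) ≤ n * w.length + n)
    (hV : ∀ w, K.Eval V (U w) (K.Phi (f w)) (p.eval w.length)) : PolyTime f := by
  obtain ⟨P, hP⟩ := K.exists_machine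
  choose M hM using hP
  obtain ⟨Q⟩ := K.Phi_inv_polyTime
  have := K.symFintype
  have := Classical.inhabited_of_nonempty K.sym_nonempty
  -- The polynomial of the model is evaluated at the sum of abstract time, code size and input size,
  -- and the size of `U w` is at most `n * w.length + n`.
  let r : Polynomial ℕ := P.comp (.C n + .C (K.size (E true) + K.size (E false) + K.size V) +
    (.C n * .X + .C n) + p)
  refine polyTime_of_machines (fun b => M (E b)) (M V) Q.toTM2ComputableAux
    (fun w => (U w : List K.Sym))
    (fun w => (K.Phi (f w) : List K.Sym)) f r Q.time (fun w b => ?_) (fun w => ?_) fun w => ?_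
  · obtain ⟨h⟩ := hM (E b) _ _ (hE w b).1
    refine ⟨⟨h.toEvalsTo, h.steps_le_m.trans ?_⟩⟩
    have h1 := (hE w b).2
    have h2 := hU w
    have h3 : K.size (E b) ≤ K.size (E true) + K.size (E false) := by cases b <;> omega
    simp only [r, Polynomial.eval_add, Polynomial.eval_mul, Polynomial.eval_X, Polynomial.eval_C,
      Polynomial.eval_comp]
    exact eval_mono P (by omega)
  · obtain ⟨h⟩ := hM V _ _ (hV w).1
    refine ⟨⟨h.toEvalsTo, h.steps_le_m.trans ?_⟩⟩
    have h1 := (hV w).2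
    have h2 := hU w
    simp only [r, Polynomial.eval_add, Polynomial.eval_mul, Polynomial.eval_X, Polynomial.eval_C,
      Polynomial.eval_comp]
    exact eval_mono P (by omega)
  · exact ⟨Q.outputsFun (f w)⟩

end SAL

/-! ### The soundness theorem. -/

theorem mainTheorem3 (K : SAL.CompModel) (η : ℕ → SAL.SoftSpace K) (j k : ℕ)
    (π : SAL.Proof [] (SAL.Formula.limp (SAL.Formula.bangN j SAL.Formula.listSAL)
      (SAL.Formula.bangN k SAL.Formula.listSAL))) :
    (∃! f : List Bool → List Bool, SAL.Induces η π f) ∧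
      ∀ f : List Bool → List Bool, SAL.Induces η π f → SAL.PolyTime f := by
  obtain ⟨f, hf, huniq, U, E, V, n, p, hE, hU, hV⟩ := SAL.exists_algorithm η π
  refine ⟨⟨f, hf, huniq⟩, fun g hg => ?_⟩
  rw [huniq g hg]
  exact SAL.polyTime_of_algorithms K f U E V n p hE hU hV
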